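/- Let $n\ge 1$, let $\mathbb B_n$ and $\mathbb S_n$ be the open unit ball and the unit sphere of $\mathbb C^n$, $\langle z,w\rangle=\sum_i z_i\overline{w_i}$, let $dV_n$ be Lebesgue measure on $\mathbb B_n$ with $V_n(\mathbb B_n)=1$ and $\sigma$ the surface measure on $\mathbb S_n$ with $\sigma(\mathbb S_n)=1$. Fix $\gamma>1$ and put $\Gamma(\zeta)=\{z\in\mathbb B_n: |1-\langle z,\zeta\rangle|<\frac{\gamma}{2}(1-|z|^2)\}$ for $\zeta\in\mathbb S_n$, and $Q(u)=\{z\in\mathbb B_n:|1-\langle z,u/|u|\rangle|<1-|u|^2\}$ for $0\ne u\in\mathbb B_n$, $Q(0)=\mathbb B_n$. For $1<q<\infty$ and $\alpha>-n-1$, let $\mathcal{CT}_{q,\alpha}(\mathbb B_n)$ be the space of holomorphic functions $f$ on $\mathbb B_n$ with $$\|f\|_{\mathcal{CT}_{q,\alpha}(\mathbb B_n)}=\operatorname*{ess\,sup}_{\zeta\in\mathbb S_n}\Big(\sup_{u\in\Gamma(\zeta)}\frac1{(1-|u|^2)^n}\int_{Q(u)}|f(z)|^q(1-|z|^2)^{n+\alpha}\,dV_n(z)\Big)^{1/q}<\infty,$$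 the essential supremum being with respect to $\sigma$. **Theorem.** Let $1<q<\infty$, $\alpha>-n-1$ and let $s,t$ be real numbers such that neither $n+s$ nor $n+s+t$ is a negative integer and $qt+n+1+\alpha>0$. Then there is a unique linear operator $R^{s,t}$ on the space of holomorphic functions on $\mathbb B_n$ that is continuous for the topology of uniform convergence on compact sets and satisfies $$R^{s,t}\frac1{(1-\langle z,w\rangle)^{n+1+s}}=\frac1{(1-\langle z,w\rangle)^{n+1+s+t}}\qquad(w\in\mathbb B_n)$$ as functions of $z$. A holomorphic function $f$ on $\mathbb B_n$ belongs to $\mathcal{CT}_{q,\alpha}(\mathbb B_n)$ if and only if $R^{s,t}f$ belongs to $\mathcal{CT}_{q,\alpha+qt}(\mathbb B_n)$. Moreover, there are constants $c,C>0$, independent of $f$, such that $$c\,\|f\|_{\mathcal{CT}_{q,\alpha}(\mathbb B_n)}\le\|R^{s,t}f\|_{\mathcal{CT}_{q,\alpha+qt}(\mathbb B_n)}\le C\,\|f\|_{\mathcal{CT}_{q,\alpha}(\mathbb B_n)}\qquad\text{for all } f\in\mathcal{CT}_{q,\alpha}(\mathbb B_n).$$ -/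

import Mathlib

open MeasureTheory Metric
open scoped ENNReal

noncomputable section

namespace HoloTent

/-- Complex Euclidean space `ℂⁿ` with the norm `|z| = (∑ |z_i|²)^(1/2)`. -/
abbrev Cn (n : ℕ) : Type := EuclideanSpace ℂ (Fin n)

/-- The open unit ball of `ℂⁿ`, as a type of points. -/
abbrev Ball (n : ℕ) : Type := ↥(ball (0 : Cn n) 1)

/-- The unit sphere of `ℂⁿ`, as a type of points. -/
abbrev Sphere (n : ℕ) : Type := ↥(sphere (0 : Cn n) 1)

/-- `⟨z, w⟩ = ∑ i, z_i * conj (w_i)`: linear in the first argument, whereas Mathlib's inner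
product is linear in the second one. -/
def herm {n : ℕ} (z w : Cn n) : ℂ := inner ℂ w z

/-- Lebesgue measure on the unit ball, normalized to have total mass `1`. -/
def ballMeasure (n : ℕ) : Measure (Ball n) :=
  (volume (ball (0 : Cn n) 1))⁻¹ • (volume : Measure (Cn n)).comap Subtype.val

/-- Surface measure on the unit sphere, normalized to have total mass `1`. -/
def sphereMeasure (n : ℕ) : Measure (Sphere n) :=
  ((volume : Measure (Cn n)).toSphere Set.univ)⁻¹ • (volume : Measure (Cn n)).toSphere

/-! ### Holomorphic functions on the ball -/

/-- The space of holomorphic functions on the unit ball. As a subspace of `C(Ball n, ℂ)` it carries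
the compact-open topology, that is, the topology of uniform convergence on compact sets. -/
def HolBall (n : ℕ) : Submodule ℂ C(Ball n, ℂ) where
  carrier := {f | ∃ F : Cn n → ℂ, DifferentiableOn ℂ F (ball 0 1) ∧ ∀ z : Ball n, f z = F z}
  add_mem' := by
    rintro f g ⟨F, hF, hf⟩ ⟨G, hG, hg⟩
    exact ⟨F + G, hF.add hG, fun z => by simp [hf, hg]⟩
  zero_mem' := ⟨0, differentiableOn_const 0, fun z => by simp⟩
  smul_mem' := by
    rintro c f ⟨F, hF, hf⟩
    exact ⟨c • F, hF.const_smul c, fun z => by simp [hf]⟩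

lemma one_sub_herm_mem_slitPlane {n : ℕ} {z w : Cn n} (hz : z ∈ ball (0 : Cn n) 1)
    (hw : w ∈ ball (0 : Cn n) 1) : 1 - herm z w ∈ Complex.slitPlane := by
  have hz' : ‖z‖ < 1 := by simpa using hz
  have hw' : ‖w‖ < 1 := by simpa using hw
  have h1 : ‖herm z w‖ ≤ ‖w‖ * ‖z‖ := norm_inner_le_norm w z
  have h2 : ‖w‖ * ‖z‖ < 1 := mul_lt_one_of_nonneg_of_lt_one_left (norm_nonneg _) hw' hz'.le
  have h3 : (herm z w).re ≤ ‖herm z w‖ := Complex.re_le_norm _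
  left
  simp only [Complex.sub_re, Complex.one_re]
  linarith

lemma differentiableOn_kernel {n : ℕ} (c : ℝ) (w : Ball n) :
    DifferentiableOn ℂ (fun z : Cn n => 1 / (1 - herm z w) ^ (c : ℂ)) (ball 0 1) := by
  have hlin : Differentiable ℂ (fun z : Cn n => 1 - herm z (w : Cn n)) :=
    (differentiable_const 1).sub (innerSL ℂ (w : Cn n)).differentiable
  have hpow : DifferentiableOn ℂ (fun z : Cn n => (1 - herm z (w : Cn n)) ^ (c : ℂ))
      (ball 0 1) :=
    hlin.differentiableOn.cpow (differentiableOn_const _)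
      fun z hz => one_sub_herm_mem_slitPlane hz w.2
  simp only [one_div]
  refine hpow.fun_inv fun z hz h => ?_
  exact Complex.slitPlane_ne_zero (one_sub_herm_mem_slitPlane hz w.2)
    ((Complex.cpow_eq_zero_iff _ _).1 h).1

/-- The holomorphic function `z ↦ 1 / (1 - ⟨z, w⟩) ^ c` (principal branch; `1 - ⟨z, w⟩` has positive
real part). -/
def kernel (n : ℕ) (c : ℝ) (w : Ball n) : HolBall n :=
  ⟨⟨fun z => 1 / (1 - herm (z : Cn n) w) ^ (c : ℂ),
      continuousOn_iff_continuous_domRestrict.1 (differentiableOn_kernel c w).continuousOn⟩,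
    _, differentiableOn_kernel c w, fun _ => rfl⟩

/-! ### Fractional differential operators -/

/-- `R` is a continuous linear operator on the space of holomorphic functions with
`R (1 / (1 - ⟨z, w⟩)^(n+1+s)) = 1 / (1 - ⟨z, w⟩)^(n+1+s+t)` for all `w` in the ball. -/
def IsFracDiff (n : ℕ) (s t : ℝ) (R : HolBall n →L[ℂ] HolBall n) : Prop :=
  ∀ w : Ball n, R (kernel n (n + 1 + s) w) = kernel n (n + 1 + s + t) w

open Classical in
/-- The fractional differential operator `R^{s,t}`: the unique operator with `IsFracDiff n s t`.
(The value `0` is a placeholder for parameters without a unique such operator.) -/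
def fracDiff (n : ℕ) (s t : ℝ) : HolBall n →L[ℂ] HolBall n :=
  if h : ∃! R : HolBall n →L[ℂ] HolBall n, IsFracDiff n s t R then h.choose else 0

/-! ### The Hardy-Carleson type spaces -/

/-- The admissible (Korányi) approach region `Γ_γ(ζ)`. -/
def korany {n : ℕ} (γ : ℝ) (ζ : Sphere n) : Set (Ball n) :=
  {z | ‖1 - herm (z : Cn n) (ζ : Cn n)‖ < γ / 2 * (1 - ‖(z : Cn n)‖ ^ 2)}

open Classical in
/-- The Carleson tube `Q(u) = {z : |1 - ⟨z, u/|u|⟩| < 1 - |u|²}`, with `Q(0)` the whole ball. -/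
def tube {n : ℕ} (u : Ball n) : Set (Ball n) :=
  if (u : Cn n) = 0 then Set.univ
  else {z | ‖1 - herm (z : Cn n) (((‖(u : Cn n)‖⁻¹ : ℝ) : ℂ) • (u : Cn n))‖
    < 1 - ‖(u : Cn n)‖ ^ 2}

/-- The norm `ess sup_ζ (sup_{u ∈ Γ(ζ)} (1-|u|²)^{-n} ∫_{Q(u)} |f|^q (1-|z|²)^{n+α} dV)^{1/q}`,
with values in `[0, ∞]`. -/
def ctNorm {n : ℕ} (γ q α : ℝ) (f : HolBall n) : ℝ≥0∞ :=
  essSup (fun ζ : Sphere n =>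
    (⨆ u ∈ korany γ ζ, ENNReal.ofReal (1 / (1 - ‖(u : Cn n)‖ ^ 2) ^ n) *
      ∫⁻ z in tube u,
        ‖f.1 z‖ₑ ^ q * ENNReal.ofReal ((1 - ‖(z : Cn n)‖ ^ 2) ^ ((n : ℝ) + α))
        ∂(ballMeasure n)) ^ (1 / q))
    (sphereMeasure n)

/-- The space `CT_{q,α}` of holomorphic functions of finite norm. -/
def CT (n : ℕ) (γ q α : ℝ) : Set (HolBall n) := {f | ctNorm γ q α f < ∞}

end HoloTent

end

/-!
Expand holomorphic functions on the ball in homogeneous components, `F = ∑ F_k`. With `a = n + 1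
+ s` and `b = a + t`, the binomial series shows that the kernel `(1 - ⟨z, w⟩)^{-a}` has
components `(a)_k / k! ⟨z, w⟩^k`, so the operator with multiplier `(b)_k / (a)_k`, which is
continuous because the multiplier grows only polynomially, has the required property
(`multOp_pochRatio_kernel`). It is the only one: a continuous functional that kills all kernels
kills all powers `⟨·, w⟩^k`, hence all monomials, hence everything (`eq_zero_of_kernel`). Its
inverse is the operator with `a` and `b` exchanged, so a single norm inequality, applied in both
directions, gives the rest.

The norm is equivalent to a Carleson constant. Since the set of `ζ` with `u ∈ Γ(ζ)` is open, the
essential supremum dominates the mean over `Q(u)` for every `u` close to the sphere; a covering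
of the sphere by small tubes and the maximum principle then show that `‖f‖^q` is comparable to
the least `M` such that `∫ |f|^q (1 - |z|²)^{n+α} ≤ M r^n` over all tubes `{|1 - ⟨z, ζ⟩| < r}`
(`exists_carlesonLE_ctNorm`, `ctNorm_rpow_le_of_carlesonLE`). It remains to see that the operator
maps the Carleson condition of exponent `δ₀ = n + α` to that of exponent `δ₀ + q (b - a)`
(`CarlesonLE.multOp_pochRatio`).

To this end, write `(b)_k / (a)_k` as the product of `(a + N)_k / (a)_k` and `(b)_k / (a + N)_k`,
where `N > b - a`. The first factor is a product of `N` factors `(a + j + k) / (a + j)`, each of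
which acts as `F + (a + j)⁻¹ ∑ z_i ∂F/∂z_i`. For the second, put `τ = a + N - b > 0`; Euler's
Beta integral says that up to an error `O(2^{-k})` it is a multiple of `∫_0^{1/2} y^{τ-1} (1 -
y)^{b+k-1} dy`, so that the operator is a radial fractional integral `∫_0^{1/2} y^{τ-1} (1 -
y)^{b-1} F((1 - y) z) dy` plus a smoothing operator (`enorm_multFun_pochRatio_le`).

Both the radial derivative and the fractional integral (after Hölder's inequality) are controlled
by averages of `|F|^q` over nonisotropic neighbourhoods, by the mean value property
(`enorm_radial_rpow_le`, `radialIntegral_rpow_le`). Such averages respect Carleson conditions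
(`CarlesonLE.lintegral_shadow_le`): by Tonelli's theorem this is a pointwise bound on the mass
that a point `w` sends to a tube of size `r`, and this mass decays geometrically in the number of
doublings of the tube that are needed to reach `w`.
-/

noncomputable section
namespace HoloTent
open Filter Topology
open scoped Nat

variable {n : ℕ}

/-! ### Holomorphic functions as functions on the whole space -/

/-- The extension by zero of a holomorphic function on the ball to all of `ℂⁿ`. -/
def ext (f : HolBall n) (z : Cn n) : ℂ :=
  open Classical in if h : z ∈ ball (0 : Cn n) 1 then f.1 ⟨z, h⟩ else 0

lemma ext_coe (f : HolBall n) (z : Ball n) : ext f z = f.1 z := by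
  simp only [ext, Subtype.coe_prop, dite_true, Subtype.coe_eta]

lemma differentiableOn_ext (f : HolBall n) : DifferentiableOn ℂ (ext f) (ball 0 1) := by
  obtain ⟨F, hF, h⟩ := f.2
  refine hF.congr fun z hz => ?_
  rw [← h ⟨z, hz⟩, ← ext_coe f ⟨z, hz⟩]

lemma measurable_ext (f : HolBall n) : Measurable (ext f) := by
  classical
  have h1 : Measurable (fun z : Ball n => f.1 z) := f.1.continuous.measurable
  have : ext f = fun z => if h : z ∈ ball (0 : Cn n) 1 then f.1 ⟨z, h⟩ else 0 := by
    funext z; simp only [ext]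
  rw [this]
  exact Measurable.dite h1 measurable_const measurableSet_ball

/-- The element of `HolBall n` given by a function that is holomorphic on the ball. -/
def ofDiff (F : Cn n → ℂ) (hF : DifferentiableOn ℂ F (ball 0 1)) : HolBall n :=
  ⟨⟨fun z => F z, continuousOn_iff_continuous_domRestrict.1 hF.continuousOn⟩, F, hF, fun _ => rfl⟩

lemma HolBall.ext' {f g : HolBall n} (h : ∀ z : Ball n, f.1 z = g.1 z) : f = g :=
  Subtype.ext (ContinuousMap.ext h)

lemma hasSum_of_eq {u v : ℕ → ℂ} {a : ℂ} (h : ∀ k, u k = v k) (hu : HasSum u a) : HasSum v a :=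
  funext h ▸ hu

/-! ### Derivatives and homogeneous components -/

lemma differentiableOn_line {E : Type*} [NormedAddCommGroup E] [NormedSpace ℂ E] {U : Set E}
    {F : E → ℂ} (hF : DifferentiableOn ℂ F U) (z v : E) :
    DifferentiableOn ℂ (fun c : ℂ => F (z + c • v)) {c | z + c • v ∈ U} :=
  hF.comp (by fun_prop) fun _ h => h

/-- Cauchy estimate for the Fréchet derivative. -/
lemma norm_fderiv_le_of_ball {E : Type*} [NormedAddCommGroup E] [NormedSpace ℂ E]
    {F : E → ℂ} {z : E} {r C : ℝ} (hr : 0 < r) (hC : 0 ≤ C) (hF : DifferentiableOn ℂ F (ball z r))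
    (hb : ∀ w ∈ ball z r, ‖F w‖ ≤ C) : ‖fderiv ℂ F z‖ ≤ 2 * C / r := by
  refine ContinuousLinearMap.opNorm_le_bound _ (by positivity) fun v => ?_
  rcases eq_or_ne v 0 with rfl | hv
  · simp
  have hv' : 0 < ‖v‖ := norm_pos_iff.2 hv
  have hmem : ∀ c ∈ closedBall (0 : ℂ) (r / (2 * ‖v‖)), z + c • v ∈ ball z r := by
    intro c hc
    simp only [mem_closedBall, dist_zero_right] at hc
    simp only [mem_ball, dist_self_add_left, norm_smul]
    calc ‖c‖ * ‖v‖ ≤ r / (2 * ‖v‖) * ‖v‖ := by gcongr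
      _ = r / 2 := by field_simp
      _ < r := by linarith
  have hd : DiffContOnCl ℂ (fun c : ℂ => F (z + c • v)) (ball 0 (r / (2 * ‖v‖))) := by
    apply DifferentiableOn.diffContOnCl
    rw [closure_ball _ (by positivity)]
    exact (differentiableOn_line hF z v).mono hmem
  have h1 := Complex.norm_deriv_le_of_forall_mem_sphere_norm_le (c := 0) (C := C) (by positivity) hd
    (fun c hc => hb _ (hmem c (sphere_subset_closedBall hc)))
  have h2 : HasDerivAt (fun c : ℂ => F (z + c • v)) (fderiv ℂ F z v) 0 := by
    have h3 : HasFDerivAt F (fderiv ℂ F z) (z + (0 : ℂ) • v) := by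
      simpa using (hF.differentiableAt (isOpen_ball.mem_nhds (mem_ball_self hr))).hasFDerivAt
    have h4 : HasDerivAt (fun c : ℂ => z + c • v) v 0 := by
      simpa using ((hasDerivAt_id (0 : ℂ)).smul_const v).const_add z
    exact h3.comp_hasDerivAt 0 h4
  rw [h2.deriv] at h1
  refine h1.trans (le_of_eq ?_)
  field_simp

/-- Directional derivatives of holomorphic functions of several variables are holomorphic. -/
lemma differentiableOn_fderiv_apply {U : Set (Cn n)} (hU : IsOpen U) {F : Cn n → ℂ}
    (hF : DifferentiableOn ℂ F U) (v : Cn n) :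
    DifferentiableOn ℂ (fun z => fderiv ℂ F z v) U := by
  intro z₀ hz₀
  apply DifferentiableAt.differentiableWithinAt
  obtain ⟨K, hKn, hKU, hKc⟩ := local_compact_nhds (hU.mem_nhds hz₀)
  obtain ⟨C, hC⟩ := hKc.exists_bound_of_continuousOn (hF.continuousOn.mono hKU)
  obtain ⟨r, hr, hrK⟩ := Metric.mem_nhds_iff.1 hKn
  have hC0 : 0 ≤ C := (norm_nonneg _).trans (hC z₀ (mem_of_mem_nhds hKn))
  set ρ : ℝ := r / (4 * (‖v‖ + 1)) with hρ
  have hv1 : 0 < ‖v‖ + 1 := by positivity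
  have hρ0 : 0 < ρ := by positivity
  have hρv : ρ * ‖v‖ ≤ r / 4 := by
    calc ρ * ‖v‖ ≤ ρ * (‖v‖ + 1) := by gcongr; linarith
      _ = r / 4 := by rw [hρ]; field_simp
  have hmem : ∀ z ∈ ball z₀ (r / 4), ∀ c ∈ closedBall (0 : ℂ) ρ,
      ball (z + c • v) (r / 4) ⊆ ball z₀ r := by
    intro z hz c hc w hw
    simp only [mem_closedBall, dist_zero_right, mem_ball] at hc hz hw ⊢
    have : dist (z + c • v) z ≤ r / 4 := by
      rw [dist_self_add_left, norm_smul]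
      exact (mul_le_mul_of_nonneg_right hc (norm_nonneg _)).trans hρv
    linarith [dist_triangle w (z + c • v) z₀, dist_triangle (z + c • v) z z₀]
  have hmem' : ∀ z ∈ ball z₀ (r / 4), ∀ c ∈ closedBall (0 : ℂ) ρ, z + c • v ∈ ball z₀ r :=
    fun z hz c hc => hmem z hz c hc (mem_ball_self (by positivity))
  have hFb : DifferentiableOn ℂ F (ball z₀ r) := hF.mono (hrK.trans hKU)
  -- Cauchy's formula for the derivative along `v`
  have key : ∀ z ∈ ball z₀ (r / 4), fderiv ℂ F z v = (2 * Real.pi * Complex.I)⁻¹ *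
      ∫ θ in Set.Ioc 0 (2 * Real.pi), deriv (circleMap 0 ρ) θ *
        ((1 / (circleMap 0 ρ θ - 0) ^ 2) * F (z + circleMap 0 ρ θ • v)) := by
    intro z hz
    have hd : DiffContOnCl ℂ (fun c : ℂ => F (z + c • v)) (ball 0 ρ) := by
      apply DifferentiableOn.diffContOnCl
      rw [closure_ball _ hρ0.ne']
      exact (differentiableOn_line hFb z v).mono (hmem' z hz)
    have h1 := hd.deriv_eq_smul_circleIntegral hρ0
    have h2 : HasDerivAt (fun c : ℂ => F (z + c • v)) (fderiv ℂ F z v) 0 := by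
      have hz' : z ∈ ball z₀ r := by simpa using hmem' z hz 0 (by simp [hρ0.le])
      have h3 : HasFDerivAt F (fderiv ℂ F z) (z + (0 : ℂ) • v) := by
        simpa using (hFb.differentiableAt (isOpen_ball.mem_nhds hz')).hasFDerivAt
      have h4 : HasDerivAt (fun c : ℂ => z + c • v) v 0 := by
        simpa using ((hasDerivAt_id (0 : ℂ)).smul_const v).const_add z
      exact h3.comp_hasDerivAt 0 h4
    rw [h2.deriv] at h1
    simp only [circleIntegral, smul_eq_mul] at h1
    rw [intervalIntegral.integral_of_le (by positivity)] at h1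
    rw [h1, inv_mul_cancel_left₀]
    simp [Real.pi_ne_zero]
  have hcirc : ∀ θ, circleMap 0 ρ θ ∈ closedBall (0 : ℂ) ρ := fun θ =>
    sphere_subset_closedBall (circleMap_mem_sphere 0 hρ0.le θ)
  have hcm : Continuous (fun θ => deriv (circleMap 0 ρ) θ * (1 / (circleMap 0 ρ θ - 0) ^ 2)) := by
    simp only [deriv_circleMap, sub_zero]
    refine Continuous.mul (by fun_prop) (Continuous.div (by fun_prop) (by fun_prop) fun θ => ?_)
    simp [hρ0.ne']
  have hcn : ∀ θ, ‖deriv (circleMap 0 ρ) θ * (1 / (circleMap 0 ρ θ - 0) ^ 2)‖ = ρ⁻¹ := by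
    intro θ
    simp only [deriv_circleMap, sub_zero, norm_mul, norm_div, norm_one, norm_pow,
      norm_circleMap_zero, Complex.norm_I, mul_one, abs_of_pos hρ0]
    field_simp
  have hnhd : ball z₀ (r / 4) ∈ 𝓝 z₀ := ball_mem_nhds _ (by positivity)
  have hline : ∀ z ∈ ball z₀ (r / 4), Continuous (fun θ => F (z + circleMap 0 ρ θ • v)) := by
    intro z hz
    have : ContinuousOn (fun c : ℂ => F (z + c • v)) (closedBall 0 ρ) :=
      ((differentiableOn_line hFb z v).mono (hmem' z hz)).continuousOn
    exact this.comp_continuous (continuous_circleMap 0 ρ) hcirc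
  have hmain : DifferentiableAt ℂ (fun z => ∫ θ in Set.Ioc 0 (2 * Real.pi),
      deriv (circleMap 0 ρ) θ * ((1 / (circleMap 0 ρ θ - 0) ^ 2) * F (z + circleMap 0 ρ θ • v)))
      z₀ := by
    have := hasFDerivAt_integral_of_dominated_of_fderiv_le
      (μ := volume.restrict (Set.Ioc 0 (2 * Real.pi))) (𝕜 := ℂ) (x₀ := z₀)
      (F := fun z θ => deriv (circleMap 0 ρ) θ *
        ((1 / (circleMap 0 ρ θ - 0) ^ 2) * F (z + circleMap 0 ρ θ • v)))
      (F' := fun z θ => (deriv (circleMap 0 ρ) θ * (1 / (circleMap 0 ρ θ - 0) ^ 2)) •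
        fderiv ℂ F (z + circleMap 0 ρ θ • v))
      (bound := fun _ => ρ⁻¹ * (2 * C / (r / 4))) (s := ball z₀ (r / 4)) hnhd ?_ ?_ ?_ ?_ ?_ ?_
    · exact this.differentiableAt
    · filter_upwards [hnhd] with z hz
      refine Continuous.aestronglyMeasurable ?_
      simp only [← mul_assoc]
      exact hcm.mul (hline z hz)
    · refine Continuous.integrableOn_Ioc ?_
      simp only [← mul_assoc]
      exact hcm.mul (hline z₀ (mem_ball_self (by positivity)))
    · refine AEStronglyMeasurable.smul hcm.aestronglyMeasurable ?_
      refine Measurable.aestronglyMeasurable ?_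
      exact (measurable_fderiv ℂ F).comp (by fun_prop)
    · refine Eventually.of_forall fun θ z hz => ?_
      rw [norm_smul, hcn]
      gcongr
      have hs := hmem z hz _ (hcirc θ)
      exact norm_fderiv_le_of_ball (by positivity) hC0 (hFb.mono hs)
        fun w hw => hC w (hrK (hs hw))
    · exact integrable_const _
    · refine Eventually.of_forall fun θ z hz => ?_
      have h3 : HasFDerivAt F (fderiv ℂ F (z + circleMap 0 ρ θ • v)) (z + circleMap 0 ρ θ • v) :=
        (hFb.differentiableAt (isOpen_ball.mem_nhds (hmem' z hz _ (hcirc θ)))).hasFDerivAt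
      have h4 : HasFDerivAt (fun z => F (z + circleMap 0 ρ θ • v))
          (fderiv ℂ F (z + circleMap 0 ρ θ • v)) z := by
        rw [hasFDerivAt_comp_add_right]; exact h3
      simpa only [← mul_assoc] using h4.const_mul _
  refine (hmain.const_mul (2 * Real.pi * Complex.I)⁻¹).congr_of_eventuallyEq ?_
  filter_upwards [hnhd] with z hz using key z hz

/-- Holomorphic functions of several variables are smooth. -/
lemma contDiffOn_of_differentiableOn_Cn {U : Set (Cn n)} (hU : IsOpen U) (k : ℕ) :
    ∀ {F : Cn n → ℂ}, DifferentiableOn ℂ F U → ContDiffOn ℂ k F U := by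
  induction k with
  | zero => intro F hF; exact contDiffOn_zero.2 hF.continuousOn
  | succ k ih =>
    intro F hF
    rw [Nat.cast_succ]
    refine contDiffOn_succ_of_fderiv_apply hF (by simp) fun v => ?_
    refine (ih (differentiableOn_fderiv_apply hU hF v)).congr fun z hz => ?_
    rw [fderivWithin_of_isOpen hU hz]

/-- The homogeneous component of degree `k` of the Taylor expansion of `F` at the origin, as the
`k`-th iterated derivative on the diagonal, divided by `k!`. -/
def hcomp (k : ℕ) (F : Cn n → ℂ) (z : Cn n) : ℂ :=
  (k ! : ℂ)⁻¹ * iteratedFDeriv ℂ k F 0 (fun _ => z)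

lemma hcomp_smul (k : ℕ) (F : Cn n → ℂ) (c : ℂ) (z : Cn n) :
    hcomp k F (c • z) = c ^ k * hcomp k F z := by
  have := (iteratedFDeriv ℂ k F 0).map_smul_univ (fun _ => c) (fun _ => z)
  simp only [hcomp]
  rw [this]
  simp
  ring

lemma differentiable_hcomp (k : ℕ) (F : Cn n → ℂ) : Differentiable ℂ (hcomp k F) := by
  have h : Differentiable ℂ (iteratedFDeriv ℂ k F 0) :=
    (iteratedFDeriv ℂ k F 0).contDiff.differentiable (n := 1) one_ne_zero
  exact (h.comp (differentiable_pi.2 fun _ => differentiable_id)).const_mul _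

lemma differentiableOn_slice {F : Cn n → ℂ} (hF : DifferentiableOn ℂ F (ball 0 1)) {z : Cn n}
    {r : ℝ} (hr : r * ‖z‖ ≤ 1) :
    DifferentiableOn ℂ (fun c : ℂ => F (c • z)) (ball 0 r) := by
  refine hF.comp (by fun_prop) fun c hc => ?_
  simp only [mem_ball, dist_zero_right, norm_smul] at hc ⊢
  rcases eq_or_ne z 0 with rfl | hz
  · simp
  · exact (mul_lt_mul_of_pos_right hc (norm_pos_iff.2 hz)).trans_le hr

/-- The homogeneous components are the Taylor coefficients along complex lines. -/
lemma iteratedDeriv_slice {F : Cn n → ℂ} (hF : DifferentiableOn ℂ F (ball 0 1)) (k : ℕ)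
    (z : Cn n) : iteratedDeriv k (fun c : ℂ => F (c • z)) 0 = k ! * hcomp k F z := by
  have hc := contDiffOn_of_differentiableOn_Cn isOpen_ball k hF
  let g : ℂ →L[ℂ] Cn n := (ContinuousLinearMap.id ℂ ℂ).smulRight z
  have hg : ∀ c, g c = c • z := fun c => by simp [g]
  have hop : IsOpen (g ⁻¹' ball (0 : Cn n) 1) := isOpen_ball.preimage g.continuous
  have h0 : g 0 ∈ ball (0 : Cn n) 1 := by simp
  have := g.iteratedFDerivWithin_comp_right hc isOpen_ball.uniqueDiffOn hop.uniqueDiffOn h0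
    (i := k) le_rfl
  rw [iteratedFDerivWithin_of_isOpen k hop h0, iteratedFDerivWithin_of_isOpen k isOpen_ball h0]
    at this
  rw [iteratedDeriv_eq_iteratedFDeriv]
  have h2 : (fun c : ℂ => F (c • z)) = F ∘ g := by funext c; simp [hg]
  rw [h2, this]
  simp only [ContinuousMultilinearMap.compContinuousLinearMap_apply, hg, hcomp, one_smul, zero_smul]
  rw [mul_inv_cancel_left₀ (by exact_mod_cast k.factorial_ne_zero)]

lemma hasSum_hcomp {F : Cn n → ℂ} (hF : DifferentiableOn ℂ F (ball 0 1)) {z : Cn n}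
    (hz : z ∈ ball (0 : Cn n) 1) : HasSum (fun k => hcomp k F z) (F z) := by
  simp only [mem_ball, dist_zero_right] at hz
  have h1 : ∃ r : ℝ, 1 < r ∧ r * ‖z‖ ≤ 1 := by
    rcases eq_or_ne z 0 with rfl | hz0
    · exact ⟨2, by norm_num, by simp⟩
    · have := norm_pos_iff.2 hz0
      exact ⟨‖z‖⁻¹, (one_lt_inv₀ this).2 hz, by rw [inv_mul_cancel₀ this.ne']⟩
  obtain ⟨r, hr1, hr⟩ := h1
  have := Complex.hasSum_taylorSeries_on_ball
    (differentiableOn_slice hF hr) (z := 1) (by simpa using hr1)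
  simp only [iteratedDeriv_slice hF, one_smul, sub_zero, one_pow, smul_eq_mul] at this
  refine hasSum_of_eq (fun k => ?_) this
  rw [one_mul, inv_mul_cancel_left₀ (by exact_mod_cast k.factorial_ne_zero)]

/-- Cauchy estimate for homogeneous components. The dilation factor `ρ` spares a separate
treatment of `z = 0`. -/
lemma norm_hcomp_le {F : Cn n → ℂ} (hF : DifferentiableOn ℂ F (ball 0 1)) {z : Cn n}
    {r ρ M : ℝ} (hr : r < 1) (hρ : 0 < ρ) (hz : ρ * ‖z‖ ≤ r)
    (hM : ∀ w ∈ closedBall (0 : Cn n) r, ‖F w‖ ≤ M) (k : ℕ) :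
    ‖hcomp k F z‖ ≤ M / ρ ^ k := by
  have hmem : ∀ c ∈ closedBall (0 : ℂ) ρ, c • z ∈ closedBall (0 : Cn n) r := by
    intro c hc
    simp only [mem_closedBall, dist_zero_right, norm_smul] at hc ⊢
    exact (mul_le_mul_of_nonneg_right hc (norm_nonneg _)).trans hz
  have hd : DiffContOnCl ℂ (fun c : ℂ => F (c • z)) (ball 0 ρ) := by
    apply DifferentiableOn.diffContOnCl
    rw [closure_ball _ hρ.ne']
    exact hF.comp (by fun_prop) fun c hc => closedBall_subset_ball hr (hmem c hc)
  have h1 := Complex.norm_iteratedDeriv_le_of_forall_mem_sphere_norm_le k hρ hd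
    (fun c hc => hM _ (hmem c (sphere_subset_closedBall hc)))
  rw [iteratedDeriv_slice hF, norm_mul, Complex.norm_natCast, mul_div_assoc] at h1
  exact le_of_mul_le_mul_left h1 (by exact_mod_cast k.factorial_pos)

/-- Uniqueness of power series coefficients. -/
lemma coeff_eq_of_hasSum {g : ℂ → ℂ} {c : ℕ → ℂ}
    (h : ∀ x : ℂ, ‖x‖ < 1 → HasSum (fun k => c k * x ^ k) (g x)) (k : ℕ) :
    iteratedDeriv k g 0 = k ! * c k := by
  have hp : HasFPowerSeriesOnBall g (FormalMultilinearSeries.ofScalars ℂ c) 0 1 := by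
    refine ⟨?_, one_pos, fun {y} hy => ?_⟩
    · refine ENNReal.le_of_forall_nnreal_lt fun r hr => ?_
      refine FormalMultilinearSeries.le_radius_of_summable_norm _ ?_
      have hr1 : ‖((r : ℝ) : ℂ)‖ < 1 := by simpa using hr
      refine (h _ hr1).summable.norm.congr fun k => ?_
      simp
    · have hy' : ‖y‖ < 1 := by
        simpa [enorm_eq_nnnorm, ← NNReal.coe_lt_coe] using hy
      simpa [FormalMultilinearSeries.ofScalars_apply_eq, mul_comm] using h y hy'
  have := hp.factorial_smul 1 k
  rw [iteratedDeriv_eq_iteratedFDeriv, ← this]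
  simp

lemma hcomp_eq_of_hasSum {F : Cn n → ℂ} (hF : DifferentiableOn ℂ F (ball 0 1)) {z : Cn n}
    {c : ℕ → ℂ} (h : ∀ x : ℂ, ‖x‖ < 1 → HasSum (fun k => c k * x ^ k) (F (x • z))) (k : ℕ) :
    hcomp k F z = c k := by
  have h1 := coeff_eq_of_hasSum h k
  rw [iteratedDeriv_slice hF] at h1
  exact mul_left_cancel₀ (by exact_mod_cast k.factorial_ne_zero) h1

lemma hcomp_congr {F G : Cn n → ℂ} (h : ∀ z ∈ ball (0 : Cn n) 1, F z = G z) (k : ℕ) (z : Cn n) :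
    hcomp k F z = hcomp k G z := by
  have : F =ᶠ[𝓝 0] G := by
    filter_upwards [ball_mem_nhds (0 : Cn n) one_pos] with z hz using h z hz
  have h2 := this.iteratedFDeriv (𝕜 := ℂ) k
  simp only [hcomp, h2.self_of_nhds]

/-! ### Multiplier operators -/

/-- Sequences of subexponential growth, so that multiplying homogeneous components by them preserves
convergence in the ball. -/
def IsMultiplier (m : ℕ → ℂ) : Prop :=
  ∀ ρ : ℝ, 0 < ρ → ρ < 1 → Summable fun k => ‖m k‖ * ρ ^ k

lemma isMultiplier_one : IsMultiplier fun _ => 1 := fun ρ h0 h1 => by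
  simpa using summable_geometric_of_lt_one h0.le h1

/-- The bound by a geometric series that makes multiplier operators continuous. -/
lemma norm_mul_hcomp_le {m : ℕ → ℂ} {F : Cn n → ℂ}
    (hF : DifferentiableOn ℂ F (ball 0 1)) {r r' M : ℝ} (hr : 0 < r) (hr' : 0 < r') (hr1 : r' < 1)
    (hM : ∀ w ∈ closedBall (0 : Cn n) r', ‖F w‖ ≤ M) {z : Cn n} (hz : ‖z‖ ≤ r) (k : ℕ) :
    ‖m k * hcomp k F z‖ ≤ M * (‖m k‖ * (r / r') ^ k) := by
  have h1 := norm_hcomp_le hF (ρ := r' / r) (z := z) hr1 (by positivity)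
    (by calc r' / r * ‖z‖ ≤ r' / r * r := by gcongr
          _ = r' := by field_simp) hM k
  rw [norm_mul]
  calc ‖m k‖ * ‖hcomp k F z‖ ≤ ‖m k‖ * (M / (r' / r) ^ k) := by gcongr
    _ = _ := by
      rw [div_eq_mul_inv M, ← inv_pow, inv_div]; ring

lemma exists_bound_closedBall {F : Cn n → ℂ} (hF : DifferentiableOn ℂ F (ball 0 1)) {r : ℝ}
    (hr : r < 1) : ∃ M, 0 ≤ M ∧ ∀ w ∈ closedBall (0 : Cn n) r, ‖F w‖ ≤ M := by
  obtain ⟨M, hM⟩ := (isCompact_closedBall (0 : Cn n) r).exists_bound_of_continuousOn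
    (hF.continuousOn.mono (closedBall_subset_ball hr))
  exact ⟨max M 0, le_max_right _ _, fun w hw => (hM w hw).trans (le_max_left _ _)⟩

lemma summable_mul_hcomp {m : ℕ → ℂ} (hm : IsMultiplier m) {F : Cn n → ℂ}
    (hF : DifferentiableOn ℂ F (ball 0 1)) {z : Cn n} (hz : z ∈ ball (0 : Cn n) 1) :
    Summable fun k => ‖m k * hcomp k F z‖ := by
  simp only [mem_ball, dist_zero_right] at hz
  obtain ⟨r, h1, h2⟩ := exists_between hz
  obtain ⟨r', h3, h4⟩ := exists_between h2
  have hr : 0 < r := (norm_nonneg _).trans_lt h1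
  obtain ⟨M, -, hM⟩ := exists_bound_closedBall hF h4
  exact Summable.of_nonneg_of_le (fun _ => norm_nonneg _)
    (norm_mul_hcomp_le hF hr (hr.trans h3) h4 hM h1.le)
    ((hm (r / r') (by have := hr.trans h3; positivity)
      ((div_lt_one (hr.trans h3)).2 h3)).mul_left M)

/-- The function with homogeneous components `m k * hcomp k F`. -/
def multFun (m : ℕ → ℂ) (F : Cn n → ℂ) (z : Cn n) : ℂ := ∑' k, m k * hcomp k F z

lemma differentiableOn_multFun {m : ℕ → ℂ} (hm : IsMultiplier m) {F : Cn n → ℂ}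
    (hF : DifferentiableOn ℂ F (ball 0 1)) : DifferentiableOn ℂ (multFun m F) (ball 0 1) := by
  intro z hz
  apply DifferentiableAt.differentiableWithinAt
  have hz' := hz
  simp only [mem_ball, dist_zero_right] at hz'
  obtain ⟨r₀, h0, h0'⟩ := exists_between hz'
  obtain ⟨r, h1, h2⟩ := exists_between h0'
  obtain ⟨r', h3, h4⟩ := exists_between h2
  have hr₀ : 0 < r₀ := (norm_nonneg _).trans_lt h0
  have hr : 0 < r := hr₀.trans h1
  have hr' : 0 < r' := hr.trans h3
  obtain ⟨M, hM0, hM⟩ := exists_bound_closedBall hF h4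
  have hs := hm (r / r') (by positivity) ((div_lt_one hr').2 h3)
  have hsub : ∀ w ∈ ball (0 : Cn n) r₀, ∀ v ∈ ball w (r - r₀), ‖v‖ ≤ r := by
    intro w hw v hv
    simp only [mem_ball, dist_zero_right] at hw hv
    have := norm_sub_norm_le v w
    rw [dist_eq_norm] at hv
    linarith
  refine (hasFDerivAt_tsum_of_isPreconnected (𝕜 := ℂ) (s := ball (0 : Cn n) r₀) (x₀ := z)
    (u := fun k => 2 * (M * (‖m k‖ * (r / r') ^ k)) / (r - r₀))
    (f := fun k w => m k * hcomp k F w)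
    (f' := fun k w => fderiv ℂ (fun w => m k * hcomp k F w) w)
    (((hs.mul_left M).mul_left 2).div_const _)
    isOpen_ball (convex_ball _ _).isPreconnected ?_ ?_ ?_ ?_ ?_).differentiableAt
  · intro k w _
    exact ((differentiable_hcomp k F).const_mul (m k) w).hasFDerivAt
  · intro k w hw
    refine norm_fderiv_le_of_ball (by linarith) (by positivity)
      ((differentiable_hcomp k F).const_mul (m k)).differentiableOn fun v hv => ?_
    exact norm_mul_hcomp_le hF hr hr' h4 hM (hsub w hw v hv) k
  · simpa using h0
  · exact (summable_mul_hcomp hm hF hz).of_norm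
  · simpa using h0

lemma hasSum_multFun {m : ℕ → ℂ} (hm : IsMultiplier m) {F : Cn n → ℂ}
    (hF : DifferentiableOn ℂ F (ball 0 1)) {z : Cn n} (hz : z ∈ ball (0 : Cn n) 1) :
    HasSum (fun k => m k * hcomp k F z) (multFun m F z) :=
  (summable_mul_hcomp hm hF hz).of_norm.hasSum

lemma smul_mem_unitBall {z : Cn n} (hz : z ∈ ball (0 : Cn n) 1) {x : ℂ} (hx : ‖x‖ < 1) :
    x • z ∈ ball (0 : Cn n) 1 := by
  simp only [mem_ball, dist_zero_right, norm_smul] at hz ⊢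
  exact mul_lt_one_of_nonneg_of_lt_one_left (norm_nonneg _) hx hz.le

lemma hcomp_multFun {m : ℕ → ℂ} (hm : IsMultiplier m) {F : Cn n → ℂ}
    (hF : DifferentiableOn ℂ F (ball 0 1)) {z : Cn n} (hz : z ∈ ball (0 : Cn n) 1) (k : ℕ) :
    hcomp k (multFun m F) z = m k * hcomp k F z := by
  refine hcomp_eq_of_hasSum (differentiableOn_multFun hm hF) (c := fun k => m k * hcomp k F z)
    (fun x hx => ?_) k
  have := hasSum_multFun hm hF (smul_mem_unitBall hz hx)
  simpa only [hcomp_smul, mul_assoc, mul_comm (hcomp _ F z)] using this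

lemma hcomp_add {F G : Cn n → ℂ} (hF : DifferentiableOn ℂ F (ball 0 1))
    (hG : DifferentiableOn ℂ G (ball 0 1)) (k : ℕ) {z : Cn n} (hz : z ∈ ball (0 : Cn n) 1) :
    hcomp k (F + G) z = hcomp k F z + hcomp k G z := by
  refine hcomp_eq_of_hasSum (hF.add hG) (c := fun k => hcomp k F z + hcomp k G z)
    (fun x hx => ?_) k
  have := (hasSum_hcomp hF (smul_mem_unitBall hz hx)).add
    (hasSum_hcomp hG (smul_mem_unitBall hz hx))
  simpa only [hcomp_smul, add_mul, mul_comm (x ^ _), Pi.add_apply] using this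

lemma hcomp_const_smul {F : Cn n → ℂ} (hF : DifferentiableOn ℂ F (ball 0 1))
    (a : ℂ) (k : ℕ) {z : Cn n} (hz : z ∈ ball (0 : Cn n) 1) :
    hcomp k (a • F) z = a * hcomp k F z := by
  refine hcomp_eq_of_hasSum (hF.const_smul a) (c := fun k => a * hcomp k F z)
    (fun x hx => ?_) k
  have := (hasSum_hcomp hF (smul_mem_unitBall hz hx)).mul_left a
  simpa only [hcomp_smul, mul_assoc, mul_comm (x ^ _), Pi.smul_apply, smul_eq_mul] using this

/-- The operator on `HolBall n` that multiplies homogeneous components of degree `k` by `m k`, as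
a linear map. -/
def multLin {m : ℕ → ℂ} (hm : IsMultiplier m) : HolBall n →ₗ[ℂ] HolBall n where
  toFun f := ofDiff (multFun m (ext f)) (differentiableOn_multFun hm (differentiableOn_ext f))
  map_add' f g := by
    refine HolBall.ext' fun z => ?_
    have h1 := hasSum_multFun hm (differentiableOn_ext f) z.2
    have h2 := hasSum_multFun hm (differentiableOn_ext g) z.2
    have h3 := hasSum_multFun hm (differentiableOn_ext (f + g)) z.2
    refine h3.unique ?_
    refine hasSum_of_eq (fun k => ?_) (h1.add h2)
    rw [← mul_add, ← hcomp_add (differentiableOn_ext f) (differentiableOn_ext g) k z.2]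
    congr 1
    symm
    refine hcomp_congr (fun w hw => ?_) k (z : Cn n)
    have := ext_coe (f + g) ⟨w, hw⟩
    have h1 := ext_coe f ⟨w, hw⟩
    have h2 := ext_coe g ⟨w, hw⟩
    simp only at this h1 h2
    rw [Pi.add_apply, this, h1, h2]; rfl
  map_smul' a f := by
    refine HolBall.ext' fun z => ?_
    have h1 := hasSum_multFun hm (differentiableOn_ext f) z.2
    have h3 := hasSum_multFun hm (differentiableOn_ext (a • f)) z.2
    refine h3.unique ?_
    refine hasSum_of_eq (fun k => ?_) (h1.mul_left a)
    rw [mul_left_comm, ← hcomp_const_smul (differentiableOn_ext f) a k z.2]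
    congr 1
    symm
    refine hcomp_congr (fun w hw => ?_) k (z : Cn n)
    have := ext_coe (a • f) ⟨w, hw⟩
    have h1 := ext_coe f ⟨w, hw⟩
    simp only at this h1
    rw [Pi.smul_apply, this, h1]; rfl

/-- Compact subsets of the ball lie in smaller concentric balls. -/
lemma exists_radius_of_isCompact {K : Set (Ball n)} (hK : IsCompact K) :
    ∃ r : ℝ, 0 < r ∧ r < 1 ∧ ∀ z ∈ K, ‖(z : Cn n)‖ ≤ r := by
  rcases K.eq_empty_or_nonempty with rfl | hne
  · exact ⟨1 / 2, by norm_num, by norm_num, by simp⟩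
  obtain ⟨z, hz, hmax⟩ := hK.exists_isMaxOn hne
    (f := fun z : Ball n => ‖(z : Cn n)‖) (by fun_prop)
  have hz1 : ‖(z : Cn n)‖ < 1 := mem_ball_zero_iff.1 z.2
  exact ⟨max ‖(z : Cn n)‖ (1 / 2), by positivity, max_lt hz1 (by norm_num),
    fun w hw => (hmax hw).trans (le_max_left _ _)⟩

lemma isCompact_closedBall_ball {r : ℝ} (hr : r < 1) :
    IsCompact {z : Ball n | ‖(z : Cn n)‖ ≤ r} := by
  rw [Subtype.isCompact_iff]
  have h : Subtype.val '' {z : Ball n | ‖(z : Cn n)‖ ≤ r} = closedBall (0 : Cn n) r := by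
    refine Set.Subset.antisymm ?_ fun z hz => ?_
    · rintro _ ⟨z, hz, rfl⟩
      exact mem_closedBall_zero_iff.2 hz
    · exact ⟨⟨z, closedBall_subset_ball hr hz⟩, mem_closedBall_zero_iff.1 hz, rfl⟩
  rw [h]
  exact isCompact_closedBall (0 : Cn n) r

lemma continuous_multLin {m : ℕ → ℂ} (hm : IsMultiplier m) :
    Continuous (multLin (n := n) hm) := by
  refine continuous_of_continuousAt_zero (multLin hm) ?_
  rw [ContinuousAt, map_zero, tendsto_subtype_rng]
  rw [ContinuousMap.tendsto_iff_forall_isCompact_tendstoUniformlyOn]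
  intro K hK
  rw [Metric.tendstoUniformlyOn_iff]
  intro ε hε
  obtain ⟨r, hr0, hr1, hr⟩ := exists_radius_of_isCompact hK
  obtain ⟨r', h3, h4⟩ := exists_between hr1
  have hr'0 := hr0.trans h3
  have hs := hm (r / r') (by positivity) ((div_lt_one hr'0).2 h3)
  set S := ∑' k, ‖m k‖ * (r / r') ^ k with hS
  have hS0 : 0 ≤ S := tsum_nonneg fun k => by positivity
  have hid : Tendsto (fun f : HolBall n => f.1) (𝓝 0) (𝓝 (0 : HolBall n).1) :=
    continuous_subtype_val.continuousAt
  rw [ContinuousMap.tendsto_iff_forall_isCompact_tendstoUniformlyOn] at hid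
  have hδ : 0 < ε / (S + 1) := by positivity
  have h := Metric.tendstoUniformlyOn_iff.1 (hid _ (isCompact_closedBall_ball h4)) _ hδ
  filter_upwards [h] with f hf z hz
  have hM : ∀ w ∈ closedBall (0 : Cn n) r', ‖ext f w‖ ≤ ε / (S + 1) := by
    intro w hw
    have hw' := closedBall_subset_ball h4 hw
    have := hf ⟨w, hw'⟩ (by simpa using hw)
    rw [ext_coe f ⟨w, hw'⟩]
    simpa using this.le
  have hb := norm_mul_hcomp_le (m := m) (differentiableOn_ext f) hr0 hr'0 h4 hM (hr z hz)
  have h5 := tsum_of_norm_bounded (hs.hasSum.mul_left (ε / (S + 1))) hb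
  have h6 : ε / (S + 1) * S < ε := by
    rw [div_mul_eq_mul_div, div_lt_iff₀ (by positivity)]; nlinarith
  have h7 : dist ((0 : HolBall n).1 z) ((multLin hm f).1 z) = ‖multFun m (ext f) z‖ := by
    rw [dist_eq_norm]
    have : (0 : HolBall n).1 z = 0 := rfl
    rw [this, zero_sub, norm_neg]; rfl
  rw [h7]
  exact h5.trans_lt h6

/-- The continuous operator on `HolBall n` that multiplies homogeneous components of degree `k` by
`m k`. -/
def multOp {m : ℕ → ℂ} (hm : IsMultiplier m) : HolBall n →L[ℂ] HolBall n :=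
  ⟨multLin hm, continuous_multLin hm⟩

lemma ext_multOp {m : ℕ → ℂ} (hm : IsMultiplier m) (f : HolBall n) {z : Cn n}
    (hz : z ∈ ball (0 : Cn n) 1) : ext (multOp hm f) z = multFun m (ext f) z :=
  ext_coe (multOp hm f) ⟨z, hz⟩

lemma hcomp_multOp {m : ℕ → ℂ} (hm : IsMultiplier m) (f : HolBall n) {z : Cn n}
    (hz : z ∈ ball (0 : Cn n) 1) (k : ℕ) :
    hcomp k (ext (multOp hm f)) z = m k * hcomp k (ext f) z := by
  rw [← hcomp_multFun hm (differentiableOn_ext f) hz]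
  exact hcomp_congr (fun w hw => ext_multOp hm f hw) k z

/-- A holomorphic function is determined by its homogeneous components. -/
lemma eq_of_hcomp_eq {f g : HolBall n}
    (h : ∀ k, ∀ z ∈ ball (0 : Cn n) 1, hcomp k (ext f) z = hcomp k (ext g) z) : f = g := by
  refine HolBall.ext' fun z => ?_
  rw [← ext_coe, ← ext_coe]
  refine (hasSum_hcomp (differentiableOn_ext f) z.2).unique ?_
  simpa only [h _ _ z.2] using hasSum_hcomp (differentiableOn_ext g) z.2

/-! ### Quotients of Pochhammer symbols -/

/-- The quotient `(b)_k / (a)_k` of Pochhammer symbols. -/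
def pochRatio (a b : ℝ) (k : ℕ) : ℝ := ∏ i ∈ Finset.range k, (b + i) / (a + i)

@[simp] lemma pochRatio_zero (a b : ℝ) : pochRatio a b 0 = 1 := by simp [pochRatio]

lemma pochRatio_succ (a b : ℝ) (k : ℕ) :
    pochRatio a b (k + 1) = pochRatio a b k * ((b + k) / (a + k)) :=
  Finset.prod_range_succ _ _

lemma pochRatio_mul {a b c : ℝ} (hb : ∀ k : ℕ, b + k ≠ 0) (k : ℕ) :
    pochRatio a b k * pochRatio b c k = pochRatio a c k := by
  induction k with
  | zero => simp
  | succ k ih =>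
    rw [pochRatio_succ, pochRatio_succ, pochRatio_succ, ← ih]
    have := hb k
    field_simp

lemma pochRatio_self {a : ℝ} (ha : ∀ k : ℕ, a + k ≠ 0) (k : ℕ) : pochRatio a a k = 1 := by
  rw [pochRatio]
  exact Finset.prod_eq_one fun i _ => div_self (ha i)

lemma pochRatio_ne_zero {a b : ℝ} (ha : ∀ k : ℕ, a + k ≠ 0) (hb : ∀ k : ℕ, b + k ≠ 0) (k : ℕ) :
    pochRatio a b k ≠ 0 :=
  Finset.prod_ne_zero_iff.2 fun i _ => div_ne_zero (hb i) (ha i)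

/-- The quotient of consecutive terms tends to `1`. When `a` is a nonpositive integer, the junk
value `x / 0 = 0` makes the sequence eventually vanish, and the statement persists. -/
lemma isMultiplier_pochRatio (a b : ℝ) : IsMultiplier fun k => (pochRatio a b k : ℂ) := by
  intro ρ hρ0 hρ1
  have hlim : Tendsto (fun k : ℕ => |(b + k) / (a + k)| * ρ) atTop (𝓝 (1 * ρ)) := by
    have h1 : Tendsto (fun k : ℕ => (b + k) / (a + k)) atTop (𝓝 1) := by
      have h2 : Tendsto (fun k : ℕ => 1 + (b - a) / (a + k)) atTop (𝓝 (1 + 0)) := by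
        refine tendsto_const_nhds.add (tendsto_const_nhds.div_atTop ?_)
        exact tendsto_atTop_add_const_left _ _ tendsto_natCast_atTop_atTop
      rw [add_zero] at h2
      refine h2.congr' ?_
      have h3 : Tendsto (fun k : ℕ => a + k) atTop atTop :=
        tendsto_atTop_add_const_left _ a tendsto_natCast_atTop_atTop
      filter_upwards [h3.eventually_gt_atTop 0] with k hk
      field_simp
      ring
    simpa using (h1.abs).mul_const ρ
  rw [one_mul] at hlim
  refine summable_of_ratio_norm_eventually_le (r := (1 + ρ) / 2) (by linarith) ?_
  filter_upwards [hlim.eventually_lt_const (show ρ < (1 + ρ) / 2 by linarith)] with k hk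
  simp only [pochRatio_succ, Complex.ofReal_mul, norm_mul, Complex.norm_real, norm_pow,
    Real.norm_eq_abs, abs_of_pos hρ0, pow_succ, abs_abs]
  calc |pochRatio a b k| * |(b + k) / (a + k)| * (ρ ^ k * ρ)
      = (|(b + k) / (a + k)| * ρ) * (|pochRatio a b k| * ρ ^ k) := by ring
    _ ≤ _ := by gcongr

/-- The coefficients of the binomial series are `(a)_k / (1)_k = (a)_k / k!`. -/
lemma choose_eq_pochRatio (a : ℝ) (k : ℕ) :
    Ring.choose ((a : ℂ) + k - 1) k = (pochRatio 1 a k : ℂ) := by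
  have h1 := Ring.factorial_nsmul_multichoose_eq_ascPochhammer (a : ℂ) k
  rw [Ring.multichoose_eq, Polynomial.ascPochhammer_smeval_eq_eval, nsmul_eq_mul] at h1
  have hk : (k ! : ℂ) ≠ 0 := by exact_mod_cast k.factorial_ne_zero
  refine mul_left_cancel₀ hk (h1.trans ?_)
  clear h1 hk
  induction k with
  | zero => simp
  | succ k ih =>
    rw [ascPochhammer_succ_eval, ih, pochRatio_succ, Nat.factorial_succ]
    push_cast
    have : (1 : ℂ) + k ≠ 0 := by exact_mod_cast (by positivity : (1 + k : ℝ) ≠ 0)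
    field_simp
    ring

/-- The binomial series. -/
lemma hasSum_one_div_one_sub_cpow (a : ℝ) {x : ℂ} (hx : ‖x‖ < 1) :
    HasSum (fun k => (pochRatio 1 a k : ℂ) * x ^ k) (1 / (1 - x) ^ (a : ℂ)) := by
  have h := (Complex.one_div_one_sub_cpow_hasFPowerSeriesOnBall_zero (a : ℂ)).hasSum (y := x)
    (by simpa [enorm_eq_nnnorm, ← NNReal.coe_lt_coe] using hx)
  simp only [zero_add, FormalMultilinearSeries.ofScalars_apply_eq, smul_eq_mul] at h
  refine hasSum_of_eq (fun k => ?_) h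
  rw [choose_eq_pochRatio]

/-! ### The reproducing kernels -/

lemma herm_smul_left (c : ℂ) (z w : Cn n) : herm (c • z) w = c * herm z w := by
  simp [herm]

lemma herm_smul_right (c : ℂ) (z w : Cn n) :
    herm z (c • w) = (starRingEnd ℂ) c * herm z w := by
  simp [herm, mul_comm]

lemma norm_herm_le (z w : Cn n) : ‖herm z w‖ ≤ ‖z‖ * ‖w‖ := by
  rw [mul_comm]; exact norm_inner_le_norm w z

lemma norm_herm_lt_one {z w : Cn n} (hz : z ∈ ball (0 : Cn n) 1) (hw : w ∈ ball (0 : Cn n) 1) :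
    ‖herm z w‖ < 1 := by
  rw [mem_ball_zero_iff] at hz hw
  exact (norm_herm_le z w).trans_lt
    (mul_lt_one_of_nonneg_of_lt_one_left (norm_nonneg _) hz hw.le)

lemma hcomp_kernel (a : ℝ) (w : Ball n) {z : Cn n} (hz : z ∈ ball (0 : Cn n) 1) (k : ℕ) :
    hcomp k (ext (kernel n a w)) z = pochRatio 1 a k * herm z w ^ k := by
  refine hcomp_eq_of_hasSum (differentiableOn_ext _)
    (c := fun k => (pochRatio 1 a k : ℂ) * herm z w ^ k) (fun x hx => ?_) k
  have hxz := smul_mem_unitBall hz hx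
  have h := hasSum_one_div_one_sub_cpow a (norm_herm_lt_one hxz w.2)
  rw [ext_coe (kernel n a w) ⟨_, hxz⟩]
  refine hasSum_of_eq (fun k => ?_) h
  rw [herm_smul_left, mul_pow]; ring

/-- The multiplier `(b)_k / (a)_k` maps the kernels of exponent `a` to those of exponent `b`. -/
lemma multOp_pochRatio_kernel {a : ℝ} (b : ℝ) (ha : ∀ k : ℕ, a + k ≠ 0) (w : Ball n) :
    multOp (isMultiplier_pochRatio a b) (kernel n a w) = kernel n b w := by
  refine eq_of_hcomp_eq fun k z hz => ?_
  rw [hcomp_multOp _ _ hz, hcomp_kernel _ _ hz, hcomp_kernel _ _ hz, ← mul_assoc,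
    mul_comm (pochRatio a b k : ℂ), ← Complex.ofReal_mul, pochRatio_mul ha]

lemma multOp_pochRatio_comp {a b : ℝ} (ha : ∀ k : ℕ, a + k ≠ 0) (hb : ∀ k : ℕ, b + k ≠ 0)
    (f : HolBall n) :
    multOp (isMultiplier_pochRatio b a) (multOp (isMultiplier_pochRatio a b) f) = f := by
  refine eq_of_hcomp_eq fun k z hz => ?_
  rw [hcomp_multOp _ _ hz, hcomp_multOp _ _ hz, ← mul_assoc, ← Complex.ofReal_mul,
    pochRatio_mul ha, pochRatio_self hb, Complex.ofReal_one, one_mul]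

/-! ### Density of the kernels -/

/-- The homogeneous component of degree `k`, as an element of `HolBall n`. -/
def homog (k : ℕ) (f : HolBall n) : HolBall n :=
  ofDiff (hcomp k (ext f)) (differentiable_hcomp k _).differentiableOn

/-- The homogeneous expansion converges uniformly on compact sets. -/
lemma hasSum_homog (f : HolBall n) : HasSum (fun k => homog k f) f := by
  have hval : ∀ s : Finset ℕ, (∑ k ∈ s, homog k f).1 = ∑ k ∈ s, (homog k f).1 := fun s =>
    Submodule.coe_sum _ _ _
  rw [HasSum, tendsto_subtype_rng]
  simp only [hval]
  rw [ContinuousMap.tendsto_iff_forall_isCompact_tendstoUniformlyOn]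
  intro K hK
  obtain ⟨r, hr0, hr1, hr⟩ := exists_radius_of_isCompact hK
  obtain ⟨r', h3, h4⟩ := exists_between hr1
  have hr'0 := hr0.trans h3
  obtain ⟨M, -, hM⟩ := exists_bound_closedBall (differentiableOn_ext f) h4
  have hs : Summable fun k : ℕ => M * (‖(1 : ℂ)‖ * (r / r') ^ k) :=
    ((summable_geometric_of_lt_one (by positivity) ((div_lt_one hr'0).2 h3)).mul_left _).mul_left M
  have h := tendstoUniformlyOn_tsum hs (s := K)
    (f := fun k (z : Ball n) => (homog k f).1 z) (fun k z hz => by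
      have := norm_mul_hcomp_le (m := fun _ => 1) (differentiableOn_ext f) hr0 hr'0 h4 hM
        (hr z hz) k
      rwa [one_mul] at this)
  have h5 : (fun z : Ball n => ∑' k, (homog k f).1 z) = fun z => f.1 z := by
    funext z
    rw [← ext_coe f z]
    exact (hasSum_hcomp (differentiableOn_ext f) z.2).tsum_eq
  rw [h5] at h
  simp only [ContinuousMap.coe_sum, Finset.sum_apply, SummationFilter.unconditional_filter]
  exact h

/-- The holomorphic function `z ↦ ⟨z, w⟩ ^ k`. -/
def hermPow (k : ℕ) (w : Cn n) : HolBall n :=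
  ofDiff (fun z => herm z w ^ k)
    (Differentiable.differentiableOn ((innerSL ℂ w).differentiable.pow k))

/-- The monomial `z ↦ ∏ i, z (p i)`. -/
def monom {k : ℕ} (p : Fin k → Fin n) : HolBall n :=
  ofDiff (fun z => ∏ i, z (p i))
    (fun _ _ => (HasFDerivAt.finsetProd (u := Finset.univ) (g := fun i (z : Cn n) => z (p i))
      fun i _ => (EuclideanSpace.proj (𝕜 := ℂ) (p i)).hasFDerivAt)
        |>.differentiableAt.differentiableWithinAt)

lemma hermPow_eq_sum (k : ℕ) (w : Cn n) :
    hermPow k w = ∑ p : Fin k → Fin n, (∏ i, (starRingEnd ℂ) (w (p i))) • monom p := by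
  refine HolBall.ext' fun z => ?_
  have h1 : (∑ p : Fin k → Fin n, (∏ i, (starRingEnd ℂ) (w (p i))) • monom p).1 z =
      ∑ p : Fin k → Fin n, (∏ i, (starRingEnd ℂ) (w (p i))) * ∏ i, (z : Cn n) (p i) := by
    rw [Submodule.coe_sum, ContinuousMap.coe_sum, Finset.sum_apply]
    rfl
  rw [h1]
  have h2 : herm (z : Cn n) w = ∑ j, (starRingEnd ℂ) (w j) * (z : Cn n) j := by
    rw [herm, PiLp.inner_apply]
    simp [mul_comm]
  change herm (z : Cn n) w ^ k = _
  rw [h2, Fintype.sum_pow]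
  simp only [Finset.prod_mul_distrib]

lemma homog_eq_sum (k : ℕ) (f : HolBall n) :
    ∃ a : (Fin k → Fin n) → ℂ, homog k f = ∑ p, a p • monom p := by
  refine ⟨fun p => (k ! : ℂ)⁻¹ *
    iteratedFDeriv ℂ k (ext f) 0 (fun i => EuclideanSpace.basisFun (Fin n) ℂ (p i)),
    HolBall.ext' fun z => ?_⟩
  rw [Submodule.coe_sum, ContinuousMap.coe_sum, Finset.sum_apply]
  change hcomp k (ext f) z = ∑ p : Fin k → Fin n, _ * ∏ i, (z : Cn n) (p i)
  have hz := (EuclideanSpace.basisFun (Fin n) ℂ).sum_repr (z : Cn n)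
  have h1 : hcomp k (ext f) z = (k ! : ℂ)⁻¹ * iteratedFDeriv ℂ k (ext f) 0 (fun _ => ∑ j,
      (z : Cn n) j • EuclideanSpace.basisFun (Fin n) ℂ j) := by
    rw [hcomp]
    congr 2
    funext i
    exact hz.symm
  rw [h1, ContinuousMultilinearMap.map_sum, Finset.mul_sum]
  refine Finset.sum_congr rfl fun p _ => ?_
  rw [ContinuousMultilinearMap.map_smul_univ (iteratedFDeriv ℂ k (ext f) 0)
    (fun i => (z : Cn n) (p i)) (fun i => EuclideanSpace.basisFun (Fin n) ℂ (p i)), smul_eq_mul]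
  ring

/-- If a linear functional kills all powers `⟨·, w⟩ ^ k`, it kills all monomials of degree `k`:
its values on the powers are a polynomial in `conj w` whose coefficients are multiples of its values
on the monomials. -/
lemma apply_monom_eq_zero (Λ : HolBall n →L[ℂ] ℂ) {k : ℕ}
    (h : ∀ w : Cn n, Λ (hermPow k w) = 0) (p : Fin k → Fin n) : Λ (monom p) = 0 := by
  classical
  let deg : (Fin k → Fin n) → (Fin n →₀ ℕ) := fun p => ∑ i, Finsupp.single (p i) 1
  let P : MvPolynomial (Fin n) ℂ := ∑ p : Fin k → Fin n, MvPolynomial.monomial (deg p) (Λ (monom p))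
  have hmono : ∀ (p : Fin k → Fin n) (x : Fin n → ℂ),
      (deg p).prod (fun j e => x j ^ e) = ∏ i, x (p i) := by
    intro p x
    rw [← Finsupp.prod_finsetSum_index (by simp) (by intros; exact pow_add _ _ _)]
    refine Finset.prod_congr rfl fun i _ => ?_
    rw [Finsupp.prod_single_index (by simp), pow_one]
  have hP : P = 0 := by
    refine MvPolynomial.funext fun x => ?_
    have h1 := h (WithLp.toLp 2 fun j => (starRingEnd ℂ) (x j))
    rw [hermPow_eq_sum, map_sum] at h1
    simp only [map_smul, Complex.conj_conj, smul_eq_mul] at h1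
    simp only [P, map_sum, MvPolynomial.eval_monomial, hmono, map_zero]
    rw [← h1]
    exact Finset.sum_congr rfl fun p _ => mul_comm _ _
  have hcoef := congrArg (MvPolynomial.coeff (deg p)) hP
  simp only [P, MvPolynomial.coeff_sum, MvPolynomial.coeff_monomial, MvPolynomial.coeff_zero]
    at hcoef
  have hsame : ∀ p', deg p' = deg p → monom p' = monom p := by
    intro p' hp
    refine HolBall.ext' fun z => ?_
    change ∏ i, (z : Cn n) (p' i) = ∏ i, (z : Cn n) (p i)
    rw [← hmono p', ← hmono p, hp]
  have h2 : ∑ p', (if deg p' = deg p then Λ (monom p') else 0) =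
      (Finset.univ.filter fun p' => deg p' = deg p).card * Λ (monom p) := by
    rw [← Finset.sum_filter, Finset.sum_congr rfl (g := fun _ => Λ (monom p)), Finset.sum_const,
      nsmul_eq_mul]
    intro p' hp'
    rw [hsame p' (Finset.mem_filter.1 hp').2]
  rw [h2] at hcoef
  refine (mul_eq_zero.1 hcoef).resolve_left ?_
  have : p ∈ Finset.univ.filter fun p' => deg p' = deg p := by simp
  exact_mod_cast (Finset.card_pos.2 ⟨p, this⟩).ne'

lemma homog_kernel (a : ℝ) (w : Ball n) (k : ℕ) :
    homog k (kernel n a w) = (pochRatio 1 a k : ℂ) • hermPow k w :=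
  HolBall.ext' fun z => hcomp_kernel a w z.2 k

lemma hermPow_smul (k : ℕ) (c : ℂ) (w : Cn n) :
    hermPow k (c • w) = ((starRingEnd ℂ) c) ^ k • hermPow k w := by
  refine HolBall.ext' fun z => ?_
  change herm (z : Cn n) (c • w) ^ k = ((starRingEnd ℂ) c) ^ k * herm (z : Cn n) w ^ k
  rw [herm_smul_right, mul_pow]

/-- The kernels of exponent `a ∉ {0, -1, -2, …}` span a dense subspace, in dual form. For fixed `w`,
the functional is applied to the kernels at `conj x • w`; the result is a power series in `x` whose
coefficients are nonzero multiples of the values on the powers `⟨·, w⟩ ^ k`. -/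
lemma eq_zero_of_kernel {a : ℝ} (ha : ∀ k : ℕ, a + k ≠ 0) (Λ : HolBall n →L[ℂ] ℂ)
    (h : ∀ w : Ball n, Λ (kernel n a w) = 0) (f : HolBall n) : Λ f = 0 := by
  have hball : ∀ (k : ℕ) (w : Ball n), Λ (hermPow k w) = 0 := by
    intro k w
    have h1 := coeff_eq_of_hasSum (g := fun _ => 0)
      (c := fun k => (pochRatio 1 a k : ℂ) * Λ (hermPow k w)) (fun x hx => ?_) k
    · have h2 : iteratedDeriv k (fun _ : ℂ => (0 : ℂ)) 0 = 0 := by simp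
      rw [h2] at h1
      have hne : (pochRatio 1 a k : ℂ) ≠ 0 := by
        exact_mod_cast pochRatio_ne_zero (fun k => by positivity) ha k
      have h3 := (mul_eq_zero.1 h1.symm).resolve_left (by exact_mod_cast k.factorial_ne_zero)
      exact (mul_eq_zero.1 h3).resolve_left hne
    · have hw : (starRingEnd ℂ) x • (w : Cn n) ∈ ball (0 : Cn n) 1 :=
        smul_mem_unitBall w.2 (by rwa [RCLike.norm_conj])
      have h2 := (hasSum_homog (kernel n a ⟨_, hw⟩)).mapL Λ
      rw [h] at h2
      refine hasSum_of_eq (fun k => ?_) h2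
      rw [homog_kernel, hermPow_smul, map_smul, map_smul, Complex.conj_conj]
      simp only [smul_eq_mul]
      ring
  have hall : ∀ (k : ℕ) (w : Cn n), Λ (hermPow k w) = 0 := by
    intro k w
    have hpos : 0 < ‖w‖ + 1 := by positivity
    have hw : ((‖w‖ + 1 : ℝ) : ℂ)⁻¹ • w ∈ ball (0 : Cn n) 1 := by
      rw [mem_ball_zero_iff, norm_smul, norm_inv, Complex.norm_real, Real.norm_of_nonneg hpos.le,
        inv_mul_lt_iff₀ hpos]
      linarith
    have h1 := hball k ⟨_, hw⟩
    rw [hermPow_smul, map_smul, smul_eq_zero] at h1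
    refine h1.resolve_left (pow_ne_zero _ ?_)
    rw [Ne, map_eq_zero]
    exact inv_ne_zero (by exact_mod_cast hpos.ne')
  have h2 := (hasSum_homog f).mapL Λ
  refine h2.unique ?_
  refine hasSum_of_eq (fun k => ?_) hasSum_zero
  obtain ⟨a, ha⟩ := homog_eq_sum k f
  rw [ha, map_sum]
  simp only [map_smul, apply_monom_eq_zero Λ (hall k), smul_zero, Finset.sum_const_zero]

/-- Evaluation at a point of the ball. -/
def evalCLM (z : Ball n) : HolBall n →L[ℂ] ℂ :=
  (ContinuousMap.evalCLM ℂ z).comp (HolBall n).subtypeL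

/-- A continuous operator that maps kernels to kernels is a multiplier operator. -/
lemma eq_multOp_of_kernel {a b : ℝ} (ha : ∀ k : ℕ, a + k ≠ 0) {R : HolBall n →L[ℂ] HolBall n}
    (hR : ∀ w : Ball n, R (kernel n a w) = kernel n b w) :
    R = multOp (isMultiplier_pochRatio a b) := by
  refine ContinuousLinearMap.ext fun f => HolBall.ext' fun z => ?_
  let Λ₁ := (evalCLM z).comp R
  let Λ₂ := (evalCLM z).comp (multOp (n := n) (isMultiplier_pochRatio a b))
  have h := eq_zero_of_kernel ha
    ⟨Λ₁.toLinearMap - Λ₂.toLinearMap, Λ₁.continuous.sub Λ₂.continuous⟩ (fun w => ?_) f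
  · exact sub_eq_zero.1 h
  · change (evalCLM z) (R (kernel n a w)) -
      (evalCLM z) (multOp (isMultiplier_pochRatio a b) (kernel n a w)) = 0
    rw [hR, multOp_pochRatio_kernel b ha, sub_self]

lemma isFracDiff_multOp {s t : ℝ} (hs : ∀ k : ℕ, (n + 1 + s : ℝ) + k ≠ 0) :
    IsFracDiff n s t (multOp (isMultiplier_pochRatio (n + 1 + s) (n + 1 + s + t))) :=
  fun w => multOp_pochRatio_kernel _ hs w

lemma existsUnique_isFracDiff {s : ℝ} (t : ℝ) (hs : ∀ k : ℕ, (n + 1 + s : ℝ) + k ≠ 0) :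
    ∃! R : HolBall n →L[ℂ] HolBall n, IsFracDiff n s t R :=
  ⟨_, isFracDiff_multOp hs, fun _ hR => eq_multOp_of_kernel hs hR⟩

lemma fracDiff_eq {s : ℝ} (t : ℝ) (hs : ∀ k : ℕ, (n + 1 + s : ℝ) + k ≠ 0) :
    fracDiff n s t = multOp (isMultiplier_pochRatio (n + 1 + s) (n + 1 + s + t)) := by
  have h := existsUnique_isFracDiff (n := n) t hs
  rw [fracDiff, dif_pos h]
  exact eq_multOp_of_kernel hs h.choose_spec.1

/-! ### Nonisotropic geometry of the ball -/

/-- The defining function `1 - |z|²` of the ball. -/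
def rho (z : Cn n) : ℝ := 1 - ‖z‖ ^ 2

/-- The tube `{z ∈ 𝔹 : |1 - ⟨z, ζ⟩| < r}` of size `r` at the boundary point `ζ`. -/
def tubeAt (ζ : Cn n) (r : ℝ) : Set (Cn n) := {z | z ∈ ball (0 : Cn n) 1 ∧ ‖1 - herm z ζ‖ < r}

lemma rho_pos {z : Cn n} (hz : z ∈ ball (0 : Cn n) 1) : 0 < rho z := by
  rw [mem_ball_zero_iff] at hz
  have := norm_nonneg z
  unfold rho; nlinarith

lemma rho_le_one (z : Cn n) : rho z ≤ 1 := by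
  unfold rho; nlinarith [norm_nonneg z]

lemma herm_comm (z w : Cn n) : herm w z = (starRingEnd ℂ) (herm z w) :=
  (inner_conj_symm z w).symm

lemma norm_one_sub_herm_comm (z w : Cn n) : ‖1 - herm z w‖ = ‖1 - herm w z‖ := by
  rw [herm_comm z w, ← RCLike.norm_conj, map_sub, map_one]

lemma herm_self (z : Cn n) : herm z z = ((‖z‖ ^ 2 : ℝ) : ℂ) := by
  rw [herm, inner_self_eq_norm_sq_to_K]; norm_cast

lemma herm_add_left (z z' w : Cn n) : herm (z + z') w = herm z w + herm z' w :=
  inner_add_right _ _ _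

lemma herm_sub_left (z z' w : Cn n) : herm (z - z') w = herm z w - herm z' w :=
  inner_sub_right _ _ _

lemma herm_sub_right (z w w' : Cn n) : herm z (w - w') = herm z w - herm z w' :=
  inner_sub_left _ _ _

lemma measurable_rho : Measurable (rho (n := n)) := by unfold rho; fun_prop

lemma continuous_herm_left (w : Cn n) : Continuous fun z => herm z w := by unfold herm; fun_prop

lemma measurableSet_tubeAt (ζ : Cn n) (r : ℝ) : MeasurableSet (tubeAt ζ r) := by
  have h : IsOpen {z : Cn n | ‖1 - herm z ζ‖ < r} :=
    isOpen_lt ((continuous_const.sub (continuous_herm_left ζ)).norm) continuous_const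
  exact (isOpen_ball.inter h).measurableSet

lemma one_sub_norm_le {z w : Cn n} (hw : ‖w‖ ≤ 1) : 1 - ‖z‖ ≤ ‖1 - herm z w‖ := by
  have h1 : ‖herm z w‖ ≤ ‖z‖ := (norm_herm_le z w).trans
    (mul_le_of_le_one_right (norm_nonneg _) hw)
  have h2 : ‖(1 : ℂ)‖ - ‖herm z w‖ ≤ ‖1 - herm z w‖ := norm_sub_norm_le _ _
  rw [norm_one] at h2
  linarith

lemma rho_le_two_mul {z w : Cn n} (hz : ‖z‖ ≤ 1) (hw : ‖w‖ ≤ 1) :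
    rho z ≤ 2 * ‖1 - herm z w‖ := by
  have h1 := one_sub_norm_le (z := z) hw
  have := norm_nonneg z
  unfold rho; nlinarith

lemma norm_sub_sq_le {z w : Cn n} (hz : ‖z‖ ≤ 1) (hw : ‖w‖ ≤ 1) :
    ‖z - w‖ ^ 2 ≤ 2 * ‖1 - herm z w‖ := by
  have h1 : ‖z - w‖ ^ 2 = ‖z‖ ^ 2 - 2 * (herm z w).re + ‖w‖ ^ 2 := by
    have := norm_sub_sq (𝕜 := ℂ) z w
    rw [this, herm, inner_re_symm]; rfl
  have h2 : (1 - herm z w).re ≤ ‖1 - herm z w‖ := Complex.re_le_norm _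
  rw [Complex.sub_re, Complex.one_re] at h2
  nlinarith [norm_nonneg z, norm_nonneg w]

/-- The quasi-triangle inequality for `|1 - ⟨z, w⟩|` on the closed ball. It follows from an identity
for `1 - ⟨w, ζ⟩` with error terms `⟨w - z, z - ζ⟩` and `1 - |z|²`. -/
lemma norm_one_sub_herm_le {z w ζ : Cn n} (hz : ‖z‖ ≤ 1) (hw : ‖w‖ ≤ 1) (hζ : ‖ζ‖ ≤ 1) :
    ‖1 - herm w ζ‖ ≤ 2 * ‖1 - herm z w‖ + 4 * ‖1 - herm z ζ‖ := by
  set A := ‖1 - herm z w‖ with hA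
  set D := ‖1 - herm z ζ‖ with hD
  have hid : 1 - herm w ζ = (1 - herm w z) + herm (w - z) (z - ζ) +
      ((1 - herm z ζ) - (rho z : ℂ)) := by
    rw [herm_sub_left, herm_sub_right, herm_sub_right, herm_self, rho]
    push_cast; ring
  have h1 : ‖herm (w - z) (z - ζ)‖ ≤ A + D := by
    have h2 := norm_herm_le (w - z) (z - ζ)
    have h3 := norm_sub_sq_le hw hz
    have h4 := norm_sub_sq_le hz hζ
    rw [norm_one_sub_herm_comm, ← hA] at h3
    nlinarith [sq_nonneg (‖w - z‖ - ‖z - ζ‖)]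
  have h5 : ‖(rho z : ℂ)‖ ≤ 2 * D := by
    rw [Complex.norm_real, Real.norm_of_nonneg (by unfold rho; nlinarith [norm_nonneg z])]
    exact rho_le_two_mul hz hζ
  rw [hid]
  calc _ ≤ ‖1 - herm w z‖ + ‖herm (w - z) (z - ζ)‖ + (‖1 - herm z ζ‖ + ‖(rho z : ℂ)‖) :=
        (norm_add_le _ _).trans (add_le_add (norm_add_le _ _) (norm_sub_le _ _))
    _ ≤ A + (A + D) + (D + 2 * D) := by
        rw [norm_one_sub_herm_comm w z]; gcongr
    _ = _ := by ring

lemma exists_norm_eq_one (hn : 1 ≤ n) : ∃ ω : Cn n, ‖ω‖ = 1 :=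
  ⟨EuclideanSpace.basisFun (Fin n) ℂ ⟨0, hn⟩, (EuclideanSpace.basisFun (Fin n) ℂ).norm_eq_one _⟩

lemma norm_one_sub_herm_lt_two {z w : Cn n} (hz : z ∈ ball (0 : Cn n) 1) (hw : ‖w‖ ≤ 1) :
    ‖1 - herm z w‖ < 2 := by
  rw [mem_ball_zero_iff] at hz
  have h1 : ‖herm z w‖ ≤ ‖z‖ := (norm_herm_le z w).trans
    (mul_le_of_le_one_right (norm_nonneg _) hw)
  calc ‖1 - herm z w‖ ≤ ‖(1 : ℂ)‖ + ‖herm z w‖ := norm_sub_le _ _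
    _ < 2 := by rw [norm_one]; linarith

lemma tubeAt_two {ζ : Cn n} (hζ : ‖ζ‖ = 1) : tubeAt ζ 2 = ball 0 1 :=
  Set.Subset.antisymm (fun _ hz => hz.1) fun _ hz => ⟨hz, norm_one_sub_herm_lt_two hz hζ.le⟩

/-- A point `w` of the ball can be replaced by its radial projection to the sphere, at the cost of a
factor `2`. -/
lemma exists_sphere_point (hn : 1 ≤ n) {w : Cn n} (hw : ‖w‖ ≤ 1) :
    ∃ ω : Cn n, ‖ω‖ = 1 ∧ w = (‖w‖ : ℂ) • ω ∧
      ∀ z ∈ ball (0 : Cn n) 1, ‖1 - herm z ω‖ ≤ 2 * ‖1 - herm z w‖ := by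
  have hex : ∃ ω : Cn n, ‖ω‖ = 1 ∧ w = (‖w‖ : ℂ) • ω := by
    rcases eq_or_ne w 0 with rfl | h0
    · obtain ⟨ω, hω⟩ := exists_norm_eq_one hn
      exact ⟨ω, hω, by simp⟩
    · have hw0 := norm_pos_iff.2 h0
      refine ⟨((‖w‖ : ℂ)⁻¹) • w, ?_, ?_⟩
      · rw [norm_smul, norm_inv, Complex.norm_real, norm_norm, inv_mul_cancel₀ hw0.ne']
      · rw [smul_smul, mul_inv_cancel₀ (by exact_mod_cast hw0.ne'), one_smul]
  obtain ⟨ω, hω, h⟩ := hex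
  refine ⟨ω, hω, h, fun z hz => ?_⟩
  rw [mem_ball_zero_iff] at hz
  have h1 : 1 - herm z ω = (1 - herm z w) - ((1 - ‖w‖ : ℝ) : ℂ) * herm z ω := by
    conv_rhs => rw [h, herm_smul_right, Complex.conj_ofReal]
    rw [norm_smul, hω]
    simp only [Complex.norm_real, norm_norm, mul_one]
    push_cast; ring
  have h2 : ‖herm z ω‖ ≤ 1 := (norm_herm_le z ω).trans (by rw [hω, mul_one]; exact hz.le)
  have h3 : 1 - ‖w‖ ≤ ‖1 - herm z w‖ := by
    rw [norm_one_sub_herm_comm]; exact one_sub_norm_le hz.le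
  rw [h1]
  calc _ ≤ ‖1 - herm z w‖ + ‖((1 - ‖w‖ : ℝ) : ℂ) * herm z ω‖ := norm_sub_le _ _
    _ ≤ ‖1 - herm z w‖ + (1 - ‖w‖) * 1 := by
        rw [norm_mul, Complex.norm_real, Real.norm_of_nonneg (by linarith)]
        gcongr
    _ ≤ _ := by linarith

/-! ### Volume estimates -/

/-- Unitary maps preserve volume. -/
lemma measurePreserving_unitary (U : Cn n ≃ₗᵢ[ℂ] Cn n) :
    MeasurePreserving U (volume : Measure (Cn n)) volume := by
  let V : Cn n ≃ₗᵢ[ℝ] Cn n := { U.toLinearEquiv.restrictScalars ℝ with norm_map' := U.norm_map }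
  exact V.measurePreserving

/-- Unitary coordinates adapted to a point `ω` of the sphere, and the volume of the corresponding
polydiscs, up to a normalizing constant. -/
lemma exists_adapted_coords (hn : 1 ≤ n) : ∃ κ : ℝ≥0∞, κ ≠ 0 ∧ κ ≠ ∞ ∧
    ∀ ω : Cn n, ‖ω‖ = 1 → ∃ y : Cn n → Fin n → ℂ, (∀ z, y z ⟨0, hn⟩ = herm z ω) ∧
      (∀ z, ∑ i, ‖y z i‖ ^ 2 = ‖z‖ ^ 2) ∧
      ∀ (c : ℂ) (R s : ℝ), 0 ≤ R → 0 ≤ s →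
        volume {z | ‖y z ⟨0, hn⟩ - c‖ < R ∧ ∀ i ≠ ⟨0, hn⟩, ‖y z i‖ ^ 2 < s} =
          κ * ENNReal.ofReal (R ^ 2 * s ^ (n - 1)) := by
  classical
  let e := PiLp.continuousLinearEquiv 2 ℝ (fun _ : Fin n => ℂ)
  let μ : Measure (Fin n → ℂ) := (volume : Measure (Cn n)).map e
  have hμ : μ.IsAddHaarMeasure := e.isAddHaarMeasure_map _
  let κ₀ : NNReal := Measure.addHaarScalarFactor μ volume
  have hκ : μ = κ₀ • (volume : Measure (Fin n → ℂ)) := Measure.isAddLeftInvariant_eq_smul μ volume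
  have hκ0 : κ₀ ≠ 0 := (Measure.addHaarScalarFactor_pos_of_isAddHaarMeasure μ volume).ne'
  refine ⟨κ₀ * NNReal.pi ^ n, mul_ne_zero (by exact_mod_cast hκ0)
      (pow_ne_zero _ (by exact_mod_cast NNReal.pi_ne_zero)),
    ENNReal.mul_ne_top ENNReal.coe_ne_top (ENNReal.pow_ne_top ENNReal.coe_ne_top), ?_⟩
  intro ω hω
  set i₀ : Fin n := ⟨0, hn⟩
  obtain ⟨b, hb⟩ := Orthonormal.exists_orthonormalBasis_extension_of_card_eq (𝕜 := ℂ)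
    (E := Cn n) (ι := Fin n) (by simp) (v := fun _ => ω) (s := {i₀}) (by
      rw [orthonormal_iff_ite]
      intro i j
      have hi : i = j := Subsingleton.elim _ _
      simp [hi, inner_self_eq_norm_sq_to_K, hω])
  have hb0 : b i₀ = ω := hb i₀ rfl
  refine ⟨fun z => b.repr z, fun z => ?_, fun z => ?_, fun c R s hR hs => ?_⟩
  · change b.repr z i₀ = _
    rw [b.repr_apply_apply, hb0]; rfl
  · rw [← b.repr.norm_map z, EuclideanSpace.norm_sq_eq]
  let ρ : Fin n → ℝ := fun i => if i = i₀ then R else √s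
  let ctr : Fin n → ℂ := fun i => if i = i₀ then c else 0
  have hset : {z | ‖b.repr z i₀ - c‖ < R ∧ ∀ i ≠ i₀, ‖b.repr z i‖ ^ 2 < s} =
      b.repr ⁻¹' (e ⁻¹' (Set.univ.pi fun i => ball (ctr i) (ρ i))) := by
    ext z
    simp only [Set.mem_preimage, Set.mem_univ_pi, mem_ball, dist_eq_norm]
    have he : ∀ i, e (b.repr z) i = b.repr z i := fun i => rfl
    simp only [he]
    constructor
    · rintro ⟨h1, h2⟩ i
      by_cases hi : i = i₀
      · subst hi; simpa [ctr, ρ] using h1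
      · simpa [ctr, ρ, hi] using Real.lt_sqrt_of_sq_lt (h2 i hi)
    · intro h
      refine ⟨by simpa [ctr, ρ] using h i₀, fun i hi => ?_⟩
      have := h i
      simp only [ctr, ρ, if_neg hi, sub_zero] at this
      exact (Real.lt_sqrt (norm_nonneg _)).1 this
  rw [hset]
  have hm : MeasurableSet (Set.univ.pi fun i => ball (ctr i) (ρ i)) :=
    MeasurableSet.univ_pi fun i => measurableSet_ball
  have hem : Measurable e := e.continuous.measurable
  rw [(measurePreserving_unitary b.repr).measure_preimage (hem hm).nullMeasurableSet,
    ← Measure.map_apply hem hm]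
  change μ _ = _
  rw [hκ, Measure.smul_apply, volume_pi_pi]
  simp only [Complex.volume_ball, Finset.prod_mul_distrib, Finset.prod_const, Finset.card_univ,
    Fintype.card_fin]
  have hprod : ∏ i, ENNReal.ofReal (ρ i) ^ 2 = ENNReal.ofReal (R ^ 2 * s ^ (n - 1)) := by
    rw [← Finset.mul_prod_erase _ _ (Finset.mem_univ i₀), ENNReal.ofReal_mul (by positivity)]
    congr 1
    · simp [ρ, ENNReal.ofReal_pow hR]
    · rw [Finset.prod_congr rfl (g := fun _ => ENNReal.ofReal s)]
      · rw [Finset.prod_const, Finset.card_erase_of_mem (Finset.mem_univ _), Finset.card_univ,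
          Fintype.card_fin, ENNReal.ofReal_pow hs]
      · intro i hi
        simp only [ρ, if_neg (Finset.ne_of_mem_erase hi)]
        rw [← ENNReal.ofReal_pow (Real.sqrt_nonneg _), Real.sq_sqrt hs]
  rw [hprod, ENNReal.smul_def, smul_eq_mul]
  ring

/-- A tube of size `R`, extended slightly across the sphere, has volume `O(R ^ (n + 1))`. -/
lemma volume_tube_le (hn : 1 ≤ n) : ∃ C : ℝ≥0∞, C ≠ ∞ ∧ ∀ ζ : Cn n, ‖ζ‖ = 1 → ∀ R : ℝ, 0 < R →
    volume {z : Cn n | ‖1 - herm z ζ‖ < R ∧ ‖z‖ ^ 2 < 1 + R} ≤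
      C * ENNReal.ofReal (R ^ (n + 1)) := by
  obtain ⟨κ, -, hκ, h⟩ := exists_adapted_coords hn
  refine ⟨κ * ENNReal.ofReal (3 ^ (n - 1)), ENNReal.mul_ne_top hκ ENNReal.ofReal_ne_top,
    fun ζ hζ R hR => ?_⟩
  obtain ⟨y, hy0, hy, hvol⟩ := h ζ hζ
  have hsub : {z : Cn n | ‖1 - herm z ζ‖ < R ∧ ‖z‖ ^ 2 < 1 + R} ⊆
      {z | ‖y z ⟨0, hn⟩ - 1‖ < R ∧ ∀ i ≠ ⟨0, hn⟩, ‖y z i‖ ^ 2 < 3 * R} := by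
    rintro z ⟨h1, h2⟩
    refine ⟨by rwa [hy0, norm_sub_rev], fun i hi => ?_⟩
    have h3 : ‖y z ⟨0, hn⟩‖ ^ 2 + ‖y z i‖ ^ 2 ≤ ‖z‖ ^ 2 := by
      rw [← hy z, ← Finset.sum_pair (f := fun i => ‖y z i‖ ^ 2) hi.symm]
      exact Finset.sum_le_sum_of_subset_of_nonneg (Finset.subset_univ _) fun _ _ _ => by positivity
    have h4 : 1 - ‖herm z ζ‖ ≤ ‖1 - herm z ζ‖ := by
      simpa using norm_sub_norm_le (1 : ℂ) (herm z ζ)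
    rw [hy0] at h3
    nlinarith [sq_nonneg (‖herm z ζ‖ - 1)]
  refine (measure_mono hsub).trans (le_of_eq ?_)
  rw [hvol 1 R (3 * R) hR.le (by positivity), mul_assoc, ← ENNReal.ofReal_mul (by positivity)]
  congr 2
  obtain ⟨m, rfl⟩ : ∃ m, n = m + 1 := ⟨n - 1, by omega⟩
  simp only [Nat.add_sub_cancel, mul_pow]
  ring

/-- Nonisotropic polydiscs of size `h` centred at the origin have volume at least a multiple of
`h ^ (n + 1)`. -/
lemma le_volume_polydisc (hn : 1 ≤ n) : ∃ c : ℝ≥0∞, c ≠ 0 ∧ c ≠ ∞ ∧ ∀ z : Cn n, ‖z‖ ≤ 1 →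
    ∀ h : ℝ, 0 < h → h ≤ 1 →
    c * ENNReal.ofReal (h ^ (n + 1)) ≤ volume {v : Cn n | ‖herm v z‖ < h ∧ ‖v‖ ^ 2 < h} := by
  obtain ⟨κ, hκ0, hκ, H⟩ := exists_adapted_coords hn
  have hn' : (0 : ℝ) < n := by exact_mod_cast hn
  have hn1 : (1 : ℝ) ≤ n := by exact_mod_cast hn
  refine ⟨κ * ENNReal.ofReal ((1 / n : ℝ) ^ (n + 1)), mul_ne_zero hκ0 ?_,
    ENNReal.mul_ne_top hκ ENNReal.ofReal_ne_top, fun z hz h h0 h1 => ?_⟩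
  · rw [Ne, ENNReal.ofReal_eq_zero, not_le]; positivity
  obtain ⟨ω, hω, hzω, -⟩ := exists_sphere_point hn hz
  obtain ⟨y, hy0, hy, hvol⟩ := H ω hω
  have hdiv : h / n ≤ h := div_le_self h0.le hn1
  have hdiv0 : 0 < h / n := by positivity
  have hsub : {v | ‖y v ⟨0, hn⟩ - 0‖ < h / n ∧ ∀ i ≠ ⟨0, hn⟩, ‖y v i‖ ^ 2 < h / n} ⊆
      {v : Cn n | ‖herm v z‖ < h ∧ ‖v‖ ^ 2 < h} := by
    rintro v ⟨h2, h3⟩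
    rw [sub_zero] at h2
    have hall : ∀ i, ‖y v i‖ ^ 2 < h / n := by
      intro i
      by_cases hi : i = ⟨0, hn⟩
      · rw [hi]; nlinarith [norm_nonneg (y v ⟨0, hn⟩)]
      · exact h3 i hi
    refine ⟨?_, ?_⟩
    · rw [hzω, herm_smul_right, norm_mul, RCLike.norm_conj, Complex.norm_real, norm_norm, ← hy0]
      calc ‖z‖ * ‖y v ⟨0, hn⟩‖ ≤ 1 * ‖y v ⟨0, hn⟩‖ := by gcongr
        _ < h := by linarith
    · rw [← hy]
      calc ∑ i, ‖y v i‖ ^ 2 < ∑ _i : Fin n, h / n :=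
            Finset.sum_lt_sum_of_nonempty ⟨⟨0, hn⟩, Finset.mem_univ _⟩ fun i _ => hall i
        _ = h := by
            rw [Finset.sum_const, Finset.card_univ, Fintype.card_fin, nsmul_eq_mul]; field_simp
  refine le_trans (le_of_eq ?_) (measure_mono hsub)
  rw [hvol 0 _ _ hdiv0.le hdiv0.le, mul_assoc, ← ENNReal.ofReal_mul (by positivity)]
  congr 2
  obtain ⟨m, rfl⟩ : ∃ m, n = m + 1 := ⟨n - 1, by omega⟩
  simp only [Nat.add_sub_cancel]
  ring

lemma lintegral_Ioo_rpow_sub {δ : ℝ} (hδ : -1 < δ) {a b : ℝ} (hab : a ≤ b) :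
    ∫⁻ x in Set.Ioo a b, ENNReal.ofReal ((b - x) ^ δ) =
      ENNReal.ofReal ((b - a) ^ (1 + δ) / (1 + δ)) := by
  have h1 : IntervalIntegrable (fun x => (b - x) ^ δ) volume a b := by
    have := (intervalIntegral.intervalIntegrable_rpow' (a := b - b) (b := b - a) hδ).comp_sub_left b
    simpa using this.symm
  have h2 : ∫ x in a..b, (b - x) ^ δ = (b - a) ^ (1 + δ) / (1 + δ) := by
    rw [intervalIntegral.integral_comp_sub_left (fun x => x ^ δ) b, integral_rpow (Or.inl hδ),
      sub_self, Real.zero_rpow (by linarith), sub_zero, add_comm δ 1]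
  rw [← h2, intervalIntegral.integral_of_le hab, integral_Ioc_eq_integral_Ioo,
    ofReal_integral_eq_lintegral_ofReal]
  · exact (intervalIntegrable_iff_integrableOn_Ioo_of_le hab).1 h1
  · exact (ae_restrict_iff' measurableSet_Ioo).2 (Eventually.of_forall fun x hx =>
      Real.rpow_nonneg (by linarith [hx.2]) _)

/-- Weighted volume of tubes. For `δ < 0` the singular weight is first averaged over the dilations
`z ↦ x z` with `1 - r / 4 < x < 1`, which turns it into a bounded function. -/
lemma lintegral_tubeAt_rho_le (hn : 1 ≤ n) {δ : ℝ} (hδ : -1 < δ) :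
    ∃ C : ℝ≥0∞, C ≠ ∞ ∧ ∀ ζ : Cn n, ‖ζ‖ = 1 → ∀ r : ℝ, 0 < r →
      ∫⁻ z in tubeAt ζ r, ENNReal.ofReal (rho z ^ δ) ≤
        C * ENNReal.ofReal (r ^ ((n : ℝ) + 1 + δ)) := by
  obtain ⟨C, hC, hV⟩ := volume_tube_le hn
  rcases le_or_gt 0 δ with h0 | h0
  · refine ⟨ENNReal.ofReal (2 ^ δ) * C, ENNReal.mul_ne_top ENNReal.ofReal_ne_top hC,
      fun ζ hζ r hr => ?_⟩
    have hsub : tubeAt ζ r ⊆ {z : Cn n | ‖1 - herm z ζ‖ < r ∧ ‖z‖ ^ 2 < 1 + r} := by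
      rintro z ⟨h1, h2⟩
      rw [mem_ball_zero_iff] at h1
      exact ⟨h2, by nlinarith [norm_nonneg z]⟩
    calc ∫⁻ z in tubeAt ζ r, ENNReal.ofReal (rho z ^ δ)
        ≤ ∫⁻ _ in tubeAt ζ r, ENNReal.ofReal ((2 * r) ^ δ) := by
          refine setLIntegral_mono' (measurableSet_tubeAt ζ r) fun z hz => ?_
          refine ENNReal.ofReal_le_ofReal (Real.rpow_le_rpow (rho_pos hz.1).le ?_ h0)
          have := rho_le_two_mul (mem_ball_zero_iff.1 hz.1).le hζ.le
          linarith [hz.2]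
      _ = ENNReal.ofReal ((2 * r) ^ δ) * volume (tubeAt ζ r) := setLIntegral_const _ _
      _ ≤ ENNReal.ofReal ((2 * r) ^ δ) * (C * ENNReal.ofReal (r ^ (n + 1))) := by
          gcongr
          exact (measure_mono hsub).trans (hV ζ hζ r hr)
      _ = ENNReal.ofReal (2 ^ δ) * C * ENNReal.ofReal (r ^ ((n : ℝ) + 1 + δ)) := by
          rw [Real.mul_rpow (by norm_num) hr.le, Real.rpow_add hr,
            ENNReal.ofReal_mul (by positivity), ENNReal.ofReal_mul (by positivity)]
          norm_cast
          ring
  have hmain : ∀ ζ : Cn n, ‖ζ‖ = 1 → ∀ r : ℝ, 0 < r → r ≤ 2 →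
      ∫⁻ z in tubeAt ζ r, ENNReal.ofReal (rho z ^ δ) ≤
        ENNReal.ofReal ((1 / 4) ^ δ / (1 + δ) * 2 ^ (n + 1)) * C *
          ENNReal.ofReal (r ^ ((n : ℝ) + 1 + δ)) := by
    intro ζ hζ r hr hr2
    set F : Cn n → ℝ≥0∞ := (tubeAt ζ r).indicator fun z => ENNReal.ofReal (rho z ^ δ) with hF
    have hFm : Measurable F := by
      refine Measurable.indicator ?_ (measurableSet_tubeAt ζ r)
      exact (measurable_rho.pow_const δ).ennreal_ofReal
    set η := r / 4 with hη
    have hη0 : 0 < η := by positivity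
    have hη1 : η ≤ 1 / 2 := by rw [hη]; linarith
    -- Dilations by `x < 1` only increase the integral over the whole space.
    have hdil : ∀ x ∈ Set.Ioo (1 - η) 1, ∫⁻ z, F z ≤ ∫⁻ z, F (x • z) := by
      intro x hx
      have hx0 : 0 < x := by linarith [hx.1]
      have h1 : ∫⁻ z, F (x • z) = ∫⁻ z, F z ∂(Measure.map (x • ·) (volume : Measure (Cn n))) :=
        (lintegral_map hFm (measurable_const_smul x)).symm
      rw [h1, Measure.map_addHaar_smul _ hx0.ne', lintegral_smul_measure]
      refine le_mul_of_one_le_left (zero_le) ?_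
      rw [ENNReal.one_le_ofReal, abs_of_pos (by positivity)]
      exact (one_le_inv₀ (by positivity)).2 (pow_le_one₀ hx0.le hx.2.le)
    -- The average of the weight over the dilations is bounded, and supported in a larger tube.
    have hinner : ∀ z : Cn n, ∫⁻ x in Set.Ioo (1 - η) 1, F (x • z) ≤
        {z : Cn n | ‖1 - herm z ζ‖ < 2 * r ∧ ‖z‖ ^ 2 < 1 + 2 * r}.indicator
          (fun _ => ENNReal.ofReal (η ^ (1 + δ) / (1 + δ))) z := by
      intro z
      by_cases hex : ∃ x ∈ Set.Ioo (1 - η) 1, x • z ∈ tubeAt ζ r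
      · have hz : z ∈ {z : Cn n | ‖1 - herm z ζ‖ < 2 * r ∧ ‖z‖ ^ 2 < 1 + 2 * r} := by
          obtain ⟨x, hx, h1, h2⟩ := hex
          have hx0 : 1 / 2 < x := by linarith [hx.1]
          rw [mem_ball_zero_iff, norm_smul, Real.norm_of_nonneg (by linarith)] at h1
          have hz2 : ‖z‖ < 2 := by nlinarith [norm_nonneg z]
          have hxz : x • z = (x : ℂ) • z := (Complex.coe_smul x z).symm
          rw [hxz, herm_smul_left] at h2
          constructor
          · have h3 : 1 - herm z ζ = (1 - x * herm z ζ) - ((1 - x : ℝ) : ℂ) * herm z ζ := by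
              push_cast; ring
            have h4 : ‖herm z ζ‖ ≤ 2 := (norm_herm_le z ζ).trans (by rw [hζ]; linarith)
            rw [h3]
            calc _ ≤ ‖1 - x * herm z ζ‖ + ‖((1 - x : ℝ) : ℂ) * herm z ζ‖ := norm_sub_le _ _
              _ ≤ ‖1 - x * herm z ζ‖ + η * 2 := by
                rw [norm_mul, Complex.norm_real, Real.norm_of_nonneg (by linarith [hx.2])]
                gcongr
                linarith [hx.1]
              _ < 2 * r := by rw [hη]; linarith
          · have h5 : x * ‖z‖ * (x * ‖z‖) < 1 := by
              have := mul_nonneg (show 0 ≤ x by linarith) (norm_nonneg z)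
              nlinarith
            have h6 : (1 - η) ^ 2 * ‖z‖ ^ 2 < 1 := by
              calc (1 - η) ^ 2 * ‖z‖ ^ 2 ≤ x ^ 2 * ‖z‖ ^ 2 := by
                    gcongr
                    · linarith
                    · exact hx.1.le
                _ < 1 := by linarith
            have h7 : 1 ≤ (1 - η) ^ 2 * (1 + 2 * r) := by
              have : r = 4 * η := by rw [hη]; ring
              rw [this]; nlinarith [sq_nonneg η, mul_pos hη0 hη0]
            by_contra hcon
            have h8 : 1 + 2 * r ≤ ‖z‖ ^ 2 := not_lt.1 hcon
            have : (1 - η) ^ 2 * (1 + 2 * r) ≤ (1 - η) ^ 2 * ‖z‖ ^ 2 := by gcongr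
            linarith
        rw [Set.indicator_of_mem hz]
        obtain ⟨x₀, hx₀, -⟩ := hex
        -- `x₁` is the dilation factor at which `x z` leaves the ball, or `1`
        set x₁ : ℝ := if ‖z‖ ≤ 1 then 1 else ‖z‖⁻¹ with hx₁
        have hx₁1 : x₁ ≤ 1 := by
          rw [hx₁]; split_ifs with h
          · exact le_rfl
          · exact inv_le_one_of_one_le₀ (not_le.1 h).le
        have hpt : ∀ x ∈ Set.Ioo (1 - η) 1, F (x • z) ≤
            (Set.Ioo (1 - η) x₁).indicator (fun x => ENNReal.ofReal ((x₁ - x) ^ δ)) x := by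
          intro x hx
          have hx0 : 0 < x := by linarith [hx.1]
          by_cases hmem : x • z ∈ tubeAt ζ r
          · have hn1 := hmem.1
            rw [mem_ball_zero_iff, norm_smul, Real.norm_of_nonneg hx0.le] at hn1
            have hlt : x < x₁ ∧ x₁ - x ≤ 1 - x * ‖z‖ := by
              rw [hx₁]; split_ifs with h
              · exact ⟨hx.2, by nlinarith⟩
              · rw [not_le] at h
                have hz0 : 0 < ‖z‖ := by linarith
                have hx' : x < ‖z‖⁻¹ := by rwa [lt_inv_comm₀ hx0 hz0, ← one_div, lt_div_iff₀ hx0,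
                  mul_comm]
                refine ⟨hx', ?_⟩
                have : 1 - x * ‖z‖ = ‖z‖ * (‖z‖⁻¹ - x) := by field_simp
                rw [this]
                exact le_mul_of_one_le_left (by linarith) h.le
            rw [hF, Set.indicator_of_mem hmem,
              Set.indicator_of_mem (show x ∈ Set.Ioo (1 - η) x₁ from ⟨hx.1, hlt.1⟩)]
            refine ENNReal.ofReal_le_ofReal ?_
            refine Real.rpow_le_rpow_of_nonpos (by linarith [hlt.1]) (hlt.2.trans ?_) h0.le
            unfold rho
            rw [norm_smul, Real.norm_of_nonneg hx0.le]
            have : 0 ≤ x * ‖z‖ := by positivity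
            nlinarith
          · rw [hF, Set.indicator_of_notMem hmem]; exact zero_le
        calc ∫⁻ x in Set.Ioo (1 - η) 1, F (x • z)
            ≤ ∫⁻ x in Set.Ioo (1 - η) 1,
              (Set.Ioo (1 - η) x₁).indicator (fun x => ENNReal.ofReal ((x₁ - x) ^ δ)) x :=
              setLIntegral_mono' measurableSet_Ioo hpt
          _ ≤ ∫⁻ x, (Set.Ioo (1 - η) x₁).indicator (fun x => ENNReal.ofReal ((x₁ - x) ^ δ)) x :=
              setLIntegral_le_lintegral _ _
          _ = ∫⁻ x in Set.Ioo (1 - η) x₁, ENNReal.ofReal ((x₁ - x) ^ δ) :=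
              lintegral_indicator measurableSet_Ioo _
          _ ≤ ENNReal.ofReal (η ^ (1 + δ) / (1 + δ)) := by
              rcases le_or_gt (1 - η) x₁ with h | h
              · rw [lintegral_Ioo_rpow_sub hδ h]
                refine ENNReal.ofReal_le_ofReal ?_
                have : 0 < 1 + δ := by linarith
                gcongr
                linarith
              · rw [Set.Ioo_eq_empty (by linarith)]; simp
      · have : ∫⁻ x in Set.Ioo (1 - η) 1, F (x • z) = 0 := by
          rw [setLIntegral_congr_fun measurableSet_Ioo (g := fun _ => 0) ?_, lintegral_zero]
          intro x hx
          exact Set.indicator_of_notMem (fun h => hex ⟨x, hx, h⟩) _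
        rw [this]; exact zero_le
    have hstep : ENNReal.ofReal η * ∫⁻ z, F z ≤
        ENNReal.ofReal (η ^ (1 + δ) / (1 + δ)) * (C * ENNReal.ofReal ((2 * r) ^ (n + 1))) := by
      calc ENNReal.ofReal η * ∫⁻ z, F z = ∫⁻ _ in Set.Ioo (1 - η) 1, ∫⁻ z, F z := by
            rw [setLIntegral_const, Real.volume_Ioo, mul_comm]; congr 2; ring
        _ ≤ ∫⁻ x in Set.Ioo (1 - η) 1, ∫⁻ z, F (x • z) :=
            setLIntegral_mono' measurableSet_Ioo hdil
        _ = ∫⁻ z, ∫⁻ x in Set.Ioo (1 - η) 1, F (x • z) := by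
            refine lintegral_lintegral_swap (Measurable.aemeasurable ?_)
            exact hFm.comp (by fun_prop : Measurable fun p : ℝ × Cn n => p.1 • p.2)
        _ ≤ ∫⁻ z, {z : Cn n | ‖1 - herm z ζ‖ < 2 * r ∧ ‖z‖ ^ 2 < 1 + 2 * r}.indicator
              (fun _ => ENNReal.ofReal (η ^ (1 + δ) / (1 + δ))) z := lintegral_mono hinner
        _ ≤ _ := by
            refine (lintegral_indicator_const_le _ _).trans ?_
            gcongr
            exact hV ζ hζ (2 * r) (by positivity)
    have hηF : ∫⁻ z in tubeAt ζ r, ENNReal.ofReal (rho z ^ δ) = ∫⁻ z, F z :=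
      (lintegral_indicator (measurableSet_tubeAt ζ r) _).symm
    rw [hηF]
    have hηne : ENNReal.ofReal η ≠ 0 := by rwa [Ne, ENNReal.ofReal_eq_zero, not_le]
    refine (ENNReal.mul_le_mul_iff_right hηne ENNReal.ofReal_ne_top).1 (hstep.trans (le_of_eq ?_))
    have h1δ : 0 < 1 + δ := by linarith
    have e1 : η ^ (1 + δ) / (1 + δ) * (2 * r) ^ (n + 1) =
        η * (((1 / 4) ^ δ / (1 + δ) * 2 ^ (n + 1)) * r ^ ((n : ℝ) + 1 + δ)) := by
      have e2 : η = 1 / 4 * r := by rw [hη]; ring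
      rw [Real.rpow_add hη0, Real.rpow_one, mul_pow, Real.rpow_add hr (n + 1 : ℝ)]
      rw [show η ^ δ = (1 / 4) ^ δ * r ^ δ by rw [e2, Real.mul_rpow (by norm_num) hr.le]]
      norm_cast
      ring
    calc _ = C * (ENNReal.ofReal (η ^ (1 + δ) / (1 + δ)) * ENNReal.ofReal ((2 * r) ^ (n + 1))) := by
          ring
      _ = _ := by
          rw [← ENNReal.ofReal_mul (by positivity), e1, ENNReal.ofReal_mul (by positivity),
            ENNReal.ofReal_mul (by positivity)]
          ring
  refine ⟨ENNReal.ofReal ((1 / 4) ^ δ / (1 + δ) * 2 ^ (n + 1)) * C,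
    ENNReal.mul_ne_top ENNReal.ofReal_ne_top hC, fun ζ hζ r hr => ?_⟩
  rcases le_or_gt r 2 with h2 | h2
  · exact hmain ζ hζ r hr h2
  · calc ∫⁻ z in tubeAt ζ r, ENNReal.ofReal (rho z ^ δ)
        ≤ ∫⁻ z in tubeAt ζ 2, ENNReal.ofReal (rho z ^ δ) := by
          refine lintegral_mono_set ?_
          rw [tubeAt_two hζ]
          exact fun z hz => hz.1
      _ ≤ _ := hmain ζ hζ 2 two_pos le_rfl
      _ ≤ _ := by
          gcongr
          have : (0 : ℝ) ≤ n := by positivity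
          linarith

/-! ### Mean value estimates on nonisotropic balls -/

/-- Multiplication by a unimodular number preserves volume. -/
lemma measurePreserving_smul_of_norm_eq_one {c : ℂ} (hc : ‖c‖ = 1) :
    MeasurePreserving (fun v : Cn n => c • v) volume volume := by
  have hc0 : c ≠ 0 := by rintro rfl; simp at hc
  let U : Cn n ≃ₗᵢ[ℂ] Cn n :=
    { LinearEquiv.smulOfNeZero ℂ (Cn n) c hc0 with
      norm_map' := fun v => by
        change ‖c • v‖ = ‖v‖
        rw [norm_smul, hc, one_mul] }
  exact measurePreserving_unitary U

/-- Jensen's inequality for powers. -/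
lemma lintegral_rpow_le {X : Type*} [MeasurableSpace X] {μ : Measure X} {q : ℝ} (hq : 1 < q)
    {g : X → ℝ≥0∞} (hg : AEMeasurable g μ) :
    (∫⁻ x, g x ∂μ) ^ q ≤ μ Set.univ ^ (q - 1) * ∫⁻ x, g x ^ q ∂μ := by
  have hq0 : 0 < q := by linarith
  have hpq := Real.HolderConjugate.conjExponent hq
  have h := ENNReal.lintegral_mul_le_Lp_mul_Lq μ hpq hg (aemeasurable_const (b := 1))
  simp only [Pi.mul_apply, mul_one, ENNReal.one_rpow, lintegral_const, one_mul] at h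
  have h2 := ENNReal.rpow_le_rpow h hq0.le
  rw [ENNReal.mul_rpow_of_nonneg _ _ hq0.le, ← ENNReal.rpow_mul, ← ENNReal.rpow_mul,
    one_div_mul_cancel hq0.ne', ENNReal.rpow_one, mul_comm] at h2
  convert h2 using 3
  rw [Real.conjExponent]
  have : q - 1 ≠ 0 := by linarith
  field_simp

/-- The sub-mean value property of `|F|` over circled sets: average the mean value inequality over
circles `θ ↦ z + e^{iθ} v`, using that rotations preserve volume. -/
lemma enorm_mul_volume_le {F : Cn n → ℂ} (hF : DifferentiableOn ℂ F (ball 0 1))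
    (hFm : Measurable F) {P : Set (Cn n)} (hP : MeasurableSet P)
    (hcirc : ∀ v ∈ P, ∀ c : ℂ, ‖c‖ ≤ 1 → c • v ∈ P) {z : Cn n}
    (hz : ∀ v ∈ P, z + v ∈ ball (0 : Cn n) 1) :
    ‖F z‖ₑ * volume P ≤ ∫⁻ v in P, ‖F (z + v)‖ₑ := by
  set Q := ∫⁻ v in P, ‖F (z + v)‖ₑ with hQ
  have hpi : (0 : ℝ) < 2 * Real.pi := by positivity
  have h1 : ∀ v ∈ P, ENNReal.ofReal (2 * Real.pi) * ‖F z‖ₑ ≤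
      ∫⁻ θ in Set.Ioc 0 (2 * Real.pi), ‖F (z + circleMap 0 1 θ • v)‖ₑ := by
    intro v hv
    have hd : DiffContOnCl ℂ (fun c : ℂ => F (z + c • v)) (ball 0 |1|) := by
      apply DifferentiableOn.diffContOnCl
      rw [abs_one, closure_ball _ one_ne_zero]
      refine (differentiableOn_line hF z v).mono fun c hc => ?_
      exact hz _ (hcirc v hv c (by simpa using hc))
    have h2 := hd.circleAverage
    rw [Real.circleAverage_def, zero_smul, add_zero,
      intervalIntegral.integral_of_le hpi.le] at h2
    rw [← h2, enorm_smul]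
    have h3 : ‖(2 * Real.pi)⁻¹‖ₑ = ENNReal.ofReal (2 * Real.pi)⁻¹ := by
      rw [Real.enorm_of_nonneg (by positivity)]
    rw [h3, ← mul_assoc, ← ENNReal.ofReal_mul hpi.le, mul_inv_cancel₀ hpi.ne', ENNReal.ofReal_one,
      one_mul]
    exact enorm_integral_le_lintegral_enorm _
  have hrot : ∀ θ : ℝ, ∫⁻ v in P, ‖F (z + circleMap 0 1 θ • v)‖ₑ = Q := by
    intro θ
    have hc : ‖circleMap 0 1 θ‖ = 1 := by simp
    have hH : Measurable (P.indicator fun v => ‖F (z + v)‖ₑ) :=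
      ((hFm.comp (measurable_const_add z)).enorm).indicator hP
    have := (measurePreserving_smul_of_norm_eq_one (n := n) hc).lintegral_comp hH
    rw [hQ, ← lintegral_indicator hP, ← lintegral_indicator hP, ← this]
    congr 1
    funext v
    by_cases hv : v ∈ P
    · rw [Set.indicator_of_mem hv, Set.indicator_of_mem (hcirc v hv _ hc.le)]
    · have hv' : circleMap 0 1 θ • v ∉ P := fun h => hv (by
        have := hcirc _ h (circleMap 0 1 θ)⁻¹ (by rw [norm_inv, hc, inv_one])
        rwa [smul_smul, inv_mul_cancel₀ (by rw [← norm_ne_zero_iff, hc]; exact one_ne_zero),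
          one_smul] at this)
      rw [Set.indicator_of_notMem hv, Set.indicator_of_notMem hv']
  have h4 : ENNReal.ofReal (2 * Real.pi) * (‖F z‖ₑ * volume P) ≤
      ENNReal.ofReal (2 * Real.pi) * Q := by
    calc ENNReal.ofReal (2 * Real.pi) * (‖F z‖ₑ * volume P)
        = ∫⁻ _ in P, ENNReal.ofReal (2 * Real.pi) * ‖F z‖ₑ := by
          rw [setLIntegral_const, mul_assoc]
      _ ≤ ∫⁻ v in P, ∫⁻ θ in Set.Ioc 0 (2 * Real.pi), ‖F (z + circleMap 0 1 θ • v)‖ₑ :=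
          setLIntegral_mono' hP h1
      _ = ∫⁻ θ in Set.Ioc 0 (2 * Real.pi), ∫⁻ v in P, ‖F (z + circleMap 0 1 θ • v)‖ₑ := by
          refine lintegral_lintegral_swap (Measurable.aemeasurable ?_)
          refine (hFm.comp ?_).enorm
          have : Continuous fun p : Cn n × ℝ => z + circleMap 0 1 p.2 • p.1 :=
            continuous_const.add (((continuous_circleMap 0 1).comp continuous_snd).smul
              continuous_fst)
          exact this.measurable
      _ = ENNReal.ofReal (2 * Real.pi) * Q := by
          simp only [hrot, setLIntegral_const, Real.volume_Ioc, sub_zero]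
          rw [mul_comm]
  exact (ENNReal.mul_le_mul_iff_right (by rw [Ne, ENNReal.ofReal_eq_zero, not_le]; exact hpi)
    ENNReal.ofReal_ne_top).1 h4

/-- A nonisotropic neighbourhood of `z`, on which `1 - |w|²` is comparable to `1 - |z|²`. -/
def nearSet (z : Cn n) : Set (Cn n) :=
  {w | w ∈ ball (0 : Cn n) 1 ∧ rho z ≤ 4 * rho w ∧ rho w ≤ 4 * rho z ∧ ‖1 - herm w z‖ ≤ 8 * rho z}

lemma rho_add (z v : Cn n) : rho (z + v) = rho z - 2 * (herm v z).re - ‖v‖ ^ 2 := by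
  have := norm_add_sq (𝕜 := ℂ) z v
  rw [rho, rho, this, herm, RCLike.re_eq_complex_re]; ring

lemma mem_ball_of_rho_pos {w : Cn n} (h : 0 < rho w) : w ∈ ball (0 : Cn n) 1 := by
  rw [mem_ball_zero_iff]
  unfold rho at h
  nlinarith [norm_nonneg w]

lemma add_mem_nearSet {z v : Cn n} (hz : z ∈ ball (0 : Cn n) 1) {c : ℂ}
    (hc : ‖c - 1‖ ≤ rho z / 16) (h1 : ‖herm v z‖ < rho z / 16) (h2 : ‖v‖ ^ 2 < rho z / 16) :
    c • z + v ∈ nearSet z := by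
  have h0 := rho_pos hz
  have h01 := rho_le_one z
  rw [mem_ball_zero_iff] at hz
  set u := (c - 1) • z + v with hu
  have hw : c • z + v = z + u := by rw [hu, sub_smul, one_smul]; abel
  have hz2 : ‖z‖ ^ 2 ≤ 1 := by nlinarith [norm_nonneg z]
  have hu1 : ‖herm u z‖ ≤ rho z / 8 := by
    rw [hu, herm_add_left, herm_smul_left, herm_self]
    calc _ ≤ ‖(c - 1) * ((‖z‖ ^ 2 : ℝ) : ℂ)‖ + ‖herm v z‖ := norm_add_le _ _
      _ ≤ rho z / 16 * 1 + rho z / 16 := by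
          rw [norm_mul, Complex.norm_real, Real.norm_of_nonneg (by positivity)]
          gcongr
      _ = _ := by ring
  have hu2 : ‖u‖ ^ 2 ≤ rho z / 7 := by
    have h3 : ‖u‖ ≤ rho z / 16 + ‖v‖ := by
      calc ‖u‖ ≤ ‖(c - 1) • z‖ + ‖v‖ := norm_add_le _ _
        _ ≤ rho z / 16 * 1 + ‖v‖ := by rw [norm_smul]; gcongr
        _ = _ := by ring
    nlinarith [norm_nonneg u, norm_nonneg v, sq_nonneg (rho z / 16 - ‖v‖)]
  have hre : |(herm u z).re| ≤ ‖herm u z‖ := Complex.abs_re_le_norm _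
  rw [abs_le] at hre
  have hrho := rho_add z u
  rw [hw]
  have h5 : 0 < rho (z + u) := by rw [hrho]; linarith
  refine ⟨mem_ball_of_rho_pos h5, by rw [hrho]; linarith,
    by rw [hrho]; nlinarith [sq_nonneg ‖u‖], ?_⟩
  have h6 : 1 - herm (z + u) z = (rho z : ℂ) - herm u z := by
    rw [herm_add_left, herm_self, rho]; push_cast; ring
  rw [h6]
  calc _ ≤ ‖(rho z : ℂ)‖ + ‖herm u z‖ := norm_sub_le _ _
    _ ≤ rho z + rho z / 8 := by
      rw [Complex.norm_real, Real.norm_of_nonneg h0.le]; gcongr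
    _ ≤ _ := by linarith

lemma measurableSet_nearSet (z : Cn n) : MeasurableSet (nearSet z) := by
  have h1 := measurable_rho (n := n)
  refine measurableSet_ball.inter (MeasurableSet.inter ?_ (MeasurableSet.inter ?_ ?_))
  · exact measurableSet_le measurable_const (h1.const_mul 4)
  · exact measurableSet_le h1 measurable_const
  · exact measurableSet_le
      ((continuous_const.sub (continuous_herm_left z)).norm).measurable measurable_const

/-- Local estimate of `|F|^q` at points `c z` with `c` close to `1`. -/
lemma enorm_rpow_le_lintegral_nearSet (hn : 1 ≤ n) : ∃ C : ℝ≥0∞, C ≠ ∞ ∧ ∀ q : ℝ, 1 < q →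
    ∀ F : Cn n → ℂ, DifferentiableOn ℂ F (ball 0 1) → Measurable F →
    ∀ z ∈ ball (0 : Cn n) 1, ∀ c : ℂ, ‖c - 1‖ ≤ rho z / 16 →
    ‖F (c • z)‖ₑ ^ q * ENNReal.ofReal (rho z ^ (n + 1)) ≤ C * ∫⁻ w in nearSet z, ‖F w‖ₑ ^ q := by
  obtain ⟨c₀, hc₀, hc₀', hvol⟩ := le_volume_polydisc hn
  have hne : c₀ * ENNReal.ofReal ((1 / 16) ^ (n + 1)) ≠ 0 := mul_ne_zero hc₀ (by
    rw [Ne, ENNReal.ofReal_eq_zero, not_le]; positivity)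
  refine ⟨(c₀ * ENNReal.ofReal ((1 / 16) ^ (n + 1)))⁻¹, ENNReal.inv_ne_top.2 hne,
    fun q hq F hF hFm z hz c hc => ?_⟩
  have h0 := rho_pos hz
  have h01 := rho_le_one z
  set P : Set (Cn n) := {v | ‖herm v z‖ < rho z / 16 ∧ ‖v‖ ^ 2 < rho z / 16} with hP
  have hPm : MeasurableSet P :=
    (measurableSet_lt (continuous_herm_left z).norm.measurable measurable_const).inter
      (measurableSet_lt (measurable_norm.pow_const 2) measurable_const)
  have hPc : ∀ v ∈ P, ∀ a : ℂ, ‖a‖ ≤ 1 → a • v ∈ P := by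
    rintro v ⟨h1, h2⟩ a ha
    refine ⟨?_, ?_⟩
    · rw [herm_smul_left, norm_mul]
      exact (mul_le_of_le_one_left (norm_nonneg _) ha).trans_lt h1
    · rw [norm_smul, mul_pow]
      exact (mul_le_of_le_one_left (by positivity)
        (pow_le_one₀ (norm_nonneg _) ha)).trans_lt h2
  have hPn : ∀ v ∈ P, c • z + v ∈ nearSet z := fun v hv => add_mem_nearSet hz hc hv.1 hv.2
  have hlow : c₀ * ENNReal.ofReal ((rho z / 16) ^ (n + 1)) ≤ volume P :=
    hvol z (mem_ball_zero_iff.1 hz).le _ (by positivity) (by linarith)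
  have hP0 : volume P ≠ 0 := by
    refine fun h => ?_
    rw [h, nonpos_iff_eq_zero] at hlow
    exact mul_ne_zero hc₀ (by rw [Ne, ENNReal.ofReal_eq_zero, not_le]; positivity) hlow
  have hPtop : volume P ≠ ∞ := by
    refine ((measure_mono fun v hv => ?_).trans_lt
      (measure_ball_lt_top (x := (0 : Cn n)) (r := 1))).ne
    rw [mem_ball_zero_iff]
    have := hv.2
    nlinarith [norm_nonneg v]
  have h1 := enorm_mul_volume_le hF hFm hPm hPc fun v hv => (hPn v hv).1
  have hq0 : 0 < q := by linarith
  have h2 : ‖F (c • z)‖ₑ ^ q * volume P ≤ ∫⁻ v in P, ‖F (c • z + v)‖ₑ ^ q := by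
    have h3 := ENNReal.rpow_le_rpow h1 hq0.le
    rw [ENNReal.mul_rpow_of_nonneg _ _ hq0.le] at h3
    have h4 := h3.trans (lintegral_rpow_le hq
      ((hFm.comp (measurable_const_add (c • z))).enorm.aemeasurable))
    rw [Measure.restrict_apply_univ] at h4
    have h5 : volume P ^ q = volume P ^ (q - 1) * volume P := by
      conv_lhs =>
        rw [show q = (q - 1) + 1 by ring, ENNReal.rpow_add _ _ hP0 hPtop, ENNReal.rpow_one]
    rw [h5, mul_left_comm] at h4
    exact (ENNReal.mul_le_mul_iff_right (ENNReal.rpow_pos (pos_iff_ne_zero.2 hP0) hPtop).ne'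
      (ENNReal.rpow_ne_top_of_nonneg (by linarith) hPtop)).1 h4
  have h6 : ∫⁻ v in P, ‖F (c • z + v)‖ₑ ^ q ≤ ∫⁻ w in nearSet z, ‖F w‖ₑ ^ q := by
    rw [← lintegral_indicator hPm, ← lintegral_indicator (measurableSet_nearSet z),
      ← lintegral_add_left_eq_self ((nearSet z).indicator _) (c • z)]
    refine lintegral_mono fun v => ?_
    by_cases hv : v ∈ P
    · rw [Set.indicator_of_mem hv, Set.indicator_of_mem (hPn v hv)]
    · rw [Set.indicator_of_notMem hv]; exact zero_le
  rw [← ENNReal.div_eq_inv_mul, ENNReal.le_div_iff_mul_le (Or.inl hne) (Or.inl ?_)]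
  · refine le_trans (le_of_eq ?_) ((mul_le_mul_right hlow (‖F (c • z)‖ₑ ^ q)).trans (h2.trans h6))
    rw [mul_assoc, mul_left_comm (ENNReal.ofReal _), ← ENNReal.ofReal_mul (by positivity),
      ← mul_pow]
    congr 4
    ring
  · exact ENNReal.mul_ne_top hc₀' ENNReal.ofReal_ne_top

/-- The radial derivative `∑ z_i ∂F/∂z_i`, as the derivative of `c ↦ F (c z)` at `c = 1`. -/
def radial (F : Cn n → ℂ) (z : Cn n) : ℂ := deriv (fun c : ℂ => F (c • z)) 1

lemma smul_mem_ball_of_near {z : Cn n} (hz : z ∈ ball (0 : Cn n) 1) {c : ℂ}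
    (hc : ‖c - 1‖ ≤ rho z / 16) : c • z ∈ ball (0 : Cn n) 1 := by
  have h0 := rho_pos hz
  have h := add_mem_nearSet (v := 0) hz hc (by simp [herm]; linarith) (by simp; linarith)
  rw [add_zero] at h
  exact h.1

/-- Local estimate of the radial derivative, by Cauchy's inequality on the circle of radius
`(1 - |z|²) / 16` about `1` in the complex line through `z`. -/
lemma enorm_radial_rpow_le (hn : 1 ≤ n) {q : ℝ} (hq : 1 < q) : ∃ C : ℝ≥0∞, C ≠ ∞ ∧
    ∀ F : Cn n → ℂ, DifferentiableOn ℂ F (ball 0 1) → Measurable F →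
    ∀ z ∈ ball (0 : Cn n) 1,
    ‖radial F z‖ₑ ^ q * ENNReal.ofReal (rho z ^ q) * ENNReal.ofReal (rho z ^ (n + 1)) ≤
      C * ∫⁻ w in nearSet z, ‖F w‖ₑ ^ q := by
  obtain ⟨C, hC, h⟩ := enorm_rpow_le_lintegral_nearSet hn
  refine ⟨ENNReal.ofReal (16 ^ q) * C, ENNReal.mul_ne_top ENNReal.ofReal_ne_top hC,
    fun F hF hFm z hz => ?_⟩
  have h0 := rho_pos hz
  have hq0 : 0 < q := by linarith
  have hcl : ∀ c ∈ closedBall (1 : ℂ) (rho z / 16), c • z ∈ ball (0 : Cn n) 1 := fun c hc =>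
    smul_mem_ball_of_near hz (by rwa [mem_closedBall, dist_eq_norm] at hc)
  have hd : DifferentiableOn ℂ (fun c : ℂ => F (c • z)) (closedBall 1 (rho z / 16)) :=
    hF.comp (by fun_prop) hcl
  obtain ⟨c, hc, hmax⟩ := (isCompact_sphere (1 : ℂ) (rho z / 16)).exists_isMaxOn
    (NormedSpace.sphere_nonempty.2 (by positivity))
    ((hd.continuousOn.mono sphere_subset_closedBall).norm)
  have hdc : DiffContOnCl ℂ (fun c : ℂ => F (c • z)) (ball 1 (rho z / 16)) := by
    apply DifferentiableOn.diffContOnCl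
    rwa [closure_ball _ (by positivity)]
  have h1 : ‖radial F z‖ ≤ ‖F (c • z)‖ / (rho z / 16) :=
    Complex.norm_deriv_le_of_forall_mem_sphere_norm_le (by positivity) hdc fun w hw => hmax hw
  have h2 : ‖radial F z‖ₑ * ENNReal.ofReal (rho z) ≤ ENNReal.ofReal 16 * ‖F (c • z)‖ₑ := by
    rw [← ofReal_norm, ← ofReal_norm, ← ENNReal.ofReal_mul (norm_nonneg _),
      ← ENNReal.ofReal_mul (by norm_num)]
    refine ENNReal.ofReal_le_ofReal ?_
    calc ‖radial F z‖ * rho z ≤ ‖F (c • z)‖ / (rho z / 16) * rho z := by gcongr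
      _ = 16 * ‖F (c • z)‖ := by field_simp
  have h3 := ENNReal.rpow_le_rpow h2 hq0.le
  rw [ENNReal.mul_rpow_of_nonneg _ _ hq0.le, ENNReal.mul_rpow_of_nonneg _ _ hq0.le,
    ENNReal.ofReal_rpow_of_pos h0, ENNReal.ofReal_rpow_of_pos (by norm_num)] at h3
  have h4 := h q hq F hF hFm z hz c (by
    rw [mem_sphere, dist_eq_norm] at hc; exact hc.le)
  calc _ ≤ ENNReal.ofReal (16 ^ q) * ‖F (c • z)‖ₑ ^ q * ENNReal.ofReal (rho z ^ (n + 1)) := by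
        gcongr
    _ ≤ ENNReal.ofReal (16 ^ q) * (C * ∫⁻ w in nearSet z, ‖F w‖ₑ ^ q) := by
        rw [mul_assoc]; gcongr
    _ = _ := by ring

/-! ### Carleson conditions -/

/-- The Carleson condition with constant `M` for the measure `G (1 - |z|²)^δ dV`. -/
def CarlesonLE (δ : ℝ) (G : Cn n → ℝ≥0∞) (M : ℝ≥0∞) : Prop :=
  ∀ ζ : Cn n, ‖ζ‖ = 1 → ∀ r : ℝ, 0 < r →
    ∫⁻ z in tubeAt ζ r, G z * ENNReal.ofReal (rho z ^ δ) ≤ M * ENNReal.ofReal (r ^ n)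

/-- The points `w` of the ball such that `z` lies in a fixed multiple of the nonisotropic
neighbourhood of `w`. The constant `40` leaves room both for `nearSet z` and for the sets
`nearSet ((1 - y) z)`. -/
def shadow (z : Cn n) : Set (Cn n) :=
  {w | w ∈ ball (0 : Cn n) 1 ∧ ‖1 - herm z w‖ ≤ 40 * rho w}

lemma continuous_herm : Continuous fun p : Cn n × Cn n => herm p.1 p.2 := by
  unfold herm; fun_prop

lemma measurableSet_shadow_rel : MeasurableSet {p : Cn n × Cn n | p.2 ∈ shadow p.1} := by
  refine (measurableSet_ball.preimage measurable_snd).inter ?_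
  exact measurableSet_le ((continuous_const.sub continuous_herm).norm).measurable
    ((measurable_rho.comp measurable_snd).const_mul 40)

lemma measurableSet_shadow (z : Cn n) : MeasurableSet (shadow z) :=
  measurableSet_ball.inter (measurableSet_le
    ((continuous_const.sub continuous_herm).comp (Continuous.prodMk_right z)).norm.measurable
    (measurable_rho.const_mul 40))

lemma measurableSet_mem_shadow (w : Cn n) : MeasurableSet {z : Cn n | w ∈ shadow z} :=
  (MeasurableSet.const (w ∈ ball (0 : Cn n) 1)).inter (measurableSet_le
    ((continuous_const.sub (continuous_herm_left w)).norm).measurable measurable_const)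

lemma exists_two_pow_near {x : ℝ} : ∃ j : ℕ, x ≤ 2 ^ j ∧ (j = 0 ∨ (2 : ℝ) ^ j ≤ 2 * x) := by
  rcases le_or_gt x 1 with h | h
  · exact ⟨0, by simpa using h, Or.inl rfl⟩
  · obtain ⟨k, h1, h2⟩ := exists_nat_pow_near h.le (one_lt_two (α := ℝ))
    exact ⟨k + 1, h2.le, Or.inr (by rw [pow_succ]; linarith)⟩

/-- The pointwise form of the kernel estimate: the mass that `w` sends to the tube of size `r`
decays geometrically in the number of doublings of the tube needed to reach `w`. -/
lemma lintegral_tubeAt_shadow_le (hn : 1 ≤ n) {δ : ℝ} (hδ : -1 < δ) (δ₀ : ℝ) :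
    ∃ C : ℝ≥0∞, C ≠ ∞ ∧ ∀ ζ : Cn n, ‖ζ‖ = 1 → ∀ r : ℝ, 0 < r → ∀ w ∈ ball (0 : Cn n) 1,
      ENNReal.ofReal (rho w ^ (δ₀ - n - 1 - δ)) *
        (∫⁻ z in tubeAt ζ r, {z | w ∈ shadow z}.indicator (fun z => ENNReal.ofReal (rho z ^ δ)) z) ≤
      C * ∑' j : ℕ, ENNReal.ofReal (((1 / 2 : ℝ) ^ ((n : ℝ) + 1 + δ)) ^ j) *
        (tubeAt ζ (85 * 2 ^ j * r)).indicator (fun w => ENNReal.ofReal (rho w ^ δ₀)) w := by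
  obtain ⟨C, hC, hV⟩ := lintegral_tubeAt_rho_le hn hδ
  refine ⟨C * ENNReal.ofReal (81 ^ ((n : ℝ) + 1 + δ)), ENNReal.mul_ne_top hC ENNReal.ofReal_ne_top,
    fun ζ hζ r hr w hw => ?_⟩
  set m : ℝ := (n : ℝ) + 1 + δ with hm
  have hm0 : 0 < m := by rw [hm]; have : (0 : ℝ) ≤ n := by positivity
                         linarith
  have hη : δ₀ - n - 1 - δ = δ₀ - m := by rw [hm]; ring
  set I := ∫⁻ z in tubeAt ζ r, {z | w ∈ shadow z}.indicator (fun z => ENNReal.ofReal (rho z ^ δ)) z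
    with hI
  have hH := rho_pos hw
  have hmeas := measurableSet_mem_shadow w
  by_cases hex : ∃ z ∈ tubeAt ζ r, w ∈ shadow z
  swap
  · have : I = 0 := by
      rw [hI, setLIntegral_congr_fun (measurableSet_tubeAt ζ r) (g := fun _ => 0) ?_,
        lintegral_zero]
      intro z hz
      exact Set.indicator_of_notMem (s := {z : Cn n | w ∈ shadow z})
        (f := fun z => ENNReal.ofReal (rho z ^ δ)) fun h => hex ⟨z, hz, h⟩
    rw [this, mul_zero]; exact zero_le
  -- If some `z₀` in the tube has `w` in its shadow, then `w` lies in a tube of size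
  -- `80 (1 - |w|²) + 5 r`.
  obtain ⟨z₀, hz₀, hzw⟩ := hex
  have hw1 := (mem_ball_zero_iff.1 hw).le
  have hloc : ‖1 - herm w ζ‖ < 80 * rho w + 4 * r + r := by
    have := norm_one_sub_herm_le (mem_ball_zero_iff.1 hz₀.1).le hw1 hζ.le
    linarith [hz₀.2, hzw.2]
  -- The set of integration lies both in the tube of size `r` at `ζ` and in a tube of size
  -- `81 (1 - |w|²)` at the projection of `w`.
  have hI1 : I ≤ C * ENNReal.ofReal (r ^ m) := by
    refine le_trans ?_ (hV ζ hζ r hr)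
    exact lintegral_mono fun z => Set.indicator_le_self _ _ z
  have hI2 : I ≤ C * ENNReal.ofReal ((81 * rho w) ^ m) := by
    obtain ⟨ω, hω, -, h1⟩ := exists_sphere_point hn hw1
    refine le_trans ?_ (hV ω hω (81 * rho w) (by positivity))
    rw [hI, lintegral_indicator hmeas, Measure.restrict_restrict hmeas]
    refine lintegral_mono_set ?_
    rintro z ⟨hz1, hz2⟩
    refine ⟨hz2.1, (h1 z hz2.1).trans_lt ?_⟩
    have := hz1.2
    linarith
  obtain ⟨j, hj1, hj2⟩ := exists_two_pow_near (x := rho w / r)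
  rw [div_le_iff₀ hr] at hj1
  have h2j : (1 : ℝ) ≤ 2 ^ j := one_le_pow₀ one_le_two
  have hwj : w ∈ tubeAt ζ (85 * 2 ^ j * r) := by
    refine ⟨hw, hloc.trans_le ?_⟩
    have : r ≤ 2 ^ j * r := le_mul_of_one_le_left hr.le h2j
    linarith
  have hterm := ENNReal.le_tsum (f := fun j : ℕ => ENNReal.ofReal (((1 / 2 : ℝ) ^ m) ^ j) *
        (tubeAt ζ (85 * 2 ^ j * r)).indicator (fun w => ENNReal.ofReal (rho w ^ δ₀)) w) j
  refine le_trans ?_ (mul_le_mul_right hterm _)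
  rw [Set.indicator_of_mem hwj, hη]
  have hIj : I ≤ C * ENNReal.ofReal (81 ^ m * ((1 / 2 : ℝ) ^ m) ^ j * rho w ^ m) := by
    rcases hj2 with rfl | hj2
    · simpa [Real.mul_rpow (by norm_num : (0 : ℝ) ≤ 81) hH.le] using hI2
    · refine hI1.trans ?_
      gcongr
      have h3 : r ≤ 2 * (1 / 2) ^ j * rho w := by
        have h4 : (2 : ℝ) ^ j * r ≤ 2 * rho w := by
          calc (2 : ℝ) ^ j * r ≤ 2 * (rho w / r) * r := by gcongr
            _ = 2 * rho w := by field_simp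
        calc r = (1 / 2) ^ j * (2 ^ j * r) := by
              rw [← mul_assoc, ← mul_pow]; norm_num
          _ ≤ (1 / 2) ^ j * (2 * rho w) := by gcongr
          _ = _ := by ring
      calc r ^ m ≤ (2 * (1 / 2) ^ j * rho w) ^ m := by gcongr
        _ = 2 ^ m * ((1 / 2 : ℝ) ^ m) ^ j * rho w ^ m := by
            rw [Real.mul_rpow (by positivity) hH.le, Real.mul_rpow (by norm_num) (by positivity)]
            congr 2
            rw [← Real.rpow_natCast, ← Real.rpow_natCast, ← Real.rpow_mul (by norm_num),
              ← Real.rpow_mul (by norm_num), mul_comm]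
        _ ≤ _ := by gcongr; norm_num
  calc ENNReal.ofReal (rho w ^ (δ₀ - m)) * I
      ≤ ENNReal.ofReal (rho w ^ (δ₀ - m)) *
        (C * ENNReal.ofReal (81 ^ m * ((1 / 2 : ℝ) ^ m) ^ j * rho w ^ m)) := by gcongr
    _ = C * ENNReal.ofReal (81 ^ m) * (ENNReal.ofReal (((1 / 2 : ℝ) ^ m) ^ j) *
        ENNReal.ofReal (rho w ^ δ₀)) := by
        rw [mul_left_comm, mul_assoc C, ← ENNReal.ofReal_mul (by positivity),
          ← ENNReal.ofReal_mul (by positivity), ← ENNReal.ofReal_mul (by positivity)]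
        congr 2
        rw [show rho w ^ δ₀ = rho w ^ (δ₀ - m) * rho w ^ m by
          rw [← Real.rpow_add hH]; congr 1; ring]
        ring

/-- Carleson conditions are stable under averaging over nonisotropic neighbourhoods. The dyadic sum
converges because `2 ^ n * (1 / 2) ^ (n + 1 + δ) < 1`. -/
lemma CarlesonLE.lintegral_shadow_le (hn : 1 ≤ n) {δ : ℝ} (hδ : -1 < δ) (δ₀ : ℝ) :
    ∃ C : ℝ≥0∞, C ≠ ∞ ∧ ∀ (G : Cn n → ℝ≥0∞) (M : ℝ≥0∞), Measurable G → CarlesonLE δ₀ G M →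
      ∀ ζ : Cn n, ‖ζ‖ = 1 → ∀ r : ℝ, 0 < r →
      ∫⁻ z in tubeAt ζ r, ENNReal.ofReal (rho z ^ δ) *
        (∫⁻ w in shadow z, G w * ENNReal.ofReal (rho w ^ (δ₀ - n - 1 - δ))) ≤
        C * M * ENNReal.ofReal (r ^ n) := by
  obtain ⟨C, hC, hpt⟩ := lintegral_tubeAt_shadow_le hn hδ δ₀
  set m : ℝ := (n : ℝ) + 1 + δ with hm
  set y : ℝ := (1 / 2 : ℝ) ^ m with hy
  have hy0 : 0 ≤ y := by positivity
  have hy1 : y * 2 ^ n < 1 := by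
    have : y * 2 ^ n = (1 / 2 : ℝ) ^ (1 + δ) := by
      rw [hy, hm, show (n : ℝ) + 1 + δ = (1 + δ) + n by ring, Real.rpow_add (by norm_num),
        Real.rpow_natCast, mul_assoc, ← mul_pow]
      norm_num
    rw [this]
    exact Real.rpow_lt_one (by norm_num) (by norm_num) (by linarith)
  set S : ℝ≥0∞ := ∑' j : ℕ, ENNReal.ofReal (y * 2 ^ n) ^ j with hS
  have hStop : S ≠ ∞ := by
    rw [hS, ENNReal.tsum_geometric, ENNReal.inv_ne_top]
    exact (tsub_pos_of_lt (by rwa [ENNReal.ofReal_lt_one])).ne'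
  refine ⟨C * (ENNReal.ofReal (85 ^ n) * S),
    ENNReal.mul_ne_top hC (ENNReal.mul_ne_top ENNReal.ofReal_ne_top hStop),
    fun G M hG hGM ζ hζ r hr => ?_⟩
  have hw : Measurable fun w : Cn n => ENNReal.ofReal (rho w ^ (δ₀ - n - 1 - δ)) :=
    (measurable_rho.pow_const _).ennreal_ofReal
  have hw' : Measurable fun w : Cn n => ENNReal.ofReal (rho w ^ δ) :=
    (measurable_rho.pow_const _).ennreal_ofReal
  have hw₀ : Measurable fun w : Cn n => ENNReal.ofReal (rho w ^ δ₀) :=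
    (measurable_rho.pow_const _).ennreal_ofReal
  have hsub : ∀ z : Cn n, shadow z ⊆ ball 0 1 := fun z w h => h.1
  have hmeas : Measurable fun p : Cn n × Cn n => {p : Cn n × Cn n | p.2 ∈ shadow p.1}.indicator
      (fun p => ENNReal.ofReal (rho p.1 ^ δ) *
        (G p.2 * ENNReal.ofReal (rho p.2 ^ (δ₀ - n - 1 - δ)))) p :=
    Measurable.indicator ((hw'.comp measurable_fst).mul
      ((hG.comp measurable_snd).mul (hw.comp measurable_snd))) measurableSet_shadow_rel
  calc ∫⁻ z in tubeAt ζ r, ENNReal.ofReal (rho z ^ δ) *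
        (∫⁻ w in shadow z, G w * ENNReal.ofReal (rho w ^ (δ₀ - n - 1 - δ)))
      = ∫⁻ z in tubeAt ζ r, ∫⁻ w in ball (0 : Cn n) 1,
          {p : Cn n × Cn n | p.2 ∈ shadow p.1}.indicator (fun p => ENNReal.ofReal (rho p.1 ^ δ) *
            (G p.2 * ENNReal.ofReal (rho p.2 ^ (δ₀ - n - 1 - δ)))) (z, w) := by
        congr 1
        funext z
        have hGw : Measurable fun w => G w * ENNReal.ofReal (rho w ^ (δ₀ - n - 1 - δ)) := hG.mul hw
        rw [← lintegral_const_mul _ hGw, ← lintegral_indicator (measurableSet_shadow z),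
          ← setLIntegral_eq_of_support_subset (s := ball (0 : Cn n) 1)]
        · congr 1
        · exact (Set.support_indicator_subset).trans (hsub z)
    _ = ∫⁻ w in ball (0 : Cn n) 1, ∫⁻ z in tubeAt ζ r,
          {p : Cn n × Cn n | p.2 ∈ shadow p.1}.indicator (fun p => ENNReal.ofReal (rho p.1 ^ δ) *
            (G p.2 * ENNReal.ofReal (rho p.2 ^ (δ₀ - n - 1 - δ)))) (z, w) :=
        lintegral_lintegral_swap hmeas.aemeasurable
    _ ≤ ∫⁻ w in ball (0 : Cn n) 1, G w * (C * ∑' j : ℕ, ENNReal.ofReal (y ^ j) *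
          (tubeAt ζ (85 * 2 ^ j * r)).indicator (fun w => ENNReal.ofReal (rho w ^ δ₀)) w) := by
        refine setLIntegral_mono' measurableSet_ball fun w hwb => ?_
        refine le_trans (le_of_eq ?_) (mul_le_mul_right (hpt ζ hζ r hr w hwb) (G w))
        have hmw := measurableSet_mem_shadow w
        rw [← mul_assoc, ← lintegral_const_mul _ (hw'.indicator hmw)]
        congr 1
        funext z
        by_cases h : w ∈ shadow z
        · rw [Set.indicator_of_mem (show (z, w) ∈ {p : Cn n × Cn n | p.2 ∈ shadow p.1} from h),
            Set.indicator_of_mem (show z ∈ {z | w ∈ shadow z} from h), mul_comm]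
        · rw [Set.indicator_of_notMem (show (z, w) ∉ {p : Cn n × Cn n | p.2 ∈ shadow p.1} from h),
            Set.indicator_of_notMem (show z ∉ {z | w ∈ shadow z} from h), mul_zero]
    _ = C * ∑' j : ℕ, ENNReal.ofReal (y ^ j) *
          ∫⁻ w in tubeAt ζ (85 * 2 ^ j * r), G w * ENNReal.ofReal (rho w ^ δ₀) := by
        have hind : ∀ j : ℕ, Measurable ((tubeAt ζ (85 * 2 ^ j * r)).indicator
            fun w => ENNReal.ofReal (rho w ^ δ₀)) := fun j =>
          hw₀.indicator (measurableSet_tubeAt _ _)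
        simp only [mul_left_comm (G _) C, ← ENNReal.tsum_mul_left (a := G _)]
        have hterm : ∀ j : ℕ, Measurable fun w => G w * (ENNReal.ofReal (y ^ j) *
            (tubeAt ζ (85 * 2 ^ j * r)).indicator (fun w => ENNReal.ofReal (rho w ^ δ₀)) w) :=
          fun j => hG.mul ((hind j).const_mul _)
        rw [lintegral_const_mul _ (Measurable.tsum hterm),
          lintegral_tsum fun j => (hterm j).aemeasurable]
        congr 2
        funext j
        simp only [mul_left_comm (G _)]
        have hGj : Measurable fun w => G w *
            (tubeAt ζ (85 * 2 ^ j * r)).indicator (fun w => ENNReal.ofReal (rho w ^ δ₀)) w :=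
          hG.mul (hind j)
        rw [lintegral_const_mul _ hGj]
        congr 1
        have h1 : ∀ w, G w * (tubeAt ζ (85 * 2 ^ j * r)).indicator
            (fun w => ENNReal.ofReal (rho w ^ δ₀)) w = (tubeAt ζ (85 * 2 ^ j * r)).indicator
            (fun w => G w * ENNReal.ofReal (rho w ^ δ₀)) w := fun w => by
          by_cases h : w ∈ tubeAt ζ (85 * 2 ^ j * r)
          · rw [Set.indicator_of_mem h, Set.indicator_of_mem h]
          · rw [Set.indicator_of_notMem h, Set.indicator_of_notMem h, mul_zero]
        simp only [h1]
        rw [setLIntegral_indicator (measurableSet_tubeAt _ _),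
          Set.inter_eq_left.2 fun w hw => hw.1]
    _ ≤ C * ∑' j : ℕ, ENNReal.ofReal (85 ^ n) * ENNReal.ofReal (y * 2 ^ n) ^ j *
          (M * ENNReal.ofReal (r ^ n)) := by
        refine mul_le_mul_right (ENNReal.tsum_le_tsum fun j => ?_) C
        refine (mul_le_mul_right (hGM ζ hζ (85 * 2 ^ j * r) (by positivity)) _).trans
          (le_of_eq ?_)
        rw [← ENNReal.ofReal_pow (by positivity), mul_pow, mul_pow, mul_pow,
          ENNReal.ofReal_mul (by positivity), ENNReal.ofReal_mul (by positivity),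
          ENNReal.ofReal_mul (p := y ^ j) (by positivity), ← pow_mul, ← pow_mul, mul_comm j n]
        ring
    _ = _ := by
        rw [ENNReal.tsum_mul_right, ENNReal.tsum_mul_left]
        ring

/-! ### Carleson conditions for derivatives -/

lemma CarlesonLE.mono {δ : ℝ} {G G' : Cn n → ℝ≥0∞} {M M' : ℝ≥0∞} (h : CarlesonLE δ G M)
    (hG : ∀ z ∈ ball (0 : Cn n) 1, G' z ≤ G z) (hM : M ≤ M') : CarlesonLE δ G' M' := by
  intro ζ hζ r hr
  refine le_trans ?_ ((h ζ hζ r hr).trans (by gcongr))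
  refine setLIntegral_mono' (measurableSet_tubeAt ζ r) fun z hz => ?_
  gcongr
  exact hG z hz.1

lemma CarlesonLE.mono_exponent {δ δ' : ℝ} (hδ : δ ≤ δ') {G : Cn n → ℝ≥0∞} {M : ℝ≥0∞}
    (h : CarlesonLE δ G M) : CarlesonLE δ' G M := by
  intro ζ hζ r hr
  refine le_trans ?_ (h ζ hζ r hr)
  refine setLIntegral_mono' (measurableSet_tubeAt ζ r) fun z hz => ?_
  refine mul_le_mul_right (ENNReal.ofReal_le_ofReal ?_) _
  exact Real.rpow_le_rpow_of_exponent_ge (rho_pos hz.1) (rho_le_one z) hδ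

lemma CarlesonLE.add {δ : ℝ} {G G' : Cn n → ℝ≥0∞} {M M' : ℝ≥0∞} (hGm : Measurable G)
    (h : CarlesonLE δ G M) (h' : CarlesonLE δ G' M') :
    CarlesonLE δ (fun z => G z + G' z) (M + M') := by
  intro ζ hζ r hr
  have hm : Measurable fun z => G z * ENNReal.ofReal (rho z ^ δ) :=
    hGm.mul (measurable_rho.pow_const _).ennreal_ofReal
  simp only [add_mul]
  rw [lintegral_add_left hm]
  exact add_le_add (h ζ hζ r hr) (h' ζ hζ r hr)

lemma CarlesonLE.const_mul {δ : ℝ} {G : Cn n → ℝ≥0∞} {M c : ℝ≥0∞} (hc : c ≠ ∞)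
    (h : CarlesonLE δ G M) : CarlesonLE δ (fun z => c * G z) (c * M) := by
  intro ζ hζ r hr
  simp only [mul_assoc]
  rw [lintegral_const_mul' _ _ hc]
  exact mul_le_mul_right (h ζ hζ r hr) c

/-- Sums of two functions, in terms of the `q`-th powers. -/
lemma CarlesonLE.rpow_add {δ q : ℝ} (hq : 1 ≤ q) {g g' : Cn n → ℝ≥0∞} {M M' : ℝ≥0∞}
    (hgm : Measurable g) (h : CarlesonLE δ (fun z => g z ^ q) M)
    (h' : CarlesonLE δ (fun z => g' z ^ q) M') :
    CarlesonLE δ (fun z => (g z + g' z) ^ q) (2 ^ (q - 1) * (M + M')) := by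
  refine ((h.add (hgm.pow_const q) h').const_mul (c := 2 ^ (q - 1)) ?_).mono
    (fun z _ => ENNReal.rpow_add_le_mul_rpow_add_rpow _ _ hq) le_rfl
  exact ENNReal.rpow_ne_top_of_nonneg (by linarith) (by norm_num)

lemma CarlesonLE.rpow_const_mul {δ q : ℝ} (hq : 1 ≤ q) {g : Cn n → ℝ≥0∞} {M c : ℝ≥0∞}
    (hc : c ≠ ∞) (h : CarlesonLE δ (fun z => g z ^ q) M) :
    CarlesonLE δ (fun z => (c * g z) ^ q) (c ^ q * M) :=
  (h.const_mul (ENNReal.rpow_ne_top_of_nonneg (by linarith) hc : c ^ q ≠ ∞)).mono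
    (fun z _ => (ENNReal.mul_rpow_of_nonneg _ _ (by linarith)).le) le_rfl

lemma tubeAt_subset_two {ζ : Cn n} (hζ : ‖ζ‖ = 1) (r : ℝ) : tubeAt ζ r ⊆ tubeAt ζ 2 := by
  rw [tubeAt_two hζ]; exact fun z hz => hz.1

/-- Bounded functions satisfy every Carleson condition of exponent larger than `-1`. -/
lemma exists_carlesonLE_const (hn : 1 ≤ n) {δ : ℝ} (hδ : -1 < δ) : ∃ C : ℝ≥0∞, C ≠ ∞ ∧
    ∀ c : ℝ≥0∞, CarlesonLE (n := n) δ (fun _ => c) (C * c) := by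
  obtain ⟨C, hC, h⟩ := lintegral_tubeAt_rho_le hn hδ
  refine ⟨C * ENNReal.ofReal (2 ^ (1 + δ)), ENNReal.mul_ne_top hC ENNReal.ofReal_ne_top,
    fun c ζ hζ r hr => ?_⟩
  have hm : Measurable fun z : Cn n => ENNReal.ofReal (rho z ^ δ) :=
    (measurable_rho.pow_const _).ennreal_ofReal
  have key : ∀ r : ℝ, 0 < r → r ≤ 2 → C * ENNReal.ofReal (r ^ ((n : ℝ) + 1 + δ)) ≤
      C * ENNReal.ofReal (2 ^ (1 + δ)) * ENNReal.ofReal (r ^ n) := by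
    intro r hr hr2
    rw [mul_assoc, ← ENNReal.ofReal_mul (by positivity)]
    gcongr
    rw [add_assoc, Real.rpow_add hr, Real.rpow_natCast, mul_comm]
    gcongr
    linarith
  have h2 : ∫⁻ z in tubeAt ζ r, ENNReal.ofReal (rho z ^ δ) ≤
      C * ENNReal.ofReal (2 ^ (1 + δ)) * ENNReal.ofReal (r ^ n) := by
    rcases le_total r 2 with hr2 | hr2
    · exact (h ζ hζ r hr).trans (key r hr hr2)
    · refine (lintegral_mono_set (tubeAt_subset_two hζ r)).trans
        ((h ζ hζ 2 two_pos).trans ((key 2 two_pos le_rfl).trans ?_))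
      gcongr
  rw [lintegral_const_mul _ hm]
  calc _ ≤ c * (C * ENNReal.ofReal (2 ^ (1 + δ)) * ENNReal.ofReal (r ^ n)) := by gcongr
    _ = _ := by ring

/-- Powers of comparable numbers are comparable. -/
lemma rpow_le_of_comparable {x y : ℝ} (hx : 0 < x) (hy : 0 < y) (h1 : x ≤ 4 * y) (h2 : y ≤ 4 * x)
    (e : ℝ) : x ^ e ≤ 4 ^ |e| * y ^ e := by
  rcases le_total 0 e with he | he
  · rw [abs_of_nonneg he, ← Real.mul_rpow (by norm_num) hy.le]
    exact Real.rpow_le_rpow hx.le h1 he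
  · rw [abs_of_nonpos he]
    have h3 : (4 * x) ^ e ≤ y ^ e := Real.rpow_le_rpow_of_nonpos hy h2 he
    rw [Real.mul_rpow (by norm_num) hx.le] at h3
    calc x ^ e = 4 ^ (-e) * (4 ^ e * x ^ e) := by
          rw [← mul_assoc, ← Real.rpow_add (by norm_num), neg_add_cancel, Real.rpow_zero, one_mul]
      _ ≤ _ := by gcongr

lemma nearSet_subset_shadow (z : Cn n) : nearSet z ⊆ shadow z := by
  rintro w ⟨hw, h1, -, h3⟩
  refine ⟨hw, ?_⟩
  rw [norm_one_sub_herm_comm]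
  have := rho_pos hw
  linarith

/-- The radial derivative improves a Carleson condition by one power of `1 - |z|²`. -/
lemma CarlesonLE.radial (hn : 1 ≤ n) {q : ℝ} (hq : 1 < q) (δ₀ : ℝ) : ∃ C : ℝ≥0∞, C ≠ ∞ ∧
    ∀ (F : Cn n → ℂ) (M : ℝ≥0∞), DifferentiableOn ℂ F (ball 0 1) → Measurable F →
    CarlesonLE δ₀ (fun z => ‖F z‖ₑ ^ q) M →
    CarlesonLE (δ₀ + q) (fun z => ‖radial F z‖ₑ ^ q) (C * M) := by
  obtain ⟨C₁, hC₁, h₁⟩ := enorm_radial_rpow_le hn hq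
  obtain ⟨C₂, hC₂, h₂⟩ := CarlesonLE.lintegral_shadow_le hn (δ := 0) (by norm_num) δ₀
  set e : ℝ := δ₀ - n - 1 with he
  refine ⟨C₁ * ENNReal.ofReal (4 ^ |e|) * C₂, ENNReal.mul_ne_top (ENNReal.mul_ne_top hC₁
    ENNReal.ofReal_ne_top) hC₂, fun F M hF hFm hM ζ hζ r hr => ?_⟩
  have h3 := h₂ _ M (hFm.enorm.pow_const q) hM ζ hζ r hr
  have hpt : ∀ z ∈ tubeAt ζ r, ‖HoloTent.radial F z‖ₑ ^ q * ENNReal.ofReal (rho z ^ (δ₀ + q)) ≤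
      C₁ * ENNReal.ofReal (4 ^ |e|) * (ENNReal.ofReal (rho z ^ (0 : ℝ)) *
        ∫⁻ w in shadow z, ‖F w‖ₑ ^ q * ENNReal.ofReal (rho w ^ (δ₀ - n - 1 - 0))) := by
    intro z hz
    have h0 := rho_pos hz.1
    rw [Real.rpow_zero, ENNReal.ofReal_one, one_mul, sub_zero, ← he]
    calc ‖HoloTent.radial F z‖ₑ ^ q * ENNReal.ofReal (rho z ^ (δ₀ + q))
        = ‖HoloTent.radial F z‖ₑ ^ q * ENNReal.ofReal (rho z ^ q) *
            ENNReal.ofReal (rho z ^ (n + 1)) * ENNReal.ofReal (rho z ^ e) := by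
          rw [mul_assoc, mul_assoc, ← ENNReal.ofReal_mul (by positivity),
            ← ENNReal.ofReal_mul (by positivity), ← Real.rpow_natCast, ← Real.rpow_add h0,
            ← Real.rpow_add h0]
          congr 3
          rw [he]; push_cast; ring
      _ ≤ C₁ * (∫⁻ w in nearSet z, ‖F w‖ₑ ^ q) * ENNReal.ofReal (rho z ^ e) := by
          gcongr ?_ * _
          exact h₁ F hF hFm z hz.1
      _ = C₁ * ∫⁻ w in nearSet z, ‖F w‖ₑ ^ q * ENNReal.ofReal (rho z ^ e) := by
          rw [mul_assoc, lintegral_mul_const _ (hFm.enorm.pow_const q)]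
      _ ≤ C₁ * ∫⁻ w in nearSet z, ENNReal.ofReal (4 ^ |e|) *
            (‖F w‖ₑ ^ q * ENNReal.ofReal (rho w ^ e)) := by
          gcongr C₁ * ?_
          refine setLIntegral_mono' (measurableSet_nearSet z) fun w hw => ?_
          rw [mul_left_comm, ← ENNReal.ofReal_mul (by positivity)]
          gcongr
          exact rpow_le_of_comparable h0 (rho_pos hw.1) hw.2.1 hw.2.2.1 e
      _ = C₁ * ENNReal.ofReal (4 ^ |e|) *
            ∫⁻ w in nearSet z, ‖F w‖ₑ ^ q * ENNReal.ofReal (rho w ^ e) := by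
          rw [lintegral_const_mul' _ _ ENNReal.ofReal_ne_top, mul_assoc]
      _ ≤ _ := by
          gcongr
          exact nearSet_subset_shadow z
  calc _ ≤ ∫⁻ z in tubeAt ζ r, C₁ * ENNReal.ofReal (4 ^ |e|) * (ENNReal.ofReal (rho z ^ (0 : ℝ)) *
        ∫⁻ w in shadow z, ‖F w‖ₑ ^ q * ENNReal.ofReal (rho w ^ (δ₀ - n - 1 - 0))) :=
        setLIntegral_mono' (measurableSet_tubeAt ζ r) hpt
    _ ≤ C₁ * ENNReal.ofReal (4 ^ |e|) * (C₂ * M * ENNReal.ofReal (r ^ n)) := by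
        rw [lintegral_const_mul' _ _ (ENNReal.mul_ne_top hC₁ ENNReal.ofReal_ne_top)]
        gcongr
    _ = _ := by ring

/-- The homogeneous expansion of the radial derivative. -/
lemma hasSum_radial {F : Cn n → ℂ} (hF : DifferentiableOn ℂ F (ball 0 1)) {z : Cn n}
    (hz : z ∈ ball (0 : Cn n) 1) : HasSum (fun k : ℕ => (k : ℂ) * hcomp k F z) (radial F z) := by
  obtain ⟨r, hr1, hr⟩ : ∃ r : ℝ, 1 < r ∧ r * ‖z‖ < 1 := by
    rw [mem_ball_zero_iff] at hz
    have h : Tendsto (fun r : ℝ => r * ‖z‖) (𝓝[>] 1) (𝓝 (1 * ‖z‖)) :=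
      ((continuous_id.mul continuous_const).tendsto 1).mono_left nhdsWithin_le_nhds
    rw [one_mul] at h
    obtain ⟨r, h1, h2⟩ := ((h.eventually_lt_const hz).and self_mem_nhdsWithin).exists
    exact ⟨r, h2, h1⟩
  have hr0 : 0 < r := by linarith
  have hmem : ∀ c ∈ ball (0 : ℂ) r, c • z ∈ ball (0 : Cn n) 1 := fun c hc => by
    rw [mem_ball_zero_iff] at hc ⊢
    rw [norm_smul]
    exact (mul_le_mul_of_nonneg_right hc.le (norm_nonneg z)).trans_lt hr
  have hrz : (r : ℂ) • z ∈ ball (0 : Cn n) 1 := by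
    rw [mem_ball_zero_iff, norm_smul, Complex.norm_real, Real.norm_of_nonneg hr0.le]
    exact hr
  have hu := summable_mul_hcomp isMultiplier_one hF hrz
  simp only [one_mul, hcomp_smul] at hu
  have h := Complex.hasSum_deriv_of_summable_norm (F := fun k (c : ℂ) => c ^ k * hcomp k F z) hu
    (fun k => by fun_prop) isOpen_ball (fun k c hc => by
      rw [mem_ball_zero_iff] at hc
      rw [norm_mul, norm_mul, norm_pow, norm_pow, Complex.norm_real, Real.norm_of_nonneg hr0.le]
      gcongr) (show (1 : ℂ) ∈ ball (0 : ℂ) r by simpa using hr1)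
  have h2 : radial F z = deriv (fun c : ℂ => ∑' k, c ^ k * hcomp k F z) 1 := by
    refine Filter.EventuallyEq.deriv_eq ?_
    filter_upwards [isOpen_ball.mem_nhds (show (1 : ℂ) ∈ ball (0 : ℂ) r by simpa using hr1)]
      with c hc
    simp_rw [← hcomp_smul]
    exact (hasSum_hcomp hF (hmem c hc)).tsum_eq.symm
  rw [h2]
  refine hasSum_of_eq (fun k => ?_) h
  simp

/-- The operator with multiplier `(a + k) / a` raises the exponent of a Carleson condition by `q`.
-/
lemma CarlesonLE.multOp_succ (hn : 1 ≤ n) {q : ℝ} (hq : 1 < q) (δ₀ : ℝ) {a : ℝ}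
    (ha : ∀ k : ℕ, a + k ≠ 0) :
    ∃ C : ℝ≥0∞, C ≠ ∞ ∧ ∀ (f : HolBall n) (M : ℝ≥0∞),
    CarlesonLE δ₀ (fun z => ‖ext f z‖ₑ ^ q) M → CarlesonLE (δ₀ + q)
      (fun z => ‖ext (multOp (isMultiplier_pochRatio a (a + 1)) f) z‖ₑ ^ q) (C * M) := by
  obtain ⟨C, hC, h⟩ := CarlesonLE.radial hn hq δ₀
  set c : ℝ≥0∞ := ‖(a : ℂ)⁻¹‖ₑ with hc
  have hct : c ≠ ∞ := enorm_ne_top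
  refine ⟨2 ^ (q - 1) * (1 + c ^ q * C), ?_, fun f M hM => ?_⟩
  · exact ENNReal.mul_ne_top (ENNReal.rpow_ne_top_of_nonneg (by linarith) (by norm_num))
      (ENNReal.add_ne_top.2 ⟨by norm_num, ENNReal.mul_ne_top
        (ENNReal.rpow_ne_top_of_nonneg (by linarith) hct) hC⟩)
  have h1 := h (ext f) M (differentiableOn_ext f) (measurable_ext f) hM
  have h2 := (hM.mono_exponent (δ' := δ₀ + q) (by linarith)).rpow_add hq.le
    (measurable_ext f).enorm (h1.rpow_const_mul hq.le hct)
  refine h2.mono (fun z hz => ?_) (le_of_eq (by ring))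
  refine ENNReal.rpow_le_rpow ?_ (by linarith)
  have h3 : ext (multOp (isMultiplier_pochRatio a (a + 1)) f) z =
      ext f z + (a : ℂ)⁻¹ * HoloTent.radial (ext f) z := by
    rw [ext_multOp _ f hz]
    refine (hasSum_multFun (isMultiplier_pochRatio a (a + 1)) (differentiableOn_ext f) hz).unique ?_
    refine hasSum_of_eq (fun k => ?_) ((hasSum_hcomp (differentiableOn_ext f) hz).add
      ((hasSum_radial (differentiableOn_ext f) hz).mul_left (a : ℂ)⁻¹))
    have h4 : (pochRatio a (a + 1) k : ℂ) = 1 + (a : ℂ)⁻¹ * k := by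
      have ha' : a ≠ 0 := by simpa using ha 0
      have h5 : pochRatio a (a + 1) k = 1 + a⁻¹ * k := by
        induction k with
        | zero => simp
        | succ k ih =>
          have := ha k
          rw [pochRatio_succ, ih]
          field_simp
          push_cast
          ring
      rw [h5]; push_cast; ring
    rw [h4]; ring
  rw [h3]
  exact (enorm_add_le _ _).trans (by rw [enorm_mul])

/-! ### Carleson conditions for fractional integrals -/

/-- Jensen's inequality for powers, with a weight. -/
lemma lintegral_mul_rpow_le {X : Type*} [MeasurableSpace X] {μ : Measure X} {q : ℝ} (hq : 1 < q)
    {A g : X → ℝ≥0∞} (hA : Measurable A) (hg : Measurable g) :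
    (∫⁻ x, A x * g x ∂μ) ^ q ≤ (∫⁻ x, A x ∂μ) ^ (q - 1) * ∫⁻ x, A x * g x ^ q ∂μ := by
  have h := lintegral_rpow_le (μ := μ.withDensity A) hq hg.aemeasurable
  rwa [lintegral_withDensity_eq_lintegral_mul _ hA hg,
    lintegral_withDensity_eq_lintegral_mul _ hA (hg.pow_const q),
    withDensity_apply _ MeasurableSet.univ, Measure.restrict_univ] at h

lemma lintegral_Ioo_rpow {δ : ℝ} (hδ : -1 < δ) {b : ℝ} (hb : 0 ≤ b) :
    ∫⁻ y in Set.Ioo 0 b, ENNReal.ofReal (y ^ δ) = ENNReal.ofReal (b ^ (1 + δ) / (1 + δ)) := by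
  rw [← ofReal_integral_eq_lintegral_ofReal, ← integral_Ioc_eq_integral_Ioo,
    ← intervalIntegral.integral_of_le hb, integral_rpow (Or.inl hδ), Real.zero_rpow (by linarith),
    sub_zero, add_comm δ 1]
  · exact ((intervalIntegral.intervalIntegrable_rpow' hδ).1).mono_set Set.Ioo_subset_Ioc_self
  · exact (ae_restrict_mem measurableSet_Ioo).mono fun y hy => Real.rpow_nonneg hy.1.le _

lemma lintegral_Ioi_rpow {δ : ℝ} (hδ : δ < -1) {b : ℝ} (hb : 0 < b) :
    ∫⁻ y in Set.Ioi b, ENNReal.ofReal (y ^ δ) = ENNReal.ofReal (-b ^ (δ + 1) / (δ + 1)) := by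
  rw [← ofReal_integral_eq_lintegral_ofReal, integral_Ioi_rpow_of_lt hδ hb]
  · exact integrableOn_Ioi_rpow_of_lt hδ hb
  · exact (ae_restrict_mem measurableSet_Ioi).mono fun y hy =>
      Real.rpow_nonneg (hb.le.trans (le_of_lt hy)) _

/-- The weight `y ^ (τ - 1)`, damped by a power of a function `η` that exceeds both `h` and `y`. -/
lemma lintegral_rpow_mul_le {τ lam : ℝ} (hτ : 0 < τ) (hl : τ < lam) : ∃ C : ℝ≥0∞, C ≠ ∞ ∧
    ∀ (h : ℝ) (η : ℝ → ℝ), 0 < h → (∀ y ∈ Set.Ioo (0 : ℝ) (1 / 2), h ≤ η y ∧ y ≤ η y) →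
    ∫⁻ y in Set.Ioo (0 : ℝ) (1 / 2), ENNReal.ofReal (y ^ (τ - 1) * η y ^ (-lam)) ≤
      C * ENNReal.ofReal (h ^ (τ - lam)) := by
  refine ⟨ENNReal.ofReal (1 / τ + 1 / (lam - τ)), ENNReal.ofReal_ne_top, fun h η hh hη => ?_⟩
  have hl' : 0 < lam - τ := by linarith
  have h1 : ∀ y ∈ Set.Ioo (0 : ℝ) (1 / 2), ENNReal.ofReal (y ^ (τ - 1) * η y ^ (-lam)) ≤
      ENNReal.ofReal (h ^ (-lam)) * (Set.Ioo 0 h).indicator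
        (fun y => ENNReal.ofReal (y ^ (τ - 1))) y +
      (Set.Ici h).indicator (fun y => ENNReal.ofReal (y ^ (τ - 1 - lam))) y := by
    intro y hy
    obtain ⟨hy1, hy2⟩ := hη y hy
    have hy0 : 0 < y := hy.1
    rcases lt_or_ge y h with h3 | h3
    · refine le_trans ?_ le_self_add
      rw [Set.indicator_of_mem (show y ∈ Set.Ioo 0 h from ⟨hy0, h3⟩),
        ← ENNReal.ofReal_mul (by positivity), mul_comm]
      refine ENNReal.ofReal_le_ofReal ?_
      gcongr ?_ * _
      exact Real.rpow_le_rpow_of_nonpos hh hy1 (by linarith)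
    · refine le_trans ?_ le_add_self
      rw [Set.indicator_of_mem (show y ∈ Set.Ici h from h3), sub_eq_add_neg (τ - 1),
        Real.rpow_add hy0]
      refine ENNReal.ofReal_le_ofReal ?_
      gcongr _ * ?_
      exact Real.rpow_le_rpow_of_nonpos hy0 hy2 (by linarith)
  have hm1 : Measurable fun y : ℝ => (Set.Ioo 0 h).indicator
        (fun y => ENNReal.ofReal (y ^ (τ - 1))) y :=
    (measurable_id.pow_const _).ennreal_ofReal.indicator measurableSet_Ioo
  calc _ ≤ ∫⁻ y in Set.Ioo (0 : ℝ) (1 / 2), (ENNReal.ofReal (h ^ (-lam)) *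
        (Set.Ioo 0 h).indicator (fun y => ENNReal.ofReal (y ^ (τ - 1))) y +
        (Set.Ici h).indicator (fun y => ENNReal.ofReal (y ^ (τ - 1 - lam))) y) :=
        setLIntegral_mono' measurableSet_Ioo h1
    _ ≤ ∫⁻ y, (ENNReal.ofReal (h ^ (-lam)) *
        (Set.Ioo 0 h).indicator (fun y => ENNReal.ofReal (y ^ (τ - 1))) y +
        (Set.Ici h).indicator (fun y => ENNReal.ofReal (y ^ (τ - 1 - lam))) y) :=
        setLIntegral_le_lintegral _ _
    _ = ENNReal.ofReal (h ^ (-lam)) * ENNReal.ofReal (h ^ (1 + (τ - 1)) / (1 + (τ - 1))) +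
        ENNReal.ofReal (-h ^ (τ - 1 - lam + 1) / (τ - 1 - lam + 1)) := by
        rw [lintegral_add_left (hm1.const_mul _), lintegral_const_mul _ hm1,
          lintegral_indicator measurableSet_Ioo, lintegral_indicator measurableSet_Ici,
          lintegral_Ioo_rpow (by linarith) hh.le, setLIntegral_congr Ioi_ae_eq_Ici.symm,
          lintegral_Ioi_rpow (by linarith) hh]
    _ = ENNReal.ofReal (1 / τ + 1 / (lam - τ)) * ENNReal.ofReal (h ^ (τ - lam)) := by
        have e1 : -h ^ (τ - 1 - lam + 1) / (τ - 1 - lam + 1) = 1 / (lam - τ) * h ^ (τ - lam) := by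
          rw [show τ - 1 - lam + 1 = -(lam - τ) by ring, show τ - lam = -(lam - τ) by ring]
          field_simp
        have e2 : h ^ (τ - lam) = h ^ (-lam) * h ^ τ := by
          rw [← Real.rpow_add hh]; congr 1; ring
        rw [e1, add_sub_cancel, ← ENNReal.ofReal_mul (by positivity),
          ← ENNReal.ofReal_add (by positivity) (by positivity),
          ← ENNReal.ofReal_mul (by positivity), e2]
        congr 1
        ring

lemma rho_smul (z : Cn n) (x : ℝ) : rho ((x : ℂ) • z) = 1 - x ^ 2 * ‖z‖ ^ 2 := by
  rw [rho, norm_smul, Complex.norm_real, mul_pow, Real.norm_eq_abs, sq_abs]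

lemma le_rho_smul {z : Cn n} {y : ℝ} (hz : z ∈ ball (0 : Cn n) 1) (hy0 : 0 ≤ y) (hy1 : y ≤ 1) :
    y ≤ rho (((1 - y : ℝ) : ℂ) • z) ∧ rho z ≤ rho (((1 - y : ℝ) : ℂ) • z) := by
  rw [mem_ball_zero_iff] at hz
  have h2 : ‖z‖ ^ 2 ≤ 1 := by nlinarith [norm_nonneg z]
  have h3 : (1 - y) ^ 2 ≤ 1 - y := by nlinarith
  rw [rho_smul, rho]
  constructor
  · nlinarith [sq_nonneg (1 - y)]
  · nlinarith [sq_nonneg ‖z‖]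

/-- The points near `(1 - y) z` lie in the shadow of `z`. -/
lemma nearSet_smul_subset {z w : Cn n} {y : ℝ} (hz : z ∈ ball (0 : Cn n) 1) (hy0 : 0 < y)
    (hy1 : y < 1) (hw : w ∈ nearSet (((1 - y : ℝ) : ℂ) • z)) :
    w ∈ shadow z ∧ y < 5 * rho w := by
  obtain ⟨hy2, -⟩ := le_rho_smul hz hy0.le hy1.le
  obtain ⟨hw1, hw2, -, hw4⟩ := hw
  have h0 := rho_pos hw1
  refine ⟨⟨hw1, ?_⟩, by linarith⟩
  rw [norm_one_sub_herm_comm]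
  have h1 : 1 - herm w z = (1 - herm w (((1 - y : ℝ) : ℂ) • z)) - (y : ℂ) * herm w z := by
    rw [herm_smul_right, Complex.conj_ofReal]; push_cast; ring
  rw [mem_ball_zero_iff] at hz hw1
  have h2 : ‖herm w z‖ ≤ 1 := (norm_herm_le w z).trans (mul_le_one₀ hw1.le (norm_nonneg _) hz.le)
  rw [h1]
  calc _ ≤ ‖1 - herm w (((1 - y : ℝ) : ℂ) • z)‖ + ‖(y : ℂ) * herm w z‖ := norm_sub_le _ _
    _ ≤ 8 * rho (((1 - y : ℝ) : ℂ) • z) + y * 1 := by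
        rw [norm_mul, Complex.norm_real, Real.norm_of_nonneg hy0.le]
        gcongr
    _ ≤ _ := by linarith

/-- The fractional integral of order `τ` of `|F|` along the outer half of the radius through `z`,
with `y` the distance from the end point: `∫_0^{1/2} y^{τ-1} |F((1 - y) z)| dy`. -/
def radialIntegral (τ : ℝ) (F : Cn n → ℂ) (z : Cn n) : ℝ≥0∞ :=
  ∫⁻ y in Set.Ioo (0 : ℝ) (1 / 2),
    ENNReal.ofReal (y ^ (τ - 1)) * ‖F (((1 - y : ℝ) : ℂ) • z)‖ₑ

/-- Pointwise estimate of fractional integrals by averages over shadows. Hölder's inequality is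
applied with the power `κ` of `1 - |(1 - y) z|²` as an auxiliary weight. -/
lemma radialIntegral_rpow_le (hn : 1 ≤ n) {q : ℝ} (hq : 1 < q) {τ κ : ℝ} (hτ : 0 < τ)
    (hκ : τ * (q - 1) < κ) : ∃ C : ℝ≥0∞, C ≠ ∞ ∧
    ∀ F : Cn n → ℂ, DifferentiableOn ℂ F (ball 0 1) → Measurable F → ∀ z ∈ ball (0 : Cn n) 1,
    radialIntegral τ F z ^ q ≤ C * ENNReal.ofReal (rho z ^ (τ * (q - 1) - κ)) *
      ∫⁻ w in shadow z, ‖F w‖ₑ ^ q * ENNReal.ofReal (rho w ^ (κ + τ - n - 1)) := by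
  have hq1 : 0 < q - 1 := by linarith
  set lam := κ / (q - 1) with hlam
  set e : ℝ := κ - n - 1 with he
  have hl : τ < lam := by rwa [hlam, lt_div_iff₀ hq1]
  obtain ⟨C₁, hC₁, h₁⟩ := lintegral_rpow_mul_le hτ hl
  obtain ⟨C₂, hC₂, h₂⟩ := enorm_rpow_le_lintegral_nearSet hn
  refine ⟨C₁ ^ (q - 1) * (C₂ * ENNReal.ofReal (4 ^ |e|) * ENNReal.ofReal (5 ^ τ / τ)),
    ENNReal.mul_ne_top (ENNReal.rpow_ne_top_of_nonneg hq1.le hC₁) (ENNReal.mul_ne_top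
      (ENNReal.mul_ne_top hC₂ ENNReal.ofReal_ne_top) ENNReal.ofReal_ne_top),
    fun F hF hFm z hz => ?_⟩
  set ν : Measure ℝ := volume.restrict (Set.Ioo (0 : ℝ) (1 / 2)) with hν
  set p : ℝ → Cn n := fun y => ((1 - y : ℝ) : ℂ) • z with hp
  have hpm : Measurable p :=
    (by fun_prop : Continuous fun y : ℝ => ((1 - y : ℝ) : ℂ) • z).measurable
  have hz0 := rho_pos hz
  have hb : ∀ y ∈ Set.Ioo (0 : ℝ) (1 / 2), 0 < y ∧ p y ∈ ball (0 : Cn n) 1 ∧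
      rho z ≤ rho (p y) ∧ y ≤ rho (p y) := by
    intro y hy
    have h3 := le_rho_smul hz hy.1.le (by linarith [hy.2])
    exact ⟨hy.1, mem_ball_of_rho_pos (hz0.trans_le h3.2), h3.2, h3.1⟩
  set A : ℝ → ℝ≥0∞ := fun y => ENNReal.ofReal (y ^ (τ - 1) * rho (p y) ^ (-lam)) with hA
  set g : ℝ → ℝ≥0∞ := fun y => ENNReal.ofReal (rho (p y) ^ lam) * ‖F (p y)‖ₑ with hg
  have hrm : Measurable fun y => rho (p y) := measurable_rho.comp hpm
  have hAm : Measurable A := ((measurable_id.pow_const _).mul (hrm.pow_const _)).ennreal_ofReal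
  have hgm : Measurable g := (hrm.pow_const _).ennreal_ofReal.mul (hFm.comp hpm).enorm
  have hAg : radialIntegral τ F z = ∫⁻ y, A y * g y ∂ν := by
    refine setLIntegral_congr_fun measurableSet_Ioo fun y hy => ?_
    obtain ⟨hy0, -, hy2, -⟩ := hb y hy
    have hr0 := hz0.trans_le hy2
    simp only [hA, hg]
    rw [← mul_assoc, ← ENNReal.ofReal_mul (by positivity), mul_assoc, ← Real.rpow_add hr0,
      neg_add_cancel, Real.rpow_zero, mul_one]
  have hAi : (∫⁻ y, A y ∂ν) ^ (q - 1) ≤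
      C₁ ^ (q - 1) * ENNReal.ofReal (rho z ^ (τ * (q - 1) - κ)) := by
    have h3 := h₁ (rho z) (fun y => rho (p y)) hz0 fun y hy => (hb y hy).2.2
    refine (ENNReal.rpow_le_rpow h3 hq1.le).trans (le_of_eq ?_)
    rw [ENNReal.mul_rpow_of_nonneg _ _ hq1.le, ENNReal.ofReal_rpow_of_pos (by positivity),
      ← Real.rpow_mul hz0.le]
    congr 4
    rw [sub_mul, hlam, div_mul_cancel₀ _ hq1.ne']
  set Φ : Cn n → ℝ≥0∞ := fun w => ‖F w‖ₑ ^ q * ENNReal.ofReal (rho w ^ e) with hΦ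
  have hΦm : Measurable Φ :=
    (hFm.enorm.pow_const q).mul (measurable_rho.pow_const _).ennreal_ofReal
  -- The mean value estimate at `(1 - y) z`, whose neighbourhood only contains points `w` of the
  -- shadow of `z` with `y < 5 (1 - |w|²)`.
  have hpt : ∀ y ∈ Set.Ioo (0 : ℝ) (1 / 2), A y * g y ^ q ≤
      C₂ * ENNReal.ofReal (4 ^ |e|) * ∫⁻ w in shadow z,
        {a : ℝ × Cn n | a.1 < 5 * rho a.2}.indicator
          (fun a => ENNReal.ofReal (a.1 ^ (τ - 1)) * Φ a.2) (y, w) := by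
    intro y hy
    obtain ⟨hy0, hy1, hy2, -⟩ := hb y hy
    have hr0 := hz0.trans_le hy2
    have hnear : ∫⁻ w in nearSet (p y), ‖F w‖ₑ ^ q * ENNReal.ofReal (rho (p y) ^ e) ≤
        ENNReal.ofReal (4 ^ |e|) * ∫⁻ w in nearSet (p y), Φ w := by
      rw [← lintegral_const_mul' _ _ ENNReal.ofReal_ne_top]
      refine setLIntegral_mono' (measurableSet_nearSet _) fun w hw => ?_
      rw [hΦ, mul_left_comm, ← ENNReal.ofReal_mul (by positivity)]
      gcongr
      exact rpow_le_of_comparable hr0 (rho_pos hw.1) hw.2.1 hw.2.2.1 e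
    have h4 : A y * g y ^ q = ENNReal.ofReal (y ^ (τ - 1)) * (‖F (p y)‖ₑ ^ q *
        ENNReal.ofReal (rho (p y) ^ (n + 1)) * ENNReal.ofReal (rho (p y) ^ e)) := by
      simp only [hA, hg]
      rw [ENNReal.mul_rpow_of_nonneg _ _ (by linarith), ENNReal.ofReal_rpow_of_pos (by positivity),
        mul_assoc (‖F (p y)‖ₑ ^ q), ← ENNReal.ofReal_mul (by positivity), ← mul_assoc,
        ← ENNReal.ofReal_mul (by positivity), mul_comm (‖F (p y)‖ₑ ^ q), ← mul_assoc,
        ← ENNReal.ofReal_mul (by positivity)]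
      congr 2
      rw [mul_assoc, ← Real.rpow_mul hr0.le, ← Real.rpow_add hr0, ← Real.rpow_natCast,
        ← Real.rpow_add hr0]
      congr 2
      rw [he, hlam]
      push_cast
      field_simp
      ring
    have hsub : nearSet (p y) ⊆ shadow z := fun w hw =>
      (nearSet_smul_subset hz hy0 (by linarith [hy.2]) hw).1
    have h2' := h₂ q hq F hF hFm (p y) hy1 1 (by simp; positivity)
    rw [one_smul] at h2'
    calc A y * g y ^ q ≤ ENNReal.ofReal (y ^ (τ - 1)) *
          (C₂ * (∫⁻ w in nearSet (p y), ‖F w‖ₑ ^ q) * ENNReal.ofReal (rho (p y) ^ e)) := by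
          rw [h4]
          gcongr ENNReal.ofReal (y ^ (τ - 1)) * (?_ * _)
      _ = ENNReal.ofReal (y ^ (τ - 1)) * (C₂ *
          ∫⁻ w in nearSet (p y), ‖F w‖ₑ ^ q * ENNReal.ofReal (rho (p y) ^ e)) := by
          rw [lintegral_mul_const _ (hFm.enorm.pow_const q), mul_assoc C₂]
      _ ≤ ENNReal.ofReal (y ^ (τ - 1)) * (C₂ *
          (ENNReal.ofReal (4 ^ |e|) * ∫⁻ w in nearSet (p y), Φ w)) := by gcongr
      _ = C₂ * ENNReal.ofReal (4 ^ |e|) *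
          ∫⁻ w in nearSet (p y), ENNReal.ofReal (y ^ (τ - 1)) * Φ w := by
          rw [lintegral_const_mul _ hΦm]; ring
      _ ≤ C₂ * ENNReal.ofReal (4 ^ |e|) * ∫⁻ w in nearSet (p y),
          {a : ℝ × Cn n | a.1 < 5 * rho a.2}.indicator
          (fun a => ENNReal.ofReal (a.1 ^ (τ - 1)) * Φ a.2) (y, w) := by
          gcongr C₂ * ENNReal.ofReal (4 ^ |e|) * ?_
          refine setLIntegral_mono' (measurableSet_nearSet _) fun w hw => ?_
          rw [Set.indicator_of_mem (show (y, w) ∈ {a : ℝ × Cn n | a.1 < 5 * rho a.2} from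
            (nearSet_smul_subset hz hy0 (by linarith [hy.2]) hw).2)]
      _ ≤ _ := by gcongr
  have hset : MeasurableSet {a : ℝ × Cn n | a.1 < 5 * rho a.2} :=
    measurableSet_lt measurable_fst ((measurable_rho.comp measurable_snd).const_mul 5)
  have hΨ : Measurable fun a : ℝ × Cn n => {a : ℝ × Cn n | a.1 < 5 * rho a.2}.indicator
      (fun a => ENNReal.ofReal (a.1 ^ (τ - 1)) * Φ a.2) a :=
    Measurable.indicator ((measurable_fst.pow_const _).ennreal_ofReal.mul
      (hΦm.comp measurable_snd)) hset
  have hin : ∀ w ∈ shadow z, ∫⁻ y, {a : ℝ × Cn n | a.1 < 5 * rho a.2}.indicator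
      (fun a => ENNReal.ofReal (a.1 ^ (τ - 1)) * Φ a.2) (y, w) ∂ν ≤
      ENNReal.ofReal (5 ^ τ / τ) * (‖F w‖ₑ ^ q * ENNReal.ofReal (rho w ^ (κ + τ - n - 1))) := by
    intro w hw
    have hw0 := rho_pos hw.1
    calc _ ≤ ∫⁻ y, (Set.Ioo 0 (5 * rho w)).indicator
          (fun y => ENNReal.ofReal (y ^ (τ - 1)) * Φ w) y ∂ν := by
          refine setLIntegral_mono' measurableSet_Ioo fun y hy => ?_
          by_cases h : y < 5 * rho w
          · rw [Set.indicator_of_mem (show (y, w) ∈ {a : ℝ × Cn n | a.1 < 5 * rho a.2} from h),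
              Set.indicator_of_mem (show y ∈ Set.Ioo 0 (5 * rho w) from ⟨hy.1, h⟩)]
          · rw [Set.indicator_of_notMem
              (show (y, w) ∉ {a : ℝ × Cn n | a.1 < 5 * rho a.2} from h)]
            exact zero_le
      _ ≤ ∫⁻ y, (Set.Ioo 0 (5 * rho w)).indicator
          (fun y => ENNReal.ofReal (y ^ (τ - 1)) * Φ w) y := setLIntegral_le_lintegral _ _
      _ = ENNReal.ofReal ((5 * rho w) ^ τ / τ) * Φ w := by
          have hm : Measurable fun y : ℝ => ENNReal.ofReal (y ^ (τ - 1)) :=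
            (measurable_id.pow_const _).ennreal_ofReal
          rw [lintegral_indicator measurableSet_Ioo, lintegral_mul_const _ hm,
            lintegral_Ioo_rpow (by linarith)
            (by positivity), add_sub_cancel]
      _ = _ := by
          simp only [hΦ]
          rw [mul_left_comm, mul_left_comm (ENNReal.ofReal (5 ^ τ / τ)),
            ← ENNReal.ofReal_mul (by positivity), ← ENNReal.ofReal_mul (by positivity)]
          congr 2
          rw [show κ + τ - n - 1 = e + τ by rw [he]; ring, Real.rpow_add hw0,
            Real.mul_rpow (by norm_num) hw0.le]
          ring
  calc radialIntegral τ F z ^ q ≤ (∫⁻ y, A y ∂ν) ^ (q - 1) * ∫⁻ y, A y * g y ^ q ∂ν := by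
        rw [hAg]; exact lintegral_mul_rpow_le hq hAm hgm
    _ ≤ C₁ ^ (q - 1) * ENNReal.ofReal (rho z ^ (τ * (q - 1) - κ)) *
        (C₂ * ENNReal.ofReal (4 ^ |e|) * (ENNReal.ofReal (5 ^ τ / τ) *
          ∫⁻ w in shadow z, ‖F w‖ₑ ^ q * ENNReal.ofReal (rho w ^ (κ + τ - n - 1)))) := by
        gcongr
        calc ∫⁻ y, A y * g y ^ q ∂ν ≤ ∫⁻ y, (C₂ * ENNReal.ofReal (4 ^ |e|) * ∫⁻ w in shadow z,
              {a : ℝ × Cn n | a.1 < 5 * rho a.2}.indicator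
              (fun a => ENNReal.ofReal (a.1 ^ (τ - 1)) * Φ a.2) (y, w)) ∂ν :=
              setLIntegral_mono' measurableSet_Ioo hpt
          _ = C₂ * ENNReal.ofReal (4 ^ |e|) * ∫⁻ w in shadow z, (∫⁻ y,
              {a : ℝ × Cn n | a.1 < 5 * rho a.2}.indicator
              (fun a => ENNReal.ofReal (a.1 ^ (τ - 1)) * Φ a.2) (y, w) ∂ν) := by
              rw [lintegral_const_mul' _ _ (ENNReal.mul_ne_top hC₂ ENNReal.ofReal_ne_top),
                lintegral_lintegral_swap hΨ.aemeasurable]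
          _ ≤ _ := by
              gcongr C₂ * ENNReal.ofReal (4 ^ |e|) * ?_
              rw [← lintegral_const_mul' _ _ ENNReal.ofReal_ne_top]
              exact setLIntegral_mono' (measurableSet_shadow z) hin
    _ = _ := by ring

/-- Fractional integration of order `τ` lowers the exponent of a Carleson condition by `q τ`. -/
lemma CarlesonLE.radialIntegral (hn : 1 ≤ n) {q : ℝ} (hq : 1 < q) {τ δ₀ : ℝ} (hτ : 0 < τ)
    (hδ : -1 < δ₀ - q * τ) : ∃ C : ℝ≥0∞, C ≠ ∞ ∧
    ∀ (F : Cn n → ℂ) (M : ℝ≥0∞), DifferentiableOn ℂ F (ball 0 1) → Measurable F →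
    CarlesonLE δ₀ (fun z => ‖F z‖ₑ ^ q) M →
    CarlesonLE (δ₀ - q * τ) (fun z => radialIntegral τ F z ^ q) (C * M) := by
  set δ := δ₀ - q * τ with hδdef
  -- Any exponent in `(-1, δ)` would do for the outer weight.
  set δ' := (δ - 1) / 2 with hδ'
  set κ := δ + τ * (q - 1) - δ' with hκ
  obtain ⟨C₁, hC₁, h₁⟩ := radialIntegral_rpow_le hn hq (τ := τ) (κ := κ) hτ (by linarith)
  obtain ⟨C₂, hC₂, h₂⟩ := CarlesonLE.lintegral_shadow_le hn (δ := δ') (by linarith) δ₀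
  refine ⟨C₁ * C₂, ENNReal.mul_ne_top hC₁ hC₂, fun F M hF hFm hM ζ hζ r hr => ?_⟩
  have h3 := h₂ _ M (hFm.enorm.pow_const q) hM ζ hζ r hr
  calc ∫⁻ z in tubeAt ζ r, HoloTent.radialIntegral τ F z ^ q * ENNReal.ofReal (rho z ^ δ)
      ≤ ∫⁻ z in tubeAt ζ r, C₁ * (ENNReal.ofReal (rho z ^ δ') *
        ∫⁻ w in shadow z, ‖F w‖ₑ ^ q * ENNReal.ofReal (rho w ^ (δ₀ - n - 1 - δ'))) := by
        refine setLIntegral_mono' (measurableSet_tubeAt ζ r) fun z hz => ?_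
        have h0 := rho_pos hz.1
        have e1 : δ₀ - n - 1 - δ' = κ + τ - n - 1 := by rw [hκ, hδdef]; ring
        have e2 : δ' = τ * (q - 1) - κ + δ := by rw [hκ]; ring
        rw [e1, e2, Real.rpow_add h0, ENNReal.ofReal_mul (by positivity)]
        calc _ ≤ C₁ * ENNReal.ofReal (rho z ^ (τ * (q - 1) - κ)) *
              (∫⁻ w in shadow z, ‖F w‖ₑ ^ q * ENNReal.ofReal (rho w ^ (κ + τ - n - 1))) *
              ENNReal.ofReal (rho z ^ δ) := by
              gcongr ?_ * _
              exact h₁ F hF hFm z hz.1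
          _ = _ := by ring
    _ ≤ C₁ * (C₂ * M * ENNReal.ofReal (r ^ n)) := by
        rw [lintegral_const_mul' _ _ hC₁]
        gcongr
    _ = _ := by ring

/-! ### Carleson conditions under fractional differentiation -/

/-- Weighted integrals over nonisotropic neighbourhoods bound functions where `1 - |z|²` is bounded
below. -/
lemma enorm_rpow_le_of_le_rho (hn : 1 ≤ n) {q : ℝ} (hq : 1 < q) (δ₀ : ℝ) {h : ℝ} (hh : 0 < h) :
    ∃ C : ℝ≥0∞, C ≠ ∞ ∧ ∀ F : Cn n → ℂ, DifferentiableOn ℂ F (ball 0 1) → Measurable F →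
    ∀ z ∈ ball (0 : Cn n) 1, h ≤ rho z →
    ‖F z‖ₑ ^ q ≤ C * ∫⁻ w in nearSet z, ‖F w‖ₑ ^ q * ENNReal.ofReal (rho w ^ δ₀) := by
  obtain ⟨C, hC, hloc⟩ := enorm_rpow_le_lintegral_nearSet hn
  set a : ℝ := h ^ (n + 1) with ha
  set b : ℝ := (h / 4) ^ |δ₀| with hb
  have ha0 : 0 < a := by positivity
  have hb0 : 0 < b := by positivity
  refine ⟨ENNReal.ofReal a⁻¹ * C * ENNReal.ofReal b⁻¹, ENNReal.mul_ne_top (ENNReal.mul_ne_top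
    ENNReal.ofReal_ne_top hC) ENNReal.ofReal_ne_top, fun F hF hFm z hzb hz => ?_⟩
  have h0 := rho_pos hzb
  have h1 := hloc q hq F hF hFm z hzb 1 (by simp; positivity)
  rw [one_smul] at h1
  have h2 : ∫⁻ w in nearSet z, ‖F w‖ₑ ^ q ≤
      ENNReal.ofReal b⁻¹ * ∫⁻ w in nearSet z, ‖F w‖ₑ ^ q * ENNReal.ofReal (rho w ^ δ₀) := by
    rw [← lintegral_const_mul' _ _ ENNReal.ofReal_ne_top]
    refine setLIntegral_mono' (measurableSet_nearSet z) fun w hw => ?_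
    have hw0 := rho_pos hw.1
    rw [mul_left_comm, ← ENNReal.ofReal_mul (by positivity)]
    refine le_mul_of_one_le_right zero_le ?_
    rw [ENNReal.one_le_ofReal, inv_mul_eq_div, one_le_div hb0]
    calc b ≤ rho w ^ |δ₀| := by
          rw [hb]
          gcongr
          linarith [hw.2.1]
      _ ≤ _ := Real.rpow_le_rpow_of_exponent_ge hw0 (rho_le_one w) (le_abs_self _)
  have h3 : ‖F z‖ₑ ^ q ≤ ENNReal.ofReal a⁻¹ * (‖F z‖ₑ ^ q * ENNReal.ofReal (rho z ^ (n + 1))) := by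
    rw [mul_left_comm, ← ENNReal.ofReal_mul (by positivity)]
    refine le_mul_of_one_le_right zero_le ?_
    rw [ENNReal.one_le_ofReal, inv_mul_eq_div, one_le_div ha0, ha]
    gcongr
  rw [mul_assoc, mul_assoc]
  exact h3.trans (mul_le_mul_right (h1.trans (mul_le_mul_right h2 C)) _)

/-- Carleson conditions bound functions on a smaller ball. -/
lemma enorm_rpow_le_of_carlesonLE (hn : 1 ≤ n) {q : ℝ} (hq : 1 < q) (δ₀ : ℝ) :
    ∃ C : ℝ≥0∞, C ≠ ∞ ∧ ∀ (F : Cn n → ℂ) (M : ℝ≥0∞), DifferentiableOn ℂ F (ball 0 1) →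
    Measurable F → CarlesonLE δ₀ (fun z => ‖F z‖ₑ ^ q) M →
    ∀ z : Cn n, ‖z‖ ≤ 3 / 4 → ‖F z‖ₑ ^ q ≤ C * M := by
  obtain ⟨C, hC, h⟩ := enorm_rpow_le_of_le_rho hn hq δ₀ (h := 7 / 16) (by norm_num)
  obtain ⟨ζ, hζ⟩ := exists_norm_eq_one hn
  refine ⟨C * ENNReal.ofReal (2 ^ n), ENNReal.mul_ne_top hC ENNReal.ofReal_ne_top,
    fun F M hF hFm hM z hz => ?_⟩
  refine (h F hF hFm z (by rw [mem_ball_zero_iff]; linarith)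
    (by rw [rho]; nlinarith [norm_nonneg z])).trans ?_
  rw [mul_assoc, mul_comm _ M]
  refine mul_le_mul_right (le_trans ?_ (hM ζ hζ 2 two_pos)) C
  rw [tubeAt_two hζ]
  exact lintegral_mono_set fun w hw => hw.1

lemma isMultiplier_of_decay {e : ℕ → ℂ} {K : ℝ} (he : ∀ k, ‖e k‖ ≤ K * (1 / 2) ^ k) :
    IsMultiplier e := by
  intro ρ h0 h1
  have hK : 0 ≤ K := by simpa using (norm_nonneg _).trans (he 0)
  refine Summable.of_norm_bounded
    ((summable_geometric_of_lt_one (r := ρ / 2) (by positivity) (by linarith)).mul_left K)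
    fun k => ?_
  rw [norm_mul, norm_norm, norm_pow, Real.norm_of_nonneg h0.le]
  calc _ ≤ K * (1 / 2) ^ k * ρ ^ k := by gcongr; exact he k
    _ = _ := by rw [mul_assoc, ← mul_pow]; congr 2; ring

/-- Multipliers of exponential decay `2⁻ᵏ` map Carleson conditions of any exponent to Carleson
conditions of any exponent larger than `-1`: the values on the whole ball are bounded by the maximum
over the ball of radius `3/4`. -/
lemma CarlesonLE.multFun_of_decay (hn : 1 ≤ n) {q : ℝ} (hq : 1 < q) (δ₀ : ℝ) {δ : ℝ} (hδ : -1 < δ)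
    {e : ℕ → ℂ} {K : ℝ} (he : ∀ k, ‖e k‖ ≤ K * (1 / 2) ^ k) :
    ∃ C : ℝ≥0∞, C ≠ ∞ ∧ ∀ (F : Cn n → ℂ) (M : ℝ≥0∞), DifferentiableOn ℂ F (ball 0 1) →
    Measurable F → CarlesonLE δ₀ (fun z => ‖F z‖ₑ ^ q) M →
    CarlesonLE δ (fun z => ‖multFun e F z‖ₑ ^ q) (C * M) := by
  obtain ⟨C₁, hC₁, h₁⟩ := enorm_rpow_le_of_carlesonLE hn hq δ₀
  obtain ⟨C₂, hC₂, h₂⟩ := exists_carlesonLE_const (n := n) hn hδ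
  have hK : 0 ≤ K := by simpa using (norm_nonneg _).trans (he 0)
  refine ⟨C₂ * (ENNReal.ofReal (K * 3) ^ q * C₁), ENNReal.mul_ne_top hC₂ (ENNReal.mul_ne_top
    (ENNReal.rpow_ne_top_of_nonneg (by linarith) ENNReal.ofReal_ne_top) hC₁),
    fun F M hF hFm hM => ?_⟩
  refine (h₂ (ENNReal.ofReal (K * 3) ^ q * (C₁ * M))).mono (fun z hz => ?_) (le_of_eq (by ring))
  obtain ⟨w, hw, hmax⟩ := (isCompact_closedBall (0 : Cn n) (3 / 4)).exists_isMaxOn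
    (nonempty_closedBall.2 (by norm_num))
    ((hF.continuousOn.mono (closedBall_subset_ball (by norm_num))).norm)
  rw [mem_closedBall_zero_iff] at hw
  have hterm : ∀ k, ‖e k * hcomp k F z‖ ≤ K * ‖F w‖ * (2 / 3) ^ k := by
    intro k
    have h3 := norm_hcomp_le hF (z := z) (r := 3 / 4) (ρ := 3 / 4) (by norm_num) (by norm_num)
      (by rw [mem_ball_zero_iff] at hz; linarith) (fun w hw => hmax hw) k
    rw [norm_mul]
    calc _ ≤ K * (1 / 2) ^ k * (‖F w‖ / (3 / 4) ^ k) := by gcongr; exact he k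
      _ = K * ‖F w‖ * (2 / 3) ^ k := by
        rw [mul_div_assoc', div_eq_iff (by positivity), mul_assoc _ ((2 / 3 : ℝ) ^ k), ← mul_pow]
        norm_num
        ring
  have hsum : HasSum (fun k : ℕ => K * ‖F w‖ * (2 / 3 : ℝ) ^ k) (K * ‖F w‖ * 3) := by
    have := hasSum_geometric_of_lt_one (r := (2 / 3 : ℝ)) (by norm_num) (by norm_num)
    norm_num at this
    exact this.mul_left _
  have h4 : ‖multFun e F z‖ ≤ K * 3 * ‖F w‖ := by
    refine (tsum_of_norm_bounded hsum hterm).trans (le_of_eq (by ring))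
  have h5 : ‖multFun e F z‖ₑ ≤ ENNReal.ofReal (K * 3) * ‖F w‖ₑ := by
    rw [← ofReal_norm, ← ofReal_norm, ← ENNReal.ofReal_mul (by positivity)]
    exact ENNReal.ofReal_le_ofReal h4
  calc ‖multFun e F z‖ₑ ^ q ≤ (ENNReal.ofReal (K * 3) * ‖F w‖ₑ) ^ q :=
        ENNReal.rpow_le_rpow h5 (by linarith)
    _ = ENNReal.ofReal (K * 3) ^ q * ‖F w‖ₑ ^ q := ENNReal.mul_rpow_of_nonneg _ _ (by linarith)
    _ ≤ _ := by gcongr; exact h₁ F M hF hFm hM w hw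

lemma pochRatio_eq_Gamma {a b : ℝ} (ha : ∀ k : ℕ, a + k ≠ 0) (hb : ∀ k : ℕ, b + k ≠ 0) (k : ℕ) :
    pochRatio a b k = Real.Gamma a / Real.Gamma b * (Real.Gamma (b + k) / Real.Gamma (a + k)) := by
  have hne : ∀ {x : ℝ}, (∀ k : ℕ, x + k ≠ 0) → ∀ k : ℕ, Real.Gamma (x + k) ≠ 0 := by
    intro x hx k
    refine Real.Gamma_ne_zero fun m h => hx (k + m) ?_
    push_cast
    linarith
  induction k with
  | zero =>
    have h1 := hne ha 0
    have h2 := hne hb 0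
    simp only [Nat.cast_zero, add_zero] at h1 h2
    rw [pochRatio_zero, Nat.cast_zero, add_zero, add_zero]
    field_simp
  | succ k ih =>
    rw [pochRatio_succ, ih]
    push_cast
    rw [← add_assoc, ← add_assoc, Real.Gamma_add_one (hb k), Real.Gamma_add_one (ha k)]
    have := hne ha k
    have := ha k
    field_simp

/-- Euler's Beta integral. -/
lemma integrableOn_and_integral_beta {u v : ℝ} (hu : 0 < u) (hv : 0 < v) :
    IntegrableOn (fun y : ℝ => y ^ (u - 1) * (1 - y) ^ (v - 1)) (Set.Ioc 0 1) ∧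
    ∫ y in Set.Ioc (0 : ℝ) 1, y ^ (u - 1) * (1 - y) ^ (v - 1) =
      Real.Gamma u * Real.Gamma v / Real.Gamma (u + v) := by
  have h0 := Complex.betaIntegral_convergent (u := u) (v := v) (by simpa) (by simpa)
  rw [intervalIntegrable_iff_integrableOn_Ioc_of_le zero_le_one] at h0
  have heq : Set.EqOn (fun y : ℝ => (y : ℂ) ^ ((u : ℂ) - 1) * (1 - (y : ℂ)) ^ ((v : ℂ) - 1))
      (fun y : ℝ => ((y ^ (u - 1) * (1 - y) ^ (v - 1) : ℝ) : ℂ)) (Set.Ioc 0 1) := by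
    intro y hy
    simp only
    rw [Complex.ofReal_mul, Complex.ofReal_cpow hy.1.le, Complex.ofReal_cpow (by linarith [hy.2])]
    push_cast
    rfl
  have h1 : IntegrableOn (fun y : ℝ => ((y ^ (u - 1) * (1 - y) ^ (v - 1) : ℝ) : ℂ))
      (Set.Ioc 0 1) := h0.congr_fun heq measurableSet_Ioc
  refine ⟨h1.re, ?_⟩
  have h2 := Complex.betaIntegral_eq_Gamma_mul_div (u : ℂ) v (by simpa) (by simpa)
  rw [Complex.betaIntegral, intervalIntegral.integral_of_le zero_le_one,
    setIntegral_congr_fun measurableSet_Ioc heq, integral_complex_ofReal,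
    ← Complex.ofReal_add, Complex.Gamma_ofReal, Complex.Gamma_ofReal, Complex.Gamma_ofReal] at h2
  exact_mod_cast h2

/-- Up to an exponentially small error, `(b)_k / (b + τ)_k` is a multiple of a Beta integral over
`(0, 1/2)`. -/
lemma pochRatio_sub_integral_le {b τ : ℝ} (hτ : 0 < τ) (hb : ∀ k : ℕ, b + k ≠ 0)
    (hc : ∀ k : ℕ, b + τ + k ≠ 0) : ∃ A K : ℝ, ∀ k : ℕ,
    ‖pochRatio (b + τ) b k -
      A * ∫ y in Set.Ioo (0 : ℝ) (1 / 2), y ^ (τ - 1) * (1 - y) ^ (b - 1) * (1 - y) ^ k‖ ≤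
      K * (1 / 2) ^ k := by
  set A := Real.Gamma (b + τ) / Real.Gamma b / Real.Gamma τ with hA
  suffices h : (fun k : ℕ => pochRatio (b + τ) b k - A * ∫ y in Set.Ioo (0 : ℝ) (1 / 2),
      y ^ (τ - 1) * (1 - y) ^ (b - 1) * (1 - y) ^ k) =O[atTop] fun k => (1 / 2 : ℝ) ^ k by
    obtain ⟨K, -, hK⟩ := Asymptotics.bound_of_isBigO_nat_atTop h
    refine ⟨A, K, fun k => (hK (by positivity)).trans (le_of_eq ?_)⟩
    rw [Real.norm_of_nonneg (by positivity)]
  obtain ⟨k₀, hk₀⟩ := exists_nat_gt (1 - b)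
  refine Asymptotics.IsBigO.of_bound (|A| * (4 ^ |τ - 1| * (1 / 2) ^ (b - 1))) ?_
  filter_upwards [eventually_ge_atTop k₀] with k hk
  have hk' : (k₀ : ℝ) ≤ k := by exact_mod_cast hk
  have hbk : 1 < b + k := by linarith
  obtain ⟨hint, hval⟩ := integrableOn_and_integral_beta hτ (v := b + k) (by linarith)
  have hcongr : ∫ y in Set.Ioo (0 : ℝ) (1 / 2), y ^ (τ - 1) * (1 - y) ^ (b - 1) * (1 - y) ^ k =
      ∫ y in Set.Ioc (0 : ℝ) (1 / 2), y ^ (τ - 1) * (1 - y) ^ (b + k - 1) := by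
    rw [integral_Ioc_eq_integral_Ioo]
    refine setIntegral_congr_fun measurableSet_Ioo fun y hy => ?_
    have : 0 < 1 - y := by linarith [hy.2]
    rw [mul_assoc, ← Real.rpow_natCast, ← Real.rpow_add this]
    congr 2
    ring
  have hsplit : ∫ y in Set.Ioc (0 : ℝ) 1, y ^ (τ - 1) * (1 - y) ^ (b + k - 1) =
      (∫ y in Set.Ioc (0 : ℝ) (1 / 2), y ^ (τ - 1) * (1 - y) ^ (b + k - 1)) +
      ∫ y in Set.Ioc (1 / 2 : ℝ) 1, y ^ (τ - 1) * (1 - y) ^ (b + k - 1) := by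
    rw [← setIntegral_union (Set.Ioc_disjoint_Ioc_of_le le_rfl) measurableSet_Ioc
      (hint.mono_set (Set.Ioc_subset_Ioc_right (by norm_num)))
      (hint.mono_set (Set.Ioc_subset_Ioc_left (by norm_num))),
      Set.Ioc_union_Ioc_eq_Ioc (by norm_num) (by norm_num)]
  have hp : pochRatio (b + τ) b k = A * ∫ y in Set.Ioc (0 : ℝ) 1,
      y ^ (τ - 1) * (1 - y) ^ (b + k - 1) := by
    rw [hval, pochRatio_eq_Gamma hc hb, hA, show τ + (b + k) = b + τ + k by ring]
    have := (Real.Gamma_pos_of_pos hτ).ne'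
    field_simp
  have hle : ‖∫ y in Set.Ioc (1 / 2 : ℝ) 1, y ^ (τ - 1) * (1 - y) ^ (b + k - 1)‖ ≤
      4 ^ |τ - 1| * (1 / 2) ^ (b + k - 1) := by
    refine (norm_setIntegral_le_of_norm_le_const (C := 4 ^ |τ - 1| * (1 / 2) ^ (b + k - 1))
      (by simp) fun y hy => ?_).trans ?_
    · have hy0 : 0 < y := by linarith [hy.1]
      have hy1 : 0 ≤ 1 - y := by linarith [hy.2]
      rw [Real.norm_of_nonneg (by positivity)]
      have := rpow_le_of_comparable hy0 one_pos (by linarith [hy.2]) (by linarith [hy.1]) (τ - 1)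
      rw [Real.one_rpow, mul_one] at this
      gcongr
      linarith [hy.1]
    · refine mul_le_of_le_one_right (by positivity) ?_
      simp [Measure.real]
      norm_num
  rw [hcongr, hp, hsplit, mul_add, add_sub_cancel_left, norm_mul, Real.norm_eq_abs A,
    Real.norm_of_nonneg (by positivity : (0 : ℝ) ≤ (1 / 2) ^ k)]
  calc |A| * _ ≤ |A| * (4 ^ |τ - 1| * (1 / 2) ^ (b + k - 1)) := by gcongr
    _ = _ := by
      rw [show b + k - 1 = b - 1 + k by ring, Real.rpow_add_natCast (by norm_num)]
      ring

/-- Fractional integration as a multiplier: `(b)_k / (b + τ)_k` acts, up to a smoothing operator, as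
a radial integral. -/
lemma enorm_multFun_pochRatio_le {b τ : ℝ} (hτ : 0 < τ) (hb : ∀ k : ℕ, b + k ≠ 0)
    (hc : ∀ k : ℕ, b + τ + k ≠ 0) : ∃ (C : ℝ≥0∞) (K : ℝ) (e : ℕ → ℂ), C ≠ ∞ ∧
    (∀ k, ‖e k‖ ≤ K * (1 / 2) ^ k) ∧
    ∀ F : Cn n → ℂ, DifferentiableOn ℂ F (ball 0 1) → ∀ z ∈ ball (0 : Cn n) 1,
    ‖multFun (fun k => (pochRatio (b + τ) b k : ℂ)) F z‖ₑ ≤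
      ‖multFun e F z‖ₑ + C * radialIntegral τ F z := by
  obtain ⟨A, K, hAK⟩ := pochRatio_sub_integral_le hτ hb hc
  set w : ℝ → ℝ := fun y => y ^ (τ - 1) * (1 - y) ^ (b - 1) with hw
  set c : ℕ → ℝ := fun k => ∫ y in Set.Ioo (0 : ℝ) (1 / 2), w y * (1 - y) ^ k with hcdef
  set e : ℕ → ℂ := fun k => ((pochRatio (b + τ) b k - A * c k : ℝ) : ℂ) with he
  have heK : ∀ k, ‖e k‖ ≤ K * (1 / 2) ^ k := fun k => by
    rw [he, Complex.norm_real]; exact hAK k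
  refine ⟨‖(A : ℂ)‖ₑ * ENNReal.ofReal (4 ^ |b - 1|), K, e,
    ENNReal.mul_ne_top enorm_ne_top ENNReal.ofReal_ne_top, heK, fun F hF z hz => ?_⟩
  have hw0 : ∀ y ∈ Set.Ioo (0 : ℝ) (1 / 2), 0 ≤ w y ∧ w y ≤ 4 ^ |b - 1| * y ^ (τ - 1) := by
    intro y hy
    have h1 : 0 < 1 - y := by linarith [hy.2]
    have h2 := rpow_le_of_comparable h1 one_pos (by linarith [hy.1]) (by linarith [hy.2]) (b - 1)
    rw [Real.one_rpow, mul_one] at h2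
    have hy0 := hy.1
    refine ⟨by positivity, ?_⟩
    rw [mul_comm]
    exact mul_le_mul_of_nonneg_left h2 (Real.rpow_nonneg hy0.le _)
  have hwm : Measurable w :=
    (measurable_id.pow_const _).mul ((measurable_const.sub measurable_id).pow_const _)
  have hpow : IntegrableOn (fun y : ℝ => y ^ (τ - 1)) (Set.Ioo 0 (1 / 2)) :=
    ((intervalIntegral.intervalIntegrable_rpow' (by linarith)).1).mono_set Set.Ioo_subset_Ioc_self
  have hwk : ∀ k : ℕ, IntegrableOn (fun y => w y * (1 - y) ^ k) (Set.Ioo (0 : ℝ) (1 / 2)) := by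
    intro k
    refine (hpow.const_mul (4 ^ |b - 1|)).mono'
      (hwm.mul ((measurable_const.sub measurable_id).pow_const k)).aestronglyMeasurable ?_
    refine (ae_restrict_mem measurableSet_Ioo).mono fun y hy => ?_
    obtain ⟨h1, h2⟩ := hw0 y hy
    have h3 : 0 ≤ 1 - y := by linarith [hy.2]
    rw [Real.norm_of_nonneg (by positivity)]
    exact (mul_le_of_le_one_right h1 (pow_le_one₀ h3 (by linarith [hy.1]))).trans h2
  have hc0 : ∀ k, ‖c k‖ ≤ c 0 := by
    intro k
    refine (norm_integral_le_integral_norm _).trans ?_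
    refine setIntegral_mono_on (hwk k).norm (hwk 0) measurableSet_Ioo fun y hy => ?_
    obtain ⟨h1, -⟩ := hw0 y hy
    have h3 : 0 ≤ 1 - y := by linarith [hy.2]
    rw [Real.norm_of_nonneg (by positivity), pow_zero]
    gcongr
    exact pow_le_one₀ h3 (by linarith [hy.1])
  -- The radial integral of `F` has the multiplier `c`.
  have hsum : HasSum (fun k => (c k : ℂ) * hcomp k F z)
      (∫ y in Set.Ioo (0 : ℝ) (1 / 2), (w y : ℂ) * F (((1 - y : ℝ) : ℂ) • z)) := by
    have hs := summable_mul_hcomp isMultiplier_one hF hz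
    simp only [one_mul] at hs
    have hint : ∀ k : ℕ, IntegrableOn (fun y : ℝ => ((w y * (1 - y) ^ k : ℝ) : ℂ) * hcomp k F z)
        (Set.Ioo (0 : ℝ) (1 / 2)) := fun k => ((hwk k).ofReal).mul_const _
    have h1 := hasSum_integral_of_summable_integral_norm (μ := volume.restrict (Set.Ioo 0 (1 / 2)))
      hint ?_
    · have h2 : ∫ y in Set.Ioo (0 : ℝ) (1 / 2),
          ∑' k, ((w y * (1 - y) ^ k : ℝ) : ℂ) * hcomp k F z =
          ∫ y in Set.Ioo (0 : ℝ) (1 / 2), (w y : ℂ) * F (((1 - y : ℝ) : ℂ) • z) := by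
        refine setIntegral_congr_fun measurableSet_Ioo fun y hy => ?_
        have hyz : ((1 - y : ℝ) : ℂ) • z ∈ ball (0 : Cn n) 1 := by
          refine smul_mem_unitBall hz ?_
          rw [Complex.norm_real, Real.norm_of_nonneg (by linarith [hy.2])]
          linarith [hy.1]
        refine HasSum.tsum_eq ?_
        refine hasSum_of_eq (fun k => ?_) ((hasSum_hcomp hF hyz).mul_left (w y : ℂ))
        rw [hcomp_smul]
        push_cast
        ring
      rw [h2] at h1
      refine hasSum_of_eq (fun k => ?_) h1
      rw [integral_mul_const, integral_complex_ofReal]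
    · have h3 : ∀ k, ∫ y in Set.Ioo (0 : ℝ) (1 / 2), ‖((w y * (1 - y) ^ k : ℝ) : ℂ) * hcomp k F z‖ =
          c k * ‖hcomp k F z‖ := by
        intro k
        rw [← integral_mul_const]
        refine setIntegral_congr_fun measurableSet_Ioo fun y hy => ?_
        obtain ⟨h1, -⟩ := hw0 y hy
        have h3 : 0 ≤ 1 - y := by linarith [hy.2]
        rw [norm_mul, Complex.norm_real, Real.norm_of_nonneg (by positivity)]
      simp only [h3]
      refine Summable.of_norm_bounded (hs.mul_left (c 0)) fun k => ?_
      rw [norm_mul, norm_norm]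
      gcongr
      exact hc0 k
  have hem := isMultiplier_of_decay heK
  have hkey : multFun (fun k => (pochRatio (b + τ) b k : ℂ)) F z = multFun e F z +
      A * ∫ y in Set.Ioo (0 : ℝ) (1 / 2), (w y : ℂ) * F (((1 - y : ℝ) : ℂ) • z) := by
    refine (hasSum_of_eq (fun k => ?_)
      ((hasSum_multFun hem hF hz).add (hsum.mul_left (A : ℂ)))).tsum_eq
    simp only [he]
    push_cast
    ring
  rw [hkey]
  refine (enorm_add_le _ _).trans ?_
  rw [enorm_mul, mul_assoc]
  gcongr _ + _ * ?_
  refine (enorm_integral_le_lintegral_enorm _).trans ?_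
  rw [radialIntegral, ← lintegral_const_mul' _ _ ENNReal.ofReal_ne_top]
  refine setLIntegral_mono' measurableSet_Ioo fun y hy => ?_
  obtain ⟨h1, h2⟩ := hw0 y hy
  rw [enorm_mul, ← mul_assoc, ← ENNReal.ofReal_mul (by positivity), ← ofReal_norm (w y : ℂ),
    Complex.norm_real, Real.norm_of_nonneg h1]
  gcongr

/-- The operator with multiplier `(b)_k / (b + τ)_k` lowers the exponent of a Carleson condition by
`q τ`. -/
lemma CarlesonLE.multOp_of_lt (hn : 1 ≤ n) {q : ℝ} (hq : 1 < q) {δ₀ b τ : ℝ} (hτ : 0 < τ)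
    (hb : ∀ k : ℕ, b + k ≠ 0) (hc : ∀ k : ℕ, b + τ + k ≠ 0) (hδ : -1 < δ₀ - q * τ) :
    ∃ C : ℝ≥0∞, C ≠ ∞ ∧ ∀ (f : HolBall n) (M : ℝ≥0∞),
    CarlesonLE δ₀ (fun z => ‖ext f z‖ₑ ^ q) M → CarlesonLE (δ₀ - q * τ)
      (fun z => ‖ext (multOp (isMultiplier_pochRatio (b + τ) b) f) z‖ₑ ^ q) (C * M) := by
  obtain ⟨A, K, e, hA, he, h⟩ := enorm_multFun_pochRatio_le (n := n) hτ hb hc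
  obtain ⟨C₁, hC₁, h₁⟩ := CarlesonLE.radialIntegral hn hq hτ hδ
  obtain ⟨C₂, hC₂, h₂⟩ := CarlesonLE.multFun_of_decay hn hq δ₀ hδ he
  refine ⟨2 ^ (q - 1) * (C₂ + A ^ q * C₁), ?_, fun f M hM => ?_⟩
  · exact ENNReal.mul_ne_top (ENNReal.rpow_ne_top_of_nonneg (by linarith) (by norm_num))
      (ENNReal.add_ne_top.2 ⟨hC₂, ENNReal.mul_ne_top
        (ENNReal.rpow_ne_top_of_nonneg (by linarith) hA) hC₁⟩)
  have hF := differentiableOn_ext f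
  have hFm := measurable_ext f
  have hem := isMultiplier_of_decay he
  have h3 := (h₂ _ M hF hFm hM).mono (G' := fun z => ‖ext (multOp hem f) z‖ₑ ^ q)
    (fun z hz => by rw [ext_multOp hem f hz]) le_rfl
  have h4 := h3.rpow_add hq.le (measurable_ext _).enorm
    ((h₁ _ M hF hFm hM).rpow_const_mul hq.le hA)
  refine h4.mono (fun z hz => ?_) (le_of_eq (by ring))
  refine ENNReal.rpow_le_rpow ?_ (by linarith)
  rw [ext_multOp _ _ hz, ext_multOp _ _ hz]
  exact h _ hF z hz

/-- Composition of two multipliers preserving Carleson conditions. -/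
lemma CarlesonLE.multOp_trans {q δ₀ δ₁ δ₂ a b c : ℝ} (hb : ∀ k : ℕ, b + k ≠ 0)
    (h₁ : ∃ C : ℝ≥0∞, C ≠ ∞ ∧ ∀ (f : HolBall n) (M : ℝ≥0∞),
      CarlesonLE δ₀ (fun z => ‖ext f z‖ₑ ^ q) M → CarlesonLE δ₁
      (fun z => ‖ext (multOp (isMultiplier_pochRatio a b) f) z‖ₑ ^ q) (C * M))
    (h₂ : ∃ C : ℝ≥0∞, C ≠ ∞ ∧ ∀ (f : HolBall n) (M : ℝ≥0∞),
      CarlesonLE δ₁ (fun z => ‖ext f z‖ₑ ^ q) M → CarlesonLE δ₂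
      (fun z => ‖ext (multOp (isMultiplier_pochRatio b c) f) z‖ₑ ^ q) (C * M)) :
    ∃ C : ℝ≥0∞, C ≠ ∞ ∧ ∀ (f : HolBall n) (M : ℝ≥0∞),
      CarlesonLE δ₀ (fun z => ‖ext f z‖ₑ ^ q) M → CarlesonLE δ₂
      (fun z => ‖ext (multOp (isMultiplier_pochRatio a c) f) z‖ₑ ^ q) (C * M) := by
  obtain ⟨C₁, hC₁, h₁⟩ := h₁
  obtain ⟨C₂, hC₂, h₂⟩ := h₂
  refine ⟨C₂ * C₁, ENNReal.mul_ne_top hC₂ hC₁, fun f M hM => ?_⟩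
  have h3 : multOp (isMultiplier_pochRatio b c) (multOp (isMultiplier_pochRatio a b) f) =
      multOp (isMultiplier_pochRatio a c) f := by
    refine eq_of_hcomp_eq fun k z hz => ?_
    rw [hcomp_multOp _ _ hz, hcomp_multOp _ _ hz, hcomp_multOp _ _ hz,
      ← pochRatio_mul (a := a) (c := c) hb]
    push_cast
    ring
  rw [← h3, mul_assoc]
  exact h₂ _ _ (h₁ f M hM)

/-- The operator with multiplier `(a + N)_k / (a)_k` raises the exponent of a Carleson condition by
`q N`. -/
lemma CarlesonLE.multOp_add_nat (hn : 1 ≤ n) {q : ℝ} (hq : 1 < q) (δ₀ : ℝ) {a : ℝ}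
    (ha : ∀ k : ℕ, a + k ≠ 0) (N : ℕ) : ∃ C : ℝ≥0∞, C ≠ ∞ ∧ ∀ (f : HolBall n) (M : ℝ≥0∞),
    CarlesonLE δ₀ (fun z => ‖ext f z‖ₑ ^ q) M → CarlesonLE (δ₀ + q * N)
      (fun z => ‖ext (multOp (isMultiplier_pochRatio a (a + N)) f) z‖ₑ ^ q) (C * M) := by
  induction N with
  | zero =>
    refine ⟨1, by norm_num, fun f M hM => ?_⟩
    have h : multOp (isMultiplier_pochRatio a (a + (0 : ℕ))) f = f := by
      refine eq_of_hcomp_eq fun k z hz => ?_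
      rw [hcomp_multOp _ _ hz, Nat.cast_zero, add_zero, pochRatio_self ha]
      simp
    rw [h, one_mul, Nat.cast_zero, mul_zero, add_zero]
    exact hM
  | succ N ih =>
    have hN : ∀ k : ℕ, a + N + k ≠ 0 := fun k => by
      have := ha (N + k); push_cast at this; rwa [← add_assoc] at this
    have h := CarlesonLE.multOp_trans hN ih
      (CarlesonLE.multOp_succ hn hq (δ₀ + q * N) hN)
    rw [show a + (N + 1 : ℕ) = a + N + 1 by push_cast; ring,
      show δ₀ + q * (N + 1 : ℕ) = δ₀ + q * N + q by push_cast; ring]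
    exact h

/-- Fractional differentiation of order `b - a` maps the Carleson condition of exponent `δ₀` to that
of exponent `δ₀ + q (b - a)`. Differentiation of integral order comes before fractional integration,
so that the intermediate exponent stays above `-1`. -/
lemma CarlesonLE.multOp_pochRatio (hn : 1 ≤ n) {q : ℝ} (hq : 1 < q) {δ₀ a b : ℝ}
    (ha : ∀ k : ℕ, a + k ≠ 0) (hb : ∀ k : ℕ, b + k ≠ 0) (hδ : -1 < δ₀ + q * (b - a)) :
    ∃ C : ℝ≥0∞, C ≠ ∞ ∧ ∀ (f : HolBall n) (M : ℝ≥0∞),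
    CarlesonLE δ₀ (fun z => ‖ext f z‖ₑ ^ q) M → CarlesonLE (δ₀ + q * (b - a))
      (fun z => ‖ext (multOp (isMultiplier_pochRatio a b) f) z‖ₑ ^ q) (C * M) := by
  obtain ⟨N, hN⟩ := exists_nat_gt (b - a)
  have hN' : ∀ k : ℕ, a + N + k ≠ 0 := fun k => by
    have := ha (N + k); push_cast at this; rwa [← add_assoc] at this
  have he : b + (a + N - b) = a + N := by ring
  have h := CarlesonLE.multOp_of_lt hn hq (δ₀ := δ₀ + q * N) (b := b) (τ := a + N - b) (by linarith)
    hb (by rwa [he]) (by linarith)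
  rw [he, show δ₀ + q * N - q * (a + N - b) = δ₀ + q * (b - a) by ring] at h
  exact CarlesonLE.multOp_trans hN' (CarlesonLE.multOp_add_nat hn hq δ₀ ha N) h

/-! ### The norm of `CT` and Carleson conditions -/

/-- A Carleson condition for small tubes implies the Carleson condition for all tubes: the small
tubes cover a neighbourhood of the sphere, and the maximum principle controls the rest. -/
lemma exists_carlesonLE_of_small (hn : 1 ≤ n) {q : ℝ} (hq : 1 < q) {δ : ℝ} (hδ : -1 < δ)
    {r₁ : ℝ} (hr₁ : 0 < r₁) (hr₁' : r₁ ≤ 1) : ∃ C : ℝ≥0∞, C ≠ ∞ ∧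
    ∀ (F : Cn n → ℂ) (M : ℝ≥0∞), DifferentiableOn ℂ F (ball 0 1) → Measurable F →
    (∀ ζ : Cn n, ‖ζ‖ = 1 → ∀ r : ℝ, 0 < r → r < r₁ →
      ∫⁻ z in tubeAt ζ r, ‖F z‖ₑ ^ q * ENNReal.ofReal (rho z ^ δ) ≤ M * ENNReal.ofReal (r ^ n)) →
    CarlesonLE δ (fun z => ‖F z‖ₑ ^ q) (C * M) := by
  -- The radius of the inner ball is chosen so that the neighbourhoods `nearSet w`, `|w| = R`, lie
  -- in small tubes.
  set R : ℝ := 1 - r₁ / 64 with hR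
  have hR0 : 0 < R := by linarith
  have hR1 : R < 1 := by linarith
  have hh : 0 < 1 - R ^ 2 := by nlinarith
  obtain ⟨C₁, hC₁, h₁⟩ := enorm_rpow_le_of_le_rho hn hq δ hh
  obtain ⟨C₂, hC₂, h₂⟩ := lintegral_tubeAt_rho_le hn hδ
  obtain ⟨ζ₀, hζ₀⟩ := exists_norm_eq_one hn
  obtain ⟨t, htS, htf, htc⟩ := (isCompact_sphere (0 : Cn n) 1).finite_cover_balls
    (e := r₁ / 4) (by positivity)
  set A : ℝ≥0∞ := ∫⁻ z in ball (0 : Cn n) 1, ENNReal.ofReal (rho z ^ δ) with hA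
  have hAtop : A ≠ ∞ := by
    rw [hA, ← tubeAt_two hζ₀]
    exact ((h₂ ζ₀ hζ₀ 2 two_pos).trans_lt
      (ENNReal.mul_lt_top hC₂.lt_top ENNReal.ofReal_lt_top)).ne
  set B : ℝ≥0∞ := htf.toFinset.card + C₁ * A with hB
  have hBtop : B ≠ ∞ :=
    ENNReal.add_ne_top.2 ⟨ENNReal.natCast_ne_top _, ENNReal.mul_ne_top hC₁ hAtop⟩
  refine ⟨1 + B * ENNReal.ofReal (r₁⁻¹ ^ n), ENNReal.add_ne_top.2 ⟨ENNReal.one_ne_top,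
    ENNReal.mul_ne_top hBtop ENNReal.ofReal_ne_top⟩, fun F M hF hFm hM ζ hζ r hr => ?_⟩
  have hsmall : ∀ ζ : Cn n, ‖ζ‖ = 1 →
      ∫⁻ z in tubeAt ζ (r₁ / 2), ‖F z‖ₑ ^ q * ENNReal.ofReal (rho z ^ δ) ≤ M := by
    intro ζ hζ
    refine (hM ζ hζ (r₁ / 2) (by positivity) (by linarith)).trans
      (mul_le_of_le_one_right zero_le ?_)
    rw [ENNReal.ofReal_le_one]
    exact pow_le_one₀ (by positivity) (by linarith)
  have hsphere : ∀ w ∈ sphere (0 : Cn n) R, ‖F w‖ₑ ^ q ≤ C₁ * M := by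
    intro w hw
    rw [mem_sphere_zero_iff_norm] at hw
    have hrw : rho w = 1 - R ^ 2 := by rw [rho, hw]
    obtain ⟨ω, hω, -, h3⟩ := exists_sphere_point hn (w := w) (by linarith)
    refine (h₁ F hF hFm w (mem_ball_of_rho_pos (by rw [hrw]; exact hh)) hrw.ge).trans ?_
    refine mul_le_mul_right (le_trans (lintegral_mono_set ?_) (hsmall ω hω)) C₁
    rintro v ⟨hv, -, -, hv4⟩
    refine ⟨hv, (h3 v hv).trans_lt ?_⟩
    have : 1 - R ^ 2 ≤ r₁ / 32 := by rw [hR]; nlinarith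
    nlinarith
  have hinner : ∀ z ∈ closedBall (0 : Cn n) R, ‖F z‖ₑ ^ q ≤ C₁ * M := by
    intro z hz
    have hcont : ContinuousOn F (closedBall 0 R) :=
      hF.continuousOn.mono (closedBall_subset_ball hR1)
    have hne : (sphere (0 : Cn n) R).Nonempty :=
      ⟨(R : ℂ) • ζ₀, by rw [mem_sphere_zero_iff_norm, norm_smul, hζ₀, Complex.norm_real,
        Real.norm_of_nonneg hR0.le, mul_one]⟩
    obtain ⟨w, hw, hmax⟩ := (isCompact_sphere (0 : Cn n) R).exists_isMaxOn hne
      ((hcont.mono sphere_subset_closedBall).norm)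
    have hd : DiffContOnCl ℂ F (ball 0 R) := by
      apply DifferentiableOn.diffContOnCl
      rw [closure_ball _ hR0.ne']
      exact hF.mono (closedBall_subset_ball hR1)
    have : Nontrivial (Cn n) := ⟨ζ₀, 0, by rintro rfl; simp at hζ₀⟩
    have h4 : ‖F z‖ ≤ ‖F w‖ := by
      refine Complex.norm_le_of_forall_mem_frontier_norm_le isBounded_ball hd (fun v hv => ?_)
        (by rwa [closure_ball _ hR0.ne'])
      rw [frontier_ball _ hR0.ne'] at hv
      exact hmax hv
    have h5 : ‖F z‖ₑ ≤ ‖F w‖ₑ := by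
      rw [← ofReal_norm, ← ofReal_norm]
      exact ENNReal.ofReal_le_ofReal h4
    exact (ENNReal.rpow_le_rpow h5 (by linarith)).trans (hsphere w hw)
  have hcover : ball (0 : Cn n) 1 ⊆ (⋃ i ∈ htf.toFinset, tubeAt i (r₁ / 2)) ∪
      (closedBall 0 R ∩ ball 0 1) := by
    intro z hz
    by_cases hzR : z ∈ closedBall (0 : Cn n) R
    · exact Or.inr ⟨hzR, hz⟩
    left
    rw [mem_closedBall_zero_iff, not_le] at hzR
    have hz1 := mem_ball_zero_iff.1 hz
    obtain ⟨ω, hω, hzω, -⟩ := exists_sphere_point hn hz1.le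
    obtain ⟨i, hi, hωi⟩ := Set.mem_iUnion₂.1 (htc (mem_sphere_zero_iff_norm.2 hω))
    refine Set.mem_iUnion₂.2 ⟨i, by simpa using hi, hz, ?_⟩
    have hi1 : ‖i‖ = 1 := mem_sphere_zero_iff_norm.1 (htS hi)
    have h6 : 1 - herm z i = herm (i - z) i := by
      rw [herm_sub_left, herm_self, hi1]; simp
    rw [mem_ball, dist_eq_norm] at hωi
    have h7 : ‖z - ω‖ = 1 - ‖z‖ := by
      have : z - ω = ((‖z‖ - 1 : ℝ) : ℂ) • ω := by
        conv_lhs => rw [hzω]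
        push_cast
        rw [sub_smul, one_smul]
      rw [this, norm_smul, hω, mul_one, Complex.norm_real, Real.norm_of_nonpos (by linarith)]
      ring
    rw [h6]
    calc ‖herm (i - z) i‖ ≤ ‖i - z‖ := by
          simpa [hi1] using norm_herm_le (i - z) i
      _ = ‖(z - ω) + (ω - i)‖ := by rw [sub_add_sub_cancel, norm_sub_rev]
      _ ≤ ‖z - ω‖ + ‖ω - i‖ := norm_add_le _ _
      _ < r₁ / 2 := by rw [h7]; linarith
  have htotal : ∫⁻ z in ball (0 : Cn n) 1, ‖F z‖ₑ ^ q * ENNReal.ofReal (rho z ^ δ) ≤ B * M := by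
    refine (lintegral_mono_set hcover).trans ((lintegral_union_le _ _ _).trans ?_)
    rw [hB, add_mul]
    refine add_le_add ?_ ?_
    · have h8 := lintegral_iUnion_le (μ := (volume : Measure (Cn n)))
        (fun i : htf.toFinset => tubeAt (i : Cn n) (r₁ / 2))
        (fun z => ‖F z‖ₑ ^ q * ENNReal.ofReal (rho z ^ δ))
      rw [Set.iUnion_subtype, tsum_fintype] at h8
      have h9 : ∀ i : htf.toFinset, ∫⁻ z in tubeAt (i : Cn n) (r₁ / 2),
          ‖F z‖ₑ ^ q * ENNReal.ofReal (rho z ^ δ) ≤ M := fun i =>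
        hsmall i (mem_sphere_zero_iff_norm.1 (htS (htf.mem_toFinset.1 i.2)))
      refine h8.trans ((Finset.sum_le_card_nsmul _ _ M fun i _ => h9 i).trans (le_of_eq ?_))
      rw [nsmul_eq_mul, Finset.card_univ, Fintype.card_coe]
    · calc ∫⁻ z in closedBall (0 : Cn n) R ∩ ball 0 1, ‖F z‖ₑ ^ q * ENNReal.ofReal (rho z ^ δ)
          ≤ ∫⁻ z in closedBall (0 : Cn n) R ∩ ball 0 1, C₁ * M * ENNReal.ofReal (rho z ^ δ) := by
            refine setLIntegral_mono' (measurableSet_closedBall.inter measurableSet_ball)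
              fun z hz => ?_
            gcongr
            exact hinner z hz.1
        _ ≤ ∫⁻ z in ball (0 : Cn n) 1, C₁ * M * ENNReal.ofReal (rho z ^ δ) :=
            lintegral_mono_set Set.inter_subset_right
        _ = C₁ * A * M := by
            rw [lintegral_const_mul _ (measurable_rho.pow_const _).ennreal_ofReal]
            ring
  rcases lt_or_ge r r₁ with h | h
  · refine (hM ζ hζ r hr h).trans ?_
    gcongr
    exact le_mul_of_one_le_left zero_le le_self_add
  · calc ∫⁻ z in tubeAt ζ r, ‖F z‖ₑ ^ q * ENNReal.ofReal (rho z ^ δ) ≤ B * M :=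
          (lintegral_mono_set fun z hz => hz.1).trans htotal
      _ ≤ B * M * (ENNReal.ofReal (r₁⁻¹ ^ n) * ENNReal.ofReal (r ^ n)) := by
          refine le_mul_of_one_le_right zero_le ?_
          rw [← ENNReal.ofReal_mul (by positivity), ← mul_pow, ENNReal.one_le_ofReal]
          refine one_le_pow₀ ?_
          rwa [inv_mul_eq_div, one_le_div hr₁]
      _ = B * ENNReal.ofReal (r₁⁻¹ ^ n) * M * ENNReal.ofReal (r ^ n) := by ring
      _ ≤ _ := by
          gcongr
          exact le_add_self

/-- Integrals against the normalized measure of the ball. -/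
lemma setLIntegral_ballMeasure {S : Set (Cn n)} (hS : MeasurableSet S) (hS1 : S ⊆ ball 0 1)
    {G : Cn n → ℝ≥0∞} :
    ∫⁻ z in (Subtype.val ⁻¹' S : Set (Ball n)), G z ∂(ballMeasure n) =
      (volume (ball (0 : Cn n) 1))⁻¹ * ∫⁻ z in S, G z := by
  have hS' : MeasurableSet (Subtype.val ⁻¹' S : Set (Ball n)) := hS.preimage measurable_subtype_coe
  rw [ballMeasure, Measure.restrict_smul, lintegral_smul_measure, smul_eq_mul,
    ← lintegral_indicator hS', ← lintegral_indicator hS]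
  congr 1
  have h1 := lintegral_subtype_comap (μ := (volume : Measure (Cn n)))
    (measurableSet_ball (x := (0 : Cn n)) (ε := 1)) (S.indicator G)
  rw [setLIntegral_eq_of_support_subset (Set.support_indicator_subset.trans hS1)] at h1
  rw [← h1]
  rfl

/-- The quantity `(1 - |u|²)^{-n} ∫_{Q(u)} |f|^q (1 - |z|²)^{n+α} dV` whose supremum over `u`
enters the norm. -/
def tubeMean (q α : ℝ) (f : HolBall n) (u : Ball n) : ℝ≥0∞ :=
  ENNReal.ofReal (1 / (1 - ‖(u : Cn n)‖ ^ 2) ^ n) *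
      ∫⁻ z in tube u,
        ‖f.1 z‖ₑ ^ q * ENNReal.ofReal ((1 - ‖(z : Cn n)‖ ^ 2) ^ ((n : ℝ) + α))
        ∂(ballMeasure n)

/-- `tubeMean` in terms of integrals over subsets of `ℂⁿ`. -/
lemma tubeMean_eq (q α : ℝ) (f : HolBall n) {u : Ball n} {S : Set (Cn n)}
    (hS : MeasurableSet S) (hS1 : S ⊆ ball 0 1) (hu : tube u = Subtype.val ⁻¹' S) :
    tubeMean q α f u = ENNReal.ofReal (1 / rho (u : Cn n) ^ n) *
      ((volume (ball (0 : Cn n) 1))⁻¹ *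
        ∫⁻ z in S, ‖ext f z‖ₑ ^ q * ENNReal.ofReal (rho z ^ ((n : ℝ) + α))) := by
  rw [tubeMean, hu, ← setLIntegral_ballMeasure hS hS1]
  simp only [ext_coe]
  rfl

lemma tube_eq {u : Ball n} (hu : (u : Cn n) ≠ 0) :
    tube u = Subtype.val ⁻¹' tubeAt (((‖(u : Cn n)‖⁻¹ : ℝ) : ℂ) • (u : Cn n)) (rho (u : Cn n)) := by
  ext z
  rw [tube, if_neg hu]
  exact ⟨fun h => ⟨z.2, h⟩, fun h => h.2⟩

lemma norm_inv_norm_smul {u : Cn n} (hu : u ≠ 0) : ‖((‖u‖⁻¹ : ℝ) : ℂ) • u‖ = 1 := by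
  rw [norm_smul, Complex.norm_real, norm_inv, norm_norm, inv_mul_cancel₀ (norm_ne_zero_iff.2 hu)]

/-- A Carleson condition bounds the norm: the tubes `Q(u)` are among the tubes `tubeAt`. -/
lemma ctNorm_rpow_le_of_carlesonLE (hn : 1 ≤ n) (γ : ℝ) {q : ℝ} (hq : 1 < q) (α : ℝ) :
    ∃ C : ℝ≥0∞, C ≠ ∞ ∧ ∀ (f : HolBall n) (M : ℝ≥0∞),
    CarlesonLE ((n : ℝ) + α) (fun z => ‖ext f z‖ₑ ^ q) M → ctNorm γ q α f ^ q ≤ C * M := by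
  obtain ⟨ζ₀, hζ₀⟩ := exists_norm_eq_one hn
  set V := (volume (ball (0 : Cn n) 1))⁻¹ with hV
  have hVtop : V ≠ ∞ := ENNReal.inv_ne_top.2 (measure_ball_pos _ _ one_pos).ne'
  refine ⟨V * ENNReal.ofReal (2 ^ n), ENNReal.mul_ne_top hVtop ENNReal.ofReal_ne_top,
    fun f M hM => ?_⟩
  have hq0 : 0 < q := by linarith
  have hu : ∀ u : Ball n, tubeMean q α f u ≤ V * ENNReal.ofReal (2 ^ n) * M := by
    intro u
    have h0 := rho_pos u.2
    by_cases hu0 : (u : Cn n) = 0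
    · rw [tubeMean_eq q α f (S := tubeAt ζ₀ 2) (measurableSet_tubeAt _ _) (fun z hz => hz.1)
        (by rw [tubeAt_two hζ₀, tube, if_pos hu0]; ext z; simp)]
      have h1 := hM ζ₀ hζ₀ 2 two_pos
      have h2 : rho (u : Cn n) = 1 := by rw [rho, hu0]; simp
      rw [h2, one_pow, div_one, ENNReal.ofReal_one, one_mul, mul_assoc, mul_comm _ M]
      exact mul_le_mul_right h1 V
    · rw [tubeMean_eq q α f (measurableSet_tubeAt _ _) (fun z hz => hz.1) (tube_eq hu0)]
      have h1 := hM _ (norm_inv_norm_smul hu0) _ h0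
      calc _ ≤ ENNReal.ofReal (1 / rho (u : Cn n) ^ n) *
            (V * (M * ENNReal.ofReal (rho (u : Cn n) ^ n))) := by gcongr
        _ = V * M * (ENNReal.ofReal (1 / rho (u : Cn n) ^ n) *
            ENNReal.ofReal (rho (u : Cn n) ^ n)) := by ring
        _ = V * 1 * M := by
            rw [← ENNReal.ofReal_mul (by positivity), one_div_mul_cancel (by positivity),
              ENNReal.ofReal_one, mul_one, mul_one]
        _ ≤ _ := by
            gcongr
            rw [ENNReal.one_le_ofReal]
            exact one_le_pow₀ one_le_two
  have h2 : ctNorm γ q α f ≤ (V * ENNReal.ofReal (2 ^ n) * M) ^ (1 / q) := by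
    refine essSup_le_of_ae_le _ (Eventually.of_forall fun ζ => ?_)
    refine ENNReal.rpow_le_rpow (iSup₂_le fun u _ => hu u) (by positivity)
  calc _ ≤ ((V * ENNReal.ofReal (2 ^ n) * M) ^ (1 / q)) ^ q := ENNReal.rpow_le_rpow h2 hq0.le
    _ = _ := by rw [← ENNReal.rpow_mul, one_div_mul_cancel hq0.ne', ENNReal.rpow_one]

/-- Normalized surface measure charges nonempty open sets. -/
lemma sphereMeasure_pos {U : Set (Sphere n)} (hU : IsOpen U) (hne : U.Nonempty) :
    sphereMeasure n U ≠ 0 := by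
  rw [sphereMeasure, Measure.smul_apply, smul_eq_mul]
  refine mul_ne_zero (ENNReal.inv_ne_zero.2 (measure_ne_top _ _)) ?_
  exact (hU.measure_pos _ hne).ne'

/-- The norm bounds the mean over each tube whose vertex lies in some approach region; the essential
supremum does no harm, since the set of such approach regions is open. -/
lemma tubeMean_le_ctNorm {γ q : ℝ} (hq : 1 < q) (α : ℝ) (f : HolBall n) {u : Ball n} {ζ : Sphere n}
    (hu : u ∈ korany γ ζ) : tubeMean q α f u ≤ ctNorm γ q α f ^ q := by
  have hq0 : 0 < q := by linarith
  set U : Set (Sphere n) := {ζ | u ∈ korany γ ζ} with hU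
  have hopen : IsOpen U := by
    have hc : Continuous fun ζ : Sphere n => ((u : Cn n), (ζ : Cn n)) :=
      continuous_const.prodMk continuous_subtype_val
    have hc' : Continuous fun ζ : Sphere n => ‖1 - herm (u : Cn n) (ζ : Cn n)‖ :=
      (continuous_const.sub (continuous_herm.comp hc)).norm
    exact isOpen_lt hc' continuous_const
  have hpos := sphereMeasure_pos hopen ⟨ζ, hu⟩
  have hae := ENNReal.ae_le_essSup (μ := sphereMeasure n) (fun ζ : Sphere n =>
    (⨆ u ∈ korany γ ζ, tubeMean q α f u) ^ (1 / q))
  obtain ⟨ζ', h1, h2⟩ : ∃ ζ' ∈ U, (⨆ u ∈ korany γ ζ', tubeMean q α f u) ^ (1 / q) ≤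
      ctNorm γ q α f := by
    by_contra! hcon
    refine hpos (measure_mono_null (fun ζ' h => ?_) hae)
    exact (hcon ζ' h).not_ge
  have h3 : tubeMean q α f u ^ (1 / q) ≤ ctNorm γ q α f :=
    (ENNReal.rpow_le_rpow (le_iSup₂ (f := fun u (_ : u ∈ korany γ ζ') => tubeMean q α f u) u h1)
      (by positivity)).trans h2
  calc tubeMean q α f u = (tubeMean q α f u ^ (1 / q)) ^ q := by
        rw [← ENNReal.rpow_mul, one_div_mul_cancel hq0.ne', ENNReal.rpow_one]
    _ ≤ _ := ENNReal.rpow_le_rpow h3 hq0.le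

/-- The norm bounds the Carleson constant. A tube of small size `r` at `ζ` is the tube `Q(u)` of
`u = √(1 - r) ζ`, which lies in the approach region at `ζ` if `r < 2 - 2 / γ`. -/
lemma exists_carlesonLE_ctNorm (hn : 1 ≤ n) {γ : ℝ} (hγ : 1 < γ) {q : ℝ} (hq : 1 < q) {α : ℝ}
    (hα : -1 < (n : ℝ) + α) : ∃ C : ℝ≥0∞, C ≠ ∞ ∧ ∀ f : HolBall n,
    CarlesonLE ((n : ℝ) + α) (fun z => ‖ext f z‖ₑ ^ q) (C * ctNorm γ q α f ^ q) := by
  set V := volume (ball (0 : Cn n) 1) with hV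
  have hV0 : V ≠ 0 := (measure_ball_pos _ _ one_pos).ne'
  have hVtop : V ≠ ∞ := measure_ball_lt_top.ne
  set r₁ : ℝ := min 1 (2 - 2 / γ) with hr₁
  have hγ0 : 0 < γ := by linarith
  have hγ2 : 2 / γ < 2 := by rw [div_lt_iff₀ hγ0]; linarith
  obtain ⟨C, hC, h⟩ := exists_carlesonLE_of_small hn hq hα (r₁ := r₁)
    (lt_min one_pos (by linarith)) (min_le_left _ _)
  refine ⟨C * V, ENNReal.mul_ne_top hC hVtop, fun f => ?_⟩
  rw [mul_assoc]
  refine h _ _ (differentiableOn_ext f) (measurable_ext f) fun ζ hζ r hr hr1 => ?_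
  have hr2 : r < 1 := hr1.trans_le (min_le_left _ _)
  have hr3 : r < 2 - 2 / γ := hr1.trans_le (min_le_right _ _)
  -- The vertex of the tube `T(ζ, r)`.
  set x : ℝ := √(1 - r) with hx
  have hx0 : 0 < x := Real.sqrt_pos.2 (by linarith)
  have hx2 : x ^ 2 = 1 - r := Real.sq_sqrt (by linarith)
  have hx1 : x < 1 := by nlinarith
  set u : Cn n := (x : ℂ) • ζ with hu
  have hun : ‖u‖ = x := by
    rw [hu, norm_smul, hζ, mul_one, Complex.norm_real, Real.norm_of_nonneg hx0.le]
  have hub : u ∈ ball (0 : Cn n) 1 := by rw [mem_ball_zero_iff, hun]; exact hx1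
  have hu0 : u ≠ 0 := by rw [← norm_pos_iff, hun]; exact hx0
  have hrho : rho u = r := by rw [rho, hun, hx2]; ring
  have hdir : ((‖u‖⁻¹ : ℝ) : ℂ) • u = ζ := by
    rw [hun, hu, smul_smul, ← Complex.ofReal_mul, inv_mul_cancel₀ hx0.ne', Complex.ofReal_one,
      one_smul]
  have hkor : (⟨u, hub⟩ : Ball n) ∈ korany γ (⟨ζ, mem_sphere_zero_iff_norm.2 hζ⟩ : Sphere n) := by
    change ‖1 - herm u ζ‖ < γ / 2 * (1 - ‖u‖ ^ 2)
    have h1 : 1 - herm u ζ = ((1 - x : ℝ) : ℂ) := by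
      rw [hu, herm_smul_left, herm_self, hζ]; push_cast; ring
    rw [h1, Complex.norm_real, Real.norm_of_nonneg (by linarith), hun]
    have h2 : 2 / γ < 1 + x := by nlinarith
    rw [div_lt_iff₀ hγ0] at h2
    nlinarith
  have h1 := tubeMean_le_ctNorm hq α f hkor
  rw [tubeMean_eq q α f (measurableSet_tubeAt _ _) (fun z hz => hz.1) (tube_eq hu0)] at h1
  simp only [hdir, hrho] at h1
  set I := ∫⁻ z in tubeAt ζ r, ‖ext f z‖ₑ ^ q * ENNReal.ofReal (rho z ^ ((n : ℝ) + α)) with hI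
  calc I = V * V⁻¹ * (ENNReal.ofReal (r ^ n) * ENNReal.ofReal (1 / r ^ n)) * I := by
        rw [ENNReal.mul_inv_cancel hV0 hVtop, ← ENNReal.ofReal_mul (by positivity),
          mul_one_div_cancel (by positivity), ENNReal.ofReal_one, one_mul, one_mul]
    _ = V * (ENNReal.ofReal (1 / r ^ n) * (V⁻¹ * I)) * ENNReal.ofReal (r ^ n) := by ring
    _ ≤ _ := by gcongr

/-- Fractional differentiation of order `b - a` is bounded from `CT_{q,α}` to `CT_{q,α+q(b-a)}`. -/
lemma exists_ctNorm_multOp_le (hn : 1 ≤ n) {γ : ℝ} (hγ : 1 < γ) {q : ℝ} (hq : 1 < q) {α a b : ℝ}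
    (ha : ∀ k : ℕ, a + k ≠ 0) (hb : ∀ k : ℕ, b + k ≠ 0) (hα : -1 < (n : ℝ) + α)
    (hα' : -1 < (n : ℝ) + (α + q * (b - a))) : ∃ C : ℝ, 0 < C ∧ ∀ f : HolBall n,
    ctNorm γ q (α + q * (b - a)) (multOp (isMultiplier_pochRatio a b) f) ≤
      ENNReal.ofReal C * ctNorm γ q α f := by
  obtain ⟨C₁, hC₁, h₁⟩ := exists_carlesonLE_ctNorm hn hγ hq hα
  obtain ⟨C₂, hC₂, h₂⟩ := CarlesonLE.multOp_pochRatio (n := n) hn hq (δ₀ := n + α) ha hb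
    (by rwa [add_assoc])
  obtain ⟨C₃, hC₃, h₃⟩ := ctNorm_rpow_le_of_carlesonLE hn γ hq (α + q * (b - a))
  have hq0 : 0 < q := by linarith
  set C := (C₃ * (C₂ * C₁)) ^ (1 / q) with hC
  have hCtop : C ≠ ∞ := ENNReal.rpow_ne_top_of_nonneg (by positivity)
    (ENNReal.mul_ne_top hC₃ (ENNReal.mul_ne_top hC₂ hC₁))
  refine ⟨C.toReal + 1, by positivity, fun f => ?_⟩
  have h4 := h₂ f _ (h₁ f)
  rw [add_assoc] at h4
  have h5 := h₃ _ _ h4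
  have h6 := ENNReal.rpow_le_rpow h5 (show 0 ≤ 1 / q by positivity)
  rw [← ENNReal.rpow_mul, mul_one_div_cancel hq0.ne', ENNReal.rpow_one, ← mul_assoc C₂,
    ← mul_assoc C₃, ENNReal.mul_rpow_of_nonneg _ _ (by positivity), ← ENNReal.rpow_mul,
    mul_one_div_cancel hq0.ne', ENNReal.rpow_one, ← hC] at h6
  refine h6.trans ?_
  gcongr
  rw [← ENNReal.ofReal_toReal hCtop]
  exact ENNReal.ofReal_le_ofReal (by simp)

end HoloTent
end


theorem mainTheorem9 (n : ℕ) (hn : 1 ≤ n) (γ : ℝ) (hγ : 1 < γ) (q α s t : ℝ) (hq : 1 < q)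
    (hα : -(n : ℝ) - 1 < α)
    (hs : ∀ m : ℕ, (n : ℝ) + s ≠ -((m : ℝ) + 1))
    (hst : ∀ m : ℕ, (n : ℝ) + s + t ≠ -((m : ℝ) + 1))
    (ht : 0 < q * t + n + 1 + α) :
    (∃! R : HoloTent.HolBall n →L[ℂ] HoloTent.HolBall n, HoloTent.IsFracDiff n s t R) ∧
    (∀ f : HoloTent.HolBall n,
      f ∈ HoloTent.CT n γ q α ↔ HoloTent.fracDiff n s t f ∈ HoloTent.CT n γ q (α + q * t)) ∧
    ∃ c C : ℝ, 0 < c ∧ 0 < C ∧ ∀ f ∈ HoloTent.CT n γ q α,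
      ENNReal.ofReal c * HoloTent.ctNorm γ q α f
          ≤ HoloTent.ctNorm γ q (α + q * t) (HoloTent.fracDiff n s t f) ∧
      HoloTent.ctNorm γ q (α + q * t) (HoloTent.fracDiff n s t f)
          ≤ ENNReal.ofReal C * HoloTent.ctNorm γ q α f := by
  have ha : ∀ k : ℕ, ((n : ℝ) + 1 + s) + k ≠ 0 := fun k h => hs k (by linarith)
  have hb : ∀ k : ℕ, ((n : ℝ) + 1 + s + t) + k ≠ 0 := fun k h => hst k (by linarith)
  have hfrac := HoloTent.fracDiff_eq t ha
  have hd : (n : ℝ) + 1 + s + t - (n + 1 + s) = t := by ring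
  have hd' : (n : ℝ) + 1 + s - (n + 1 + s + t) = -t := by ring
  obtain ⟨C, hC, hle⟩ := HoloTent.exists_ctNorm_multOp_le hn hγ hq (α := α) ha hb (by linarith)
    (by rw [hd]; linarith)
  obtain ⟨C', hC', hge⟩ := HoloTent.exists_ctNorm_multOp_le hn hγ hq (α := α + q * t) hb ha
    (by linarith) (by rw [hd']; linarith)
  rw [hd] at hle
  rw [hd', show α + q * t + q * -t = α by ring] at hge
  rw [hfrac]
  have hge' : ∀ f : HoloTent.HolBall n, HoloTent.ctNorm γ q α f ≤ ENNReal.ofReal C' *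
      HoloTent.ctNorm γ q (α + q * t) (HoloTent.multOp (HoloTent.isMultiplier_pochRatio
        (n + 1 + s) (n + 1 + s + t)) f) := fun f => by
    have h := hge (HoloTent.multOp (HoloTent.isMultiplier_pochRatio (n + 1 + s) (n + 1 + s + t)) f)
    rwa [HoloTent.multOp_pochRatio_comp ha hb] at h
  refine ⟨HoloTent.existsUnique_isFracDiff t ha, fun f => ⟨fun hf => ?_, fun hf => ?_⟩,
    C'⁻¹, C, inv_pos.2 hC', hC, fun f _ => ⟨?_, hle f⟩⟩
  · exact (hle f).trans_lt (ENNReal.mul_lt_top ENNReal.ofReal_lt_top hf)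
  · exact (hge' f).trans_lt (ENNReal.mul_lt_top ENNReal.ofReal_lt_top hf)
  · calc _ ≤ ENNReal.ofReal C'⁻¹ * (ENNReal.ofReal C' * _) := mul_le_mul_right (hge' f) _
      _ = _ := by
        rw [← mul_assoc, ← ENNReal.ofReal_mul (by positivity), inv_mul_cancel₀ hC'.ne',
          ENNReal.ofReal_one, one_mul]
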